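/- Let $c>0$ and let $\Omega\subset\mathbb R^3$ be a bounded open set with Lipschitz boundary $\Gamma=\partial\Omega$ and surface measure $\sigma$. Put $T_*=\operatorname{diam}(\Gamma)/c$, let $T\in\mathbb R$, $\tau>0$, and put $I_T=[T-T_*-2\tau,\,T)$. Let $w_\pm:\mathbb R\to[0,\infty)$ be measurable (for instance smooth) with $w_-+w_+=1$, $w_-(t)=1$ for $t<-\tau$ and $w_-(t)=0$ for $t\ge 0$. For a density $\mu$ on $\Gamma\times\mathbb R$ let $$(S\mu)(\mathbf r,t)=\int_\Gamma \frac{\mu(\mathbf r',\,t-|\mathbf r-\mathbf r'|/c)}{4\pi|\mathbf r-\mathbf r'|}\,d\sigma(\mathbf r'),\qquad \mathbf r\in\mathbb R^3,$$ be the retarded single-layer potential. Let $b$ be a real $C^2$ solution of $\partial_t^2 b-c^2\Delta b=0$ in $\Omega^{inc}\times\mathbb R$, where $\Omega^{inc}$ is an open set containing $\overline\Omega$, such that for some $\alpha\in\mathbb R$ we have $b=0$ on $\overline\Omega\times(-\infty,\alpha]$. Let $\psi\in L^2_{loc}(\mathbb R;L^2(\Gamma))$ be real-valued, vanish for $t<\alpha$,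 and satisfy $S\psi=b$ almost everywhere on $\Gamma\times\mathbb R$. Put $$\psi_{-,T}(\mathbf r,t)=w_-(t-T)\psi(\mathbf r,t),\qquad \psi_{*,T}(\mathbf r,t)=w_+(t-T+T_*+\tau)\,w_-(t-T)\,\psi(\mathbf r,t),\qquad h_T=b-S\psi_{-,T}.$$ Assume that $b(\mathbf r,t)=0$ for all $\mathbf r\in\overline\Omega$ and all $t\ge T-T_*-2\tau$. Below, "a.e. on $\overline\Omega\times\mathbb R$" means: for every $\mathbf r\in\Omega$ and almost every $t\in\mathbb R$, and, on the boundary, for $\sigma\times dt$-almost every $(\mathbf r,t)\in\Gamma\times\mathbb R$. Then: 1. The integrals defining $S\psi_{-,T}$ and $S\psi_{*,T}$ converge absolutely a.e. on $\overline\Omega\times\mathbb R$. Wherever either of these integrals fails to converge, $S\psi_{-,T}$, respectively $S\psi_{*,T}$, is assigned the value $0$. 2. $h_T(\mathbf r,t)=-(S\psi_{*,T})(\mathbf r,t)$ for all $\mathbf r\in\overline\Omega$ and $t\ge T-\tau$, and $h_T(\mathbf r,t)=0$ for $t<T-\tau$, a.e. on $\overline\Omega\times\mathbb R$. 3. The temporal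 support of $h_T$ on $\overline\Omega$ lies in $[T-\tau,\,T+T_*]$; that is, $h_T(\mathbf r,t)=0$ for $t\notin[T-\tau,T+T_*]$, a.e. on $\overline\Omega\times\mathbb R$. 4. Consequently $\psi$ for $t\ge T$ is determined by its restriction to $I_T$ alone: if $(\Omega^{inc\prime},b',\alpha',\psi')$ satisfies the same assumptions as $(\Omega^{inc},b,\alpha,\psi)$ (with the same $c,\Omega,T,\tau$) and $\psi=\psi'$ a.e. on $\Gamma\times I_T$, then $\psi=\psi'$ a.e. on $\Gamma\times[T,\infty)$. -/

import Mathlib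

open MeasureTheory Set
open scoped RealInnerProductSpace

noncomputable section

namespace RetardedScattering

/-- Physical space `ℝ³` with its Euclidean norm. -/
abbrev E3 : Type := EuclideanSpace ℝ (Fin 3)

/-- A bounded open set `Ω ⊂ ℝ³` with Lipschitz boundary: near each boundary point `x`, and for a
suitable unit direction `n`, the set `Ω` is the region below the graph of a Lipschitz function over
the plane orthogonal to `n`. The graph function `φ` is evaluated only at the orthogonal projections
`y - ⟪n, y⟫ n` of points `y` onto that plane. -/
structure IsLipschitzObstacle (Ω : Set E3) : Prop where
  isOpen : IsOpen Ω
  isBounded : Bornology.IsBounded Ω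
  locally_graph : ∀ x ∈ frontier Ω, ∃ (n : E3) (φ : E3 → ℝ) (K : NNReal) (ρ : ℝ),
    ‖n‖ = 1 ∧ LipschitzWith K φ ∧ 0 < ρ ∧
      ∀ y ∈ Metric.ball x ρ, (y ∈ Ω ↔ ⟪n, y⟫ < φ (y - ⟪n, y⟫ • n))

/-- The surface measure on `Γ = ∂Ω`: two-dimensional Hausdorff measure, normalised to agree with
area, restricted to `Γ`. -/
def surfaceMeasure (Ω : Set E3) : Measure E3 :=
  (Measure.euclideanHausdorffMeasure 2 : Measure E3).restrict (frontier Ω)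

/-- The product of surface measure on `Γ` and Lebesgue measure in time. -/
def surfaceTimeMeasure (Ω : Set E3) : Measure (E3 × ℝ) :=
  (surfaceMeasure Ω).prod volume

/-- The integrand on `Γ` of the retarded single-layer potential with density `μ`, at the
space-time point `(r, t)`. -/
def retardedIntegrand (c : ℝ) (μ : E3 → ℝ → ℝ) (r : E3) (t : ℝ) (r' : E3) : ℝ :=
  μ r' (t - ‖r - r'‖ / c) / (4 * Real.pi * ‖r - r'‖)

/-- The integral defining the retarded single-layer potential at `(r, t)` converges absolutely. -/
def SingleLayerConverges (c : ℝ) (Ω : Set E3) (μ : E3 → ℝ → ℝ) (r : E3) (t : ℝ) : Prop :=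
  Integrable (retardedIntegrand c μ r t) (surfaceMeasure Ω)

/-- The time-domain single-layer potential
`(S μ)(r, t) = ∫_{-∞}^t ∫_Γ δ((t - t') - |r - r'|/c) / (4π|r - r'|) μ(r', t') dσ(r') dt'
  = ∫_Γ μ(r', t - |r - r'|/c) / (4π|r - r'|) dσ(r')`, for `r ∈ ℝ³`. -/
def singleLayer (c : ℝ) (Ω : Set E3) (μ : E3 → ℝ → ℝ) (r : E3) (t : ℝ) : ℝ :=
  ∫ r', retardedIntegrand c μ r t r' ∂(surfaceMeasure Ω)

/-- `b` is an incident field: a `C²` solution of `∂²b/∂t² - c² Δb = 0` in `Ωinc × ℝ`, where `Ωinc`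
is an open neighbourhood of the closure of `Ω`. -/
structure IsIncidentField (c : ℝ) (Ω Ωinc : Set E3) (b : E3 → ℝ → ℝ) : Prop where
  isOpen : IsOpen Ωinc
  closure_subset : closure Ω ⊆ Ωinc
  contDiffOn : ContDiffOn ℝ 2 (fun p : E3 × ℝ => b p.1 p.2) (Ωinc ×ˢ (univ : Set ℝ))
  wave : ∀ r ∈ Ωinc, ∀ t : ℝ,
    iteratedDeriv 2 (fun s => b r s) t - c ^ 2 * Laplacian.laplacian (fun x => b x t) r = 0

/-- `ψ` is a causal (zero for `t < α`) boundary density in `L²_loc(ℝ; L²(Γ))` that solves the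
time-domain integral equation `S ψ = b` on `Γ × ℝ` (almost everywhere, as usual for such
densities; the trace on `Γ` of the continuous function `b` is its restriction). -/
structure IsCausalDensity (c : ℝ) (Ω : Set E3) (b : E3 → ℝ → ℝ) (α : ℝ) (ψ : E3 → ℝ → ℝ) :
    Prop where
  locally_sq_integrable : ∀ t₀ t₁ : ℝ, MemLp (fun p : E3 × ℝ => ψ p.1 p.2) 2
    ((surfaceMeasure Ω).prod (volume.restrict (Icc t₀ t₁)))
  causal : ∀ᵐ p ∂(surfaceTimeMeasure Ω), p.2 < α → ψ p.1 p.2 = 0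
  equation : ∀ᵐ p ∂(surfaceTimeMeasure Ω), singleLayer c Ω ψ p.1 p.2 = b p.1 p.2

/-- A pair of non-negative window functions with `w₋ + w₊ = 1`, where `w₋ = 1` on `(-∞, -τ)` and
`w₋ = 0` on `[0, ∞)`. Smoothness is not imposed. -/
structure IsWindowPair (τ : ℝ) (wm wp : ℝ → ℝ) : Prop where
  measurable_minus : Measurable wm
  measurable_plus : Measurable wp
  nonneg_minus : ∀ t, 0 ≤ wm t
  nonneg_plus : ∀ t, 0 ≤ wp t
  add_eq_one : ∀ t, wm t + wp t = 1
  minus_eq_one : ∀ t, t < -τ → wm t = 1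
  minus_eq_zero : ∀ t, 0 ≤ t → wm t = 0
  plus_eq_zero : ∀ t, t < -τ → wp t = 0
  plus_eq_one : ∀ t, 0 ≤ t → wp t = 1

/-- `T_* = diam(Γ) / c`. -/
def crossingTime (c : ℝ) (Ω : Set E3) : ℝ := Metric.diam (frontier Ω) / c

/-- The domain-of-dependence interval `I_T = [T - T_* - 2τ, T)`. -/
def dodInterval (c : ℝ) (Ω : Set E3) (τ T : ℝ) : Set ℝ :=
  Ico (T - crossingTime c Ω - 2 * τ) T

/-- `ψ_{-,T}(r, t) = w₋(t - T) ψ(r, t)`. -/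
def psiMinus (wm : ℝ → ℝ) (T : ℝ) (ψ : E3 → ℝ → ℝ) (r : E3) (t : ℝ) : ℝ :=
  wm (t - T) * ψ r t

/-- `ψ_{*,T}(r, t) = w₊(t - T + T_* + τ) w₋(t - T) ψ(r, t)`. -/
def psiStar (c : ℝ) (Ω : Set E3) (τ : ℝ) (wm wp : ℝ → ℝ) (T : ℝ) (ψ : E3 → ℝ → ℝ)
    (r : E3) (t : ℝ) : ℝ :=
  wp (t - T + crossingTime c Ω + τ) * wm (t - T) * ψ r t

/-- `h_T = b - S ψ_{-,T}`. -/
def hT (c : ℝ) (Ω : Set E3) (wm : ℝ → ℝ) (T : ℝ) (b ψ : E3 → ℝ → ℝ) (r : E3) (t : ℝ) : ℝ :=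
  b r t - singleLayer c Ω (psiMinus wm T ψ) r t

/-- `P r t` holds almost everywhere on `closure Ω × ℝ = (Ω ∪ Γ) × ℝ` in the following strong sense:
in the open set `Ω` for every point `r` and almost every time `t`, and on the boundary `Γ` for
almost every `(r, t)` with respect to surface measure times Lebesgue measure. -/
def AEOnClosure (Ω : Set E3) (P : E3 → ℝ → Prop) : Prop :=
  (∀ r ∈ Ω, ∀ᵐ t : ℝ, P r t) ∧ ∀ᵐ p ∂(surfaceTimeMeasure Ω), P p.1 p.2

end RetardedScattering

end

/-! By retardation, `S` observed at time `t` from a point of `closure Ω` only sees the density at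
times in `[t - T_*, t]`, since no point of `closure Ω` is farther than `diam Γ` from a point of `Γ`
(`norm_sub_le_diam_frontier`). Suppose `Sψ = b` is known on all of `closure Ω` and not only on `Γ`
(`IsCausalDensity.aeOnClosure`). Then the claims on `h_T` follow by comparing supports of windows.
For `t < T - τ` one has `w₋ = 1` at every retarded time, so `Sψ_{-,T} = Sψ = b`. For `t ≥ T - τ` one
has `b = 0`, and the factor `w₊` in `ψ_{*,T}` is `1` at every retarded time. For `t > T + T_*` one
has `w₋ = 0` at every retarded time. For the last claim, the density `1_{t ≥ T}(ψ - ψ')` has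
vanishing single-layer potential on `Γ`, and `S` is injective on causal densities
(`ae_eq_zero_of_singleLayer_eq_zero`).

Both analytic facts, the extension of `Sψ = b` into `Ω` and the injectivity of `S`, rest on energy
uniqueness for the Dirichlet problem of the wave equation. Convolution in time with a mollifier
commutes with `S` and turns an `L²` density into one that is smooth in time and dominated, up to any
fixed time, by an `L²(Γ)` function `m`. For the resulting potential `u`, the pair `P = ∂ₜu`, `V =
∇u` solves the acoustic system off `Γ`. Testing the energy balance with a cutoff at distance about
`δ` from the boundary leaves an error `δ⁻¹ ∫ |P V|` over a strip of width `3δ`.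

No trace theorem is used for this error. The gradients of `u` and of `∂ₜu` are dominated by the
potential of `m` with kernel `|x - y|⁻²`, which is in `L²_loc(ℝ³)`
(`lintegral_gradPotential_sq_lt_top`). As `P` tends to zero transversally at almost every boundary
point, it is bounded by the integral of that majorant over a transversal segment of length `O(δ)`.
Hence the strip integral is `o(δ)` (`exists_strip_bound`) and the energy vanishes
(`layer_eq_background`).

For injectivity, this uniqueness in `Ω` and in the exterior makes the potential vanish off `Γ`. Jump
relations are replaced by the weak equation `c⁻²∂ₜ²u - Δu = (density) dσ`, obtained from an exact
radial derivative in polar coordinates (`integral_weakIntegrand`). It shows that the density is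
orthogonal to all test functions (`ae_density_eq_zero`), and the mollification is removed by
Lebesgue differentiation. -/

section

open Filter Topology Metric
open scoped ENNReal NNReal

namespace RetardedScattering

/-! ### Lipschitz graph charts and their surface measure -/

/-- The component of `y` orthogonal to the unit vector `n`. -/
noncomputable def perp (n y : E3) : E3 := y - ⟪n, y⟫ • n

/-- In the ball of radius `ρ` about `x`, the set `D` is the region below the graph of the
`K`-Lipschitz function `φ` in direction `n`. -/
structure IsGraphChart (D : Set E3) (n : E3) (φ : E3 → ℝ) (K : ℝ≥0) (x : E3) (ρ : ℝ) : Prop where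
  norm_eq_one : ‖n‖ = 1
  lipschitz : LipschitzWith K φ
  radius_pos : 0 < ρ
  mem_iff : ∀ y ∈ ball x ρ, (y ∈ D ↔ ⟪n, y⟫ < φ (perp n y))

/-- An open set, not necessarily bounded, whose boundary `Γ` is compact and locally a
Lipschitz graph. -/
structure HasLipschitzBoundary (D Γ : Set E3) : Prop where
  isOpen : IsOpen D
  isCompact : IsCompact Γ
  frontier_eq : frontier D = Γ
  exists_chart : ∀ x ∈ Γ, ∃ n φ K ρ, IsGraphChart D n φ K x ρ

section perp
variable {n : E3} (hn : ‖n‖ = 1)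
include hn

theorem inner_self_unit : ⟪n, n⟫ = 1 := by
  rw [real_inner_self_eq_norm_sq, hn, one_pow]

theorem perp_add_smul (y : E3) (t : ℝ) : perp n (y + t • n) = perp n y := by
  have h := inner_self_unit hn
  simp only [perp, inner_add_right, inner_smul_right, h, mul_one, add_smul]
  abel

theorem inner_add_smul_unit (y : E3) (t : ℝ) : ⟪n, y + t • n⟫ = ⟪n, y⟫ + t := by
  rw [inner_add_right, inner_smul_right, inner_self_unit hn, mul_one]

theorem norm_perp_le (y : E3) : ‖perp n y‖ ≤ ‖y‖ := by
  have h : ‖perp n y‖ ^ 2 ≤ ‖y‖ ^ 2 := by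
    rw [perp, norm_sub_sq_real, inner_smul_right, norm_smul, hn, real_inner_comm]
    simp only [Real.norm_eq_abs, mul_one, sq_abs]
    nlinarith [sq_nonneg ⟪n, y⟫]
  exact le_of_sq_le_sq h (norm_nonneg _)

theorem abs_inner_unit_le (y : E3) : |⟪n, y⟫| ≤ ‖y‖ := by
  simpa [hn] using abs_real_inner_le_norm n y

theorem norm_le_perp_add (y : E3) : ‖y‖ ≤ ‖perp n y‖ + |⟪n, y⟫| := by
  have : y = perp n y + ⟪n, y⟫ • n := by simp [perp]
  calc ‖y‖ = ‖perp n y + ⟪n, y⟫ • n‖ := by rw [← this]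
    _ ≤ _ := by
      refine (norm_add_le _ _).trans ?_
      rw [norm_smul, hn, mul_one, Real.norm_eq_abs]

end perp

theorem perp_sub (n y z : E3) : perp n (y - z) = perp n y - perp n z := by
  simp only [perp, inner_sub_right, sub_smul]; abel

theorem continuous_perp (n : E3) : Continuous (perp n) := by
  unfold perp; fun_prop

theorem perp_neg (n y : E3) : perp (-n) y = perp n y := by
  simp [perp]

namespace IsGraphChart

variable {D : Set E3} {n : E3} {φ : E3 → ℝ} {K : ℝ≥0} {x : E3} {ρ : ℝ}

/-- Continuity of the graph function gives one direction. For the other, a point on or below the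
graph becomes a point strictly below it when pushed along `-n`. -/
theorem mem_closure_iff (h : IsGraphChart D n φ K x ρ) {y : E3} (hy : y ∈ ball x ρ) :
    y ∈ closure D ↔ ⟪n, y⟫ ≤ φ (perp n y) := by
  have hc : Continuous fun y => φ (perp n y) := h.lipschitz.continuous.comp (continuous_perp n)
  constructor
  · intro hyc
    by_contra! hlt
    have hopen : IsOpen ({z | φ (perp n z) < ⟪n, z⟫} ∩ ball x ρ) :=
      (isOpen_lt hc (by fun_prop)).inter isOpen_ball
    obtain ⟨z, ⟨hz, hzb⟩, hzD⟩ := mem_closure_iff_nhds.1 hyc _ (hopen.mem_nhds ⟨hlt, hy⟩)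
    exact absurd ((h.mem_iff z hzb).1 hzD) (not_lt.2 (le_of_lt hz))
  · intro hle
    have hlim : Tendsto (fun t : ℝ => y + (-t) • n) (𝓝[>] 0) (𝓝 y) := by
      have : Continuous fun t : ℝ => y + (-t) • n := by fun_prop
      simpa using (this.tendsto 0).mono_left nhdsWithin_le_nhds
    refine mem_closure_of_tendsto hlim ?_
    filter_upwards [hlim.eventually (isOpen_ball.mem_nhds hy), self_mem_nhdsWithin] with t ht ht0
    rw [h.mem_iff _ ht, perp_add_smul h.norm_eq_one, inner_add_smul_unit h.norm_eq_one]
    have : (0 : ℝ) < t := ht0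
    linarith

theorem mem_frontier_iff (hD : IsOpen D) (h : IsGraphChart D n φ K x ρ) {y : E3}
    (hy : y ∈ ball x ρ) : y ∈ frontier D ↔ ⟪n, y⟫ = φ (perp n y) := by
  rw [hD.frontier_eq, Set.mem_sdiff, h.mem_closure_iff hy, h.mem_iff y hy, not_lt]
  exact ⟨fun h => le_antisymm h.1 h.2, fun h => ⟨h.le, h.ge⟩⟩

theorem closure_compl (h : IsGraphChart D n φ K x ρ) :
    IsGraphChart (closure D)ᶜ (-n) (fun y => -φ y) K x ρ where
  norm_eq_one := by rw [norm_neg, h.norm_eq_one]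
  lipschitz := h.lipschitz.neg
  radius_pos := h.radius_pos
  mem_iff y hy := by
    rw [mem_compl_iff, h.mem_closure_iff hy, not_le, inner_neg_left, perp_neg, neg_lt_neg_iff]

/-- A displacement along `n` does not change `perp`, and on the graph `perp` controls the full
distance. This gives the majorant for one-sided limits of potentials at the boundary. -/
theorem norm_sub_le_of_mem_frontier (hD : IsOpen D) (h : IsGraphChart D n φ K x ρ) {y z : E3}
    (hy : y ∈ ball x ρ) (hz : z ∈ ball x ρ) (hyD : y ∈ frontier D) (hzD : z ∈ frontier D) (t : ℝ) :
    ‖y - z‖ ≤ (1 + K) * ‖y + t • n - z‖ := by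
  have h1 : perp n (y - z) = perp n (y + t • n - z) := by
    rw [perp_sub, perp_sub, perp_add_smul h.norm_eq_one]
  have h2 : |⟪n, y - z⟫| ≤ K * ‖perp n (y - z)‖ := by
    rw [inner_sub_right, (h.mem_frontier_iff hD hy).1 hyD, (h.mem_frontier_iff hD hz).1 hzD,
      perp_sub]
    simpa [Real.dist_eq, dist_eq_norm] using h.lipschitz.dist_le_mul (perp n y) (perp n z)
  calc ‖y - z‖ ≤ ‖perp n (y - z)‖ + |⟪n, y - z⟫| := norm_le_perp_add h.norm_eq_one _
    _ ≤ (1 + K) * ‖perp n (y - z)‖ := by linarith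
    _ ≤ _ := by
      rw [h1]
      exact mul_le_mul_of_nonneg_left (norm_perp_le h.norm_eq_one _) (by positivity)

/-- The line through `z` in direction `n` meets the graph after length `φ (perp n z) - ⟪n, z⟫`.
Comparison with the graph point `y` bounds this by `(K + 1) * δ`, and the smallness of `δ` keeps the
whole segment inside the chart ball. -/
theorem exists_hit (hD : IsOpen D) (h : IsGraphChart D n φ K x ρ) {z y : E3} {δ : ℝ}
    (hz : z ∈ ball x (ρ / 2)) (hzD : z ∈ D) (hy : y ∈ frontier D) (hzy : ‖z - y‖ < δ)
    (hδ : (K + 2) * δ ≤ ρ / 2) :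
    ∃ s, 0 < s ∧ s ≤ (K + 1) * δ ∧ z + s • n ∈ frontier D ∧ z + s • n ∈ ball x ρ ∧
      ∀ t ∈ Ico 0 s, z + t • n ∈ D := by
  have hρ := h.radius_pos
  have hδ0 : 0 < δ := (norm_nonneg _).trans_lt hzy
  have hK : (0 : ℝ) ≤ K := K.2
  have hn := h.norm_eq_one
  have hzx : dist z x < ρ / 2 := hz
  have hzb : z ∈ ball x ρ := ball_subset_ball (by linarith) hz
  have hyb : y ∈ ball x ρ := by
    have h1 := dist_triangle y z x
    rw [dist_comm y z, dist_eq_norm z y] at h1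
    rw [mem_ball]
    nlinarith
  have hzs := (h.mem_iff z hzb).1 hzD
  have hys := (h.mem_frontier_iff hD hyb).1 hy
  set s := φ (perp n z) - ⟪n, z⟫ with hs
  have hs0 : 0 < s := by linarith
  have h1 : |φ (perp n z) - φ (perp n y)| ≤ K * ‖z - y‖ := by
    have := h.lipschitz.dist_le_mul (perp n z) (perp n y)
    rw [Real.dist_eq, dist_eq_norm, ← perp_sub] at this
    exact this.trans (mul_le_mul_of_nonneg_left (norm_perp_le hn _) hK)
  have h2 : |⟪n, z - y⟫| ≤ ‖z - y‖ := abs_inner_unit_le hn _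
  rw [inner_sub_right] at h2
  have h1' := le_abs_self (φ (perp n z) - φ (perp n y))
  have h2' := neg_abs_le (⟪n, z⟫ - ⟪n, y⟫)
  have hsδ : s ≤ (K + 1) * δ := by nlinarith
  have hball : ∀ t ∈ Icc 0 s, z + t • n ∈ ball x ρ := by
    intro t ht
    have h3 : dist (z + t • n) x ≤ t + dist z x := by
      rw [dist_eq_norm, dist_eq_norm, show z + t • n - x = t • n + (z - x) by abel]
      refine (norm_add_le _ _).trans ?_
      rw [norm_smul, hn, Real.norm_eq_abs, abs_of_nonneg ht.1, mul_one]
    rw [mem_ball]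
    have := ht.2
    nlinarith
  refine ⟨s, hs0, hsδ, ?_, hball s ⟨hs0.le, le_rfl⟩, fun t ht => ?_⟩
  · rw [h.mem_frontier_iff hD (hball s ⟨hs0.le, le_rfl⟩), perp_add_smul hn,
      inner_add_smul_unit hn, hs]
    ring
  · rw [h.mem_iff _ (hball t ⟨ht.1, ht.2.le⟩), perp_add_smul hn, inner_add_smul_unit hn]
    have := ht.2
    linarith

/-- The piece of boundary is contained in the image of a planar disc of radius `r` under the graph
map, which is `(1 + K)`-Lipschitz and so enlarges two-dimensional Hausdorff measure by at most `(1 +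
K)²`. -/
theorem exists_measure_le (hD : IsOpen D) (h : IsGraphChart D n φ K x ρ) :
    ∃ C : ℝ≥0∞, C ≠ ∞ ∧ ∀ (y : E3) (r : ℝ), 0 < r →
      μHE[2] (frontier D ∩ ball x ρ ∩ closedBall y r) ≤ C * ENNReal.ofReal (r ^ 2) := by
  have hn := h.norm_eq_one
  let V : Submodule ℝ E3 := (ℝ ∙ n)ᗮ
  have hn0 : n ≠ 0 := by
    intro h0; rw [h0, norm_zero] at hn; exact zero_ne_one hn
  have hV : Module.finrank ℝ V = 2 := by
    have : Fact (Module.finrank ℝ E3 = 2 + 1) := ⟨by simp⟩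
    exact Submodule.finrank_orthogonal_span_singleton hn0
  have hperp : ∀ y, perp n y ∈ V := by
    intro y
    rw [Submodule.mem_orthogonal_singleton_iff_inner_right, perp, inner_sub_right,
      inner_smul_right, inner_self_unit hn]
    ring
  let F : V → E3 := fun a => (a : E3) + φ a • n
  have hF : LipschitzWith (1 + K) F := by
    have h1 : LipschitzWith 1 (fun a : V => (a : E3)) := LipschitzWith.subtype_val _
    refine h1.add (LipschitzWith.of_dist_le_mul fun a b => ?_)
    have h2 := h.lipschitz.dist_le_mul (a : E3) b
    rw [dist_eq_norm, ← sub_smul, norm_smul, hn, mul_one, Real.norm_eq_abs, ← Real.dist_eq]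
    exact h2
  have hvol : (μHE[2] : Measure V) = volume := by
    rw [← InnerProductSpace.euclideanHausdorffMeasure_eq_volume, hV]
  refine ⟨((1 + K : ℝ≥0) : ℝ≥0∞) ^ (2 : ℝ) * volume (ball (0 : V) 1), ?_, fun y r hr => ?_⟩
  · exact ENNReal.mul_ne_top (by simp) measure_ball_lt_top.ne
  have hsub : frontier D ∩ ball x ρ ∩ closedBall y r ⊆
      F '' closedBall (⟨perp n y, hperp y⟩ : V) r := by
    rintro z ⟨⟨hzD, hzx⟩, hzy⟩
    refine ⟨⟨perp n z, hperp z⟩, ?_, ?_⟩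
    · rw [mem_closedBall, Subtype.dist_eq, dist_eq_norm]
      change ‖perp n z - perp n y‖ ≤ r
      rw [← perp_sub]
      exact (norm_perp_le hn _).trans (by rwa [mem_closedBall, dist_eq_norm] at hzy)
    · change perp n z + φ (perp n z) • n = z
      rw [← (h.mem_frontier_iff hD hzx).1 hzD, perp]
      abel
  have hlip : μHE[2] (F '' closedBall (⟨perp n y, hperp y⟩ : V) r) ≤
      ((1 + K : ℝ≥0) : ℝ≥0∞) ^ (2 : ℝ) * μHE[2] (closedBall (⟨perp n y, hperp y⟩ : V) r) := by
    simp only [Measure.euclideanHausdorffMeasure_def, Measure.smul_apply]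
    rw [ENNReal.smul_def, ENNReal.smul_def, smul_eq_mul, smul_eq_mul, mul_left_comm]
    gcongr
    exact hF.hausdorffMeasure_image_le (by norm_num) _
  refine (measure_mono hsub).trans (hlip.trans ?_)
  rw [hvol, Measure.addHaar_closedBall _ _ hr.le, hV, mul_comm (ENNReal.ofReal _), ← mul_assoc]

end IsGraphChart

theorem IsLipschitzObstacle.hasLipschitzBoundary {Ω : Set E3} (h : IsLipschitzObstacle Ω) :
    HasLipschitzBoundary Ω (frontier Ω) where
  isOpen := h.isOpen
  isCompact := isCompact_of_isClosed_isBounded isClosed_frontier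
    (h.isBounded.closure.subset frontier_subset_closure)
  frontier_eq := rfl
  exists_chart x hx := by
    obtain ⟨n, φ, K, ρ, h1, h2, h3, h4⟩ := h.locally_graph x hx
    exact ⟨n, φ, K, ρ, h1, h2, h3, h4⟩

namespace HasLipschitzBoundary

variable {D Γ : Set E3}

/-- This makes the uniqueness argument available in the exterior domain. The frontier does not
shrink when `D` is replaced by its closure, because moving from a boundary point along `n` leaves
the closure at once. -/
theorem closure_compl (h : HasLipschitzBoundary D Γ) : HasLipschitzBoundary (closure D)ᶜ Γ where
  isOpen := isClosed_closure.isOpen_compl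
  isCompact := h.isCompact
  frontier_eq := by
    rw [frontier_compl, ← h.frontier_eq]
    refine subset_antisymm frontier_closure_subset fun y hy => ?_
    refine ⟨subset_closure (frontier_subset_closure hy), fun hint => ?_⟩
    obtain ⟨n, φ, K, ρ, hc⟩ := h.exists_chart y (h.frontier_eq ▸ hy)
    have hyb : y ∈ ball y ρ := mem_ball_self hc.radius_pos
    have hlim : Tendsto (fun t : ℝ => y + t • n) (𝓝[>] 0) (𝓝 y) := by
      have : Continuous fun t : ℝ => y + t • n := by fun_prop
      simpa using (this.tendsto 0).mono_left nhdsWithin_le_nhds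
    obtain ⟨t, ⟨ht1, ht2⟩, ht0⟩ := ((hlim.eventually (isOpen_ball.mem_nhds hyb)).and
      (hlim.eventually (isOpen_interior.mem_nhds hint)) |>.and self_mem_nhdsWithin).exists
    have ht0' : (0 : ℝ) < t := ht0
    have h1 := (hc.mem_closure_iff ht1).1 (interior_subset ht2)
    rw [perp_add_smul hc.norm_eq_one, inner_add_smul_unit hc.norm_eq_one,
      (hc.mem_frontier_iff h.isOpen hyb).1 hy] at h1
    linarith
  exists_chart x hx := by
    obtain ⟨n, φ, K, ρ, hc⟩ := h.exists_chart x hx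
    exact ⟨_, _, _, _, hc.closure_compl⟩

theorem disjoint (h : HasLipschitzBoundary D Γ) : Disjoint D Γ := by
  rw [← h.frontier_eq]
  exact disjoint_iff_inter_eq_empty.2 h.isOpen.inter_frontier_eq

theorem exists_measure_le (h : HasLipschitzBoundary D Γ) :
    ∃ C : ℝ≥0∞, C ≠ ∞ ∧ ∀ (y : E3) (r : ℝ), 0 < r →
      μHE[2] (Γ ∩ closedBall y r) ≤ C * ENNReal.ofReal (r ^ 2) := by
  choose! n φ K ρ hc using h.exists_chart
  obtain ⟨t, htΓ, ht⟩ := h.isCompact.elim_nhds_subcover (fun x => ball x (ρ x))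
    fun x hx => ball_mem_nhds x (hc x hx).radius_pos
  choose! C hC hle using fun x hx => (hc x hx).exists_measure_le h.isOpen
  refine ⟨∑ x ∈ t, C x, ENNReal.sum_ne_top.2 fun x hx => hC x (htΓ x hx), fun y r hr => ?_⟩
  calc μHE[2] (Γ ∩ closedBall y r)
      ≤ μHE[2] (⋃ x ∈ t, frontier D ∩ ball x (ρ x) ∩ closedBall y r) := by
        refine measure_mono fun z hz => ?_
        obtain ⟨x, hx, hzx⟩ := mem_iUnion₂.1 (ht hz.1)
        exact mem_iUnion₂.2 ⟨x, hx, ⟨⟨by rw [h.frontier_eq]; exact hz.1, hzx⟩, hz.2⟩⟩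
    _ ≤ ∑ x ∈ t, μHE[2] (frontier D ∩ ball x (ρ x) ∩ closedBall y r) :=
        measure_biUnion_finset_le _ _
    _ ≤ ∑ x ∈ t, C x * ENNReal.ofReal (r ^ 2) :=
        Finset.sum_le_sum fun x hx => hle x (htΓ x hx) y r hr
    _ = _ := by rw [Finset.sum_mul]

theorem measure_lt_top (h : HasLipschitzBoundary D Γ) : μHE[2] Γ < ∞ := by
  obtain ⟨C, hC, hle⟩ := h.exists_measure_le
  obtain ⟨R, hR0, hR⟩ := h.isCompact.isBounded.subset_closedBall_lt 0 0
  have := hle 0 R hR0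
  rw [inter_eq_left.2 hR] at this
  exact this.trans_lt (ENNReal.mul_lt_top hC.lt_top ENNReal.ofReal_lt_top)

theorem volume_eq_zero (h : HasLipschitzBoundary D Γ) : volume Γ = 0 := by
  have h1 := (Measure.euclideanHausdorffMeasure_zero_or_top (X := E3)
    (show 2 < 3 by norm_num) Γ).resolve_right h.measure_lt_top.ne
  rwa [EuclideanSpace.euclideanHausdorffMeasure_eq_volume] at h1

end HasLipschitzBoundary

/-- Projection along `n` is 1-Lipschitz, so it sends `E` to a null set of the plane orthogonal to
`n`. The preimage of that set, which contains every line in direction `n` meeting `E`, is null in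
space. -/
theorem ae_forall_add_smul_notMem {E : Set E3} (hE : μHE[2] E = 0) {n : E3} (hn : ‖n‖ = 1) :
    ∀ᵐ x : E3, ∀ s : ℝ, x + s • n ∉ E := by
  let V : Submodule ℝ E3 := (ℝ ∙ n)ᗮ
  have hn0 : n ≠ 0 := by
    intro h0; rw [h0, norm_zero] at hn; exact zero_ne_one hn
  have hV : Module.finrank ℝ V = 2 := by
    have : Fact (Module.finrank ℝ E3 = 2 + 1) := ⟨by simp⟩
    exact Submodule.finrank_orthogonal_span_singleton hn0
  let P : E3 →L[ℝ] V := V.orthogonalProjectionOnto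
  have hP : LipschitzWith 1 P := by
    refine LipschitzWith.of_dist_le_mul fun a b => ?_
    rw [dist_eq_norm, dist_eq_norm, ← map_sub, NNReal.coe_one, one_mul]
    exact V.norm_orthogonalProjectionOnto_apply_le _
  have hvol : (μHE[2] : Measure V) = volume := by
    rw [← InnerProductSpace.euclideanHausdorffMeasure_eq_volume, hV]
  have h0 : volume (P '' E) = 0 := by
    rw [← hvol]
    have h1 : μH[(2 : ℕ)] E = 0 := by
      rw [Measure.euclideanHausdorffMeasure_def, Measure.smul_apply, ENNReal.smul_def,
        smul_eq_mul, mul_eq_zero] at hE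
      exact hE.resolve_left
        (by simpa using Measure.addHaarScalarFactor_volume_hausdorffMeasure_ne_zero 2)
    rw [Measure.euclideanHausdorffMeasure_def, Measure.smul_apply]
    have := hP.hausdorffMeasure_image_le (d := (2 : ℕ)) (by norm_num) E
    rw [h1, mul_zero, nonpos_iff_eq_zero] at this
    rw [this, smul_zero]
  have hsurj : Function.Surjective (P : E3 →ₗ[ℝ] V) := fun a =>
    ⟨a, V.orthogonalProjectionOnto_mem_subspace_eq_self a⟩
  have h2 : ∀ᵐ x : E3, (P : E3 →ₗ[ℝ] V) x ∈ (toMeasurable volume (P '' E))ᶜ := by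
    rw [ae_comp_linearMap_mem_iff _ volume volume hsurj (measurableSet_toMeasurable _ _).compl]
    exact measure_eq_zero_iff_ae_notMem.1 (by rw [measure_toMeasurable, h0])
  filter_upwards [h2] with x hx s hs
  refine hx (subset_toMeasurable _ _ ⟨x + s • n, hs, ?_⟩)
  have : P n = 0 := by
    rw [Submodule.orthogonalProjectionOnto_eq_zero_iff]
    exact Submodule.le_orthogonal_orthogonal _ (Submodule.mem_span_singleton_self n)
  rw [map_add, map_smul, this, smul_zero, add_zero]
  rfl

/-! ### Weakly singular integrals on the boundary and in space -/

theorem enorm_sub_comm (x y : E3) : ‖x - y‖ₑ = ‖y - x‖ₑ := by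
  rw [← enorm_neg, neg_sub]

/-- Dyadic shells: for `2^(-j-1) < |x - y| ≤ 2^(-j)` the kernel is at most `2^((j+1)a)` and the ball
has measure at most `C 2^(-jd)`, so the series is geometric with ratio `2^(a-d) < 1`. Outside the
unit ball the kernel is at most `1`. -/
theorem exists_lintegral_inv_enorm_rpow_le {μ : Measure E3} [IsFiniteMeasure μ] {d : ℕ} {C : ℝ≥0∞}
    (hC : C ≠ ∞) (hμ : ∀ (y : E3) (r : ℝ), 0 < r → μ (closedBall y r) ≤ C * ENNReal.ofReal (r ^ d))
    {a : ℝ} (ha0 : 0 < a) (had : a < d) :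
    ∃ C' : ℝ≥0∞, C' ≠ ∞ ∧ ∀ x : E3, ∫⁻ y, (‖x - y‖ₑ⁻¹) ^ a ∂μ ≤ C' := by
  have h2a : (2 : ℝ≥0∞) ^ a ≠ ∞ := ENNReal.rpow_ne_top_of_nonneg ha0.le (by simp)
  have hq : (2 : ℝ≥0∞) ^ (a - d) < 1 :=
    ENNReal.rpow_lt_one_of_one_lt_of_neg (by norm_num) (by linarith)
  refine ⟨μ univ + 2 ^ a * C * (1 - 2 ^ (a - d))⁻¹, ?_, fun x => ?_⟩
  · refine ENNReal.add_ne_top.2 ⟨measure_ne_top _ _, ENNReal.mul_ne_top (ENNReal.mul_ne_top h2a hC) ?_⟩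
    rw [ENNReal.inv_ne_top]
    exact (tsub_pos_of_lt hq).ne'
  have hpt : ∀ y, (‖x - y‖ₑ⁻¹) ^ a ≤ 1 + ∑' j : ℕ,
      (closedBall x ((1 / 2 : ℝ) ^ j)).indicator (fun _ => ((2 : ℝ≥0∞) ^ (j + 1)) ^ a) y := by
    intro y
    rcases eq_or_ne (x - y) 0 with h0 | h0
    · have hy : y = x := (sub_eq_zero.1 h0).symm
      -- At the singular point the kernel is infinite, and so is the series, since each of its terms
      -- is at least `1` there.
      have : ∑' j : ℕ, (closedBall x ((1 / 2 : ℝ) ^ j)).indicator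
          (fun _ => ((2 : ℝ≥0∞) ^ (j + 1)) ^ a) y = ∞ := by
        rw [eq_top_iff, ← ENNReal.tsum_const_eq_top_of_ne_zero (α := ℕ) one_ne_zero]
        refine ENNReal.tsum_le_tsum fun j => ?_
        rw [indicator_of_mem (by rw [hy]; exact mem_closedBall_self (by positivity))]
        exact ENNReal.one_le_rpow (one_le_pow₀ (by norm_num)) ha0
      rw [this, add_top]
      exact le_top
    · have hpos : 0 < ‖x - y‖ := norm_pos_iff.2 h0
      rcases le_or_gt ‖x - y‖ 1 with h1 | h1
      · obtain ⟨j, hj1, hj2⟩ := exists_nat_pow_near_of_lt_one hpos h1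
          (show (0 : ℝ) < 1 / 2 by norm_num) (by norm_num)
        refine le_add_left (le_trans ?_ (ENNReal.le_tsum j))
        rw [indicator_of_mem (by rwa [mem_closedBall, dist_comm, dist_eq_norm])]
        refine ENNReal.rpow_le_rpow ?_ ha0.le
        rw [ENNReal.inv_le_iff_inv_le, ENNReal.inv_pow, ← ofReal_norm]
        refine le_trans (le_of_eq ?_) (ENNReal.ofReal_le_ofReal hj1.le)
        rw [ENNReal.ofReal_pow (by norm_num), one_div, ENNReal.ofReal_inv_of_pos (by norm_num)]
        norm_num
      · refine le_add_right ?_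
        refine ENNReal.rpow_le_one ?_ ha0.le
        rw [ENNReal.inv_le_one, ← ofReal_norm, ENNReal.one_le_ofReal]
        exact h1.le
  calc ∫⁻ y, (‖x - y‖ₑ⁻¹) ^ a ∂μ
      ≤ ∫⁻ y, (1 + ∑' j : ℕ, (closedBall x ((1 / 2 : ℝ) ^ j)).indicator
          (fun _ => ((2 : ℝ≥0∞) ^ (j + 1)) ^ a) y) ∂μ := lintegral_mono hpt
    _ = μ univ + ∑' j : ℕ, ((2 : ℝ≥0∞) ^ (j + 1)) ^ a * μ (closedBall x ((1 / 2 : ℝ) ^ j)) := by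
        rw [lintegral_add_left measurable_const, lintegral_tsum
          (fun j => (measurable_const.indicator measurableSet_closedBall).aemeasurable)]
        simp [lintegral_indicator measurableSet_closedBall]
    _ ≤ μ univ + ∑' j : ℕ, 2 ^ a * C * (2 ^ (a - d)) ^ j := by
        refine add_le_add_right (ENNReal.tsum_le_tsum fun j => ?_) _
        refine (mul_le_mul_right (hμ x ((1 / 2 : ℝ) ^ j) (by positivity)) _).trans (le_of_eq ?_)
        have e1 : ENNReal.ofReal (((1 / 2 : ℝ) ^ j) ^ d) = ((2 : ℝ≥0∞) ^ (-(d : ℝ))) ^ j := by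
          rw [← pow_mul, mul_comm, pow_mul, ENNReal.ofReal_pow (by positivity),
            ENNReal.rpow_neg, ENNReal.rpow_natCast, ← ENNReal.inv_pow,
            ENNReal.ofReal_pow (by norm_num), one_div, ENNReal.ofReal_inv_of_pos (by norm_num)]
          norm_num [ENNReal.inv_pow]
        have e2 : ((2 : ℝ≥0∞) ^ (j + 1)) ^ a = 2 ^ a * (2 ^ a) ^ j := by
          rw [← ENNReal.rpow_natCast, ← ENNReal.rpow_natCast, ← ENNReal.rpow_mul,
            ← ENNReal.rpow_mul, ← ENNReal.rpow_add _ _ (by norm_num) (by norm_num)]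
          congr 1; push_cast; ring
        rw [e1, e2, sub_eq_add_neg, ENNReal.rpow_add _ _ (by norm_num) (by norm_num), mul_pow]
        ring
    _ = _ := by rw [ENNReal.tsum_mul_left, ENNReal.tsum_geometric]

theorem HasLipschitzBoundary.exists_lintegral_le {D Γ : Set E3} (h : HasLipschitzBoundary D Γ)
    {a : ℝ} (ha0 : 0 < a) (ha : a < 2) :
    ∃ C : ℝ≥0∞, C ≠ ∞ ∧ ∀ x : E3, ∫⁻ y in Γ, (‖x - y‖ₑ⁻¹) ^ a ∂μHE[2] ≤ C := by
  obtain ⟨C, hC, hle⟩ := h.exists_measure_le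
  have : IsFiniteMeasure ((μHE[2] : Measure E3).restrict Γ) :=
    ⟨by rw [Measure.restrict_apply_univ]; exact h.measure_lt_top⟩
  refine exists_lintegral_inv_enorm_rpow_le (d := 2) hC (fun y r hr => ?_) ha0 (by exact_mod_cast ha)
  rw [Measure.restrict_apply measurableSet_closedBall, inter_comm]
  exact hle y r hr

theorem exists_setLIntegral_volume_le (R : ℝ) {a : ℝ} (ha0 : 0 < a) (ha : a < 3) :
    ∃ C : ℝ≥0∞, C ≠ ∞ ∧ ∀ x : E3, ∫⁻ y in closedBall (0 : E3) R, (‖x - y‖ₑ⁻¹) ^ a ≤ C := by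
  have : IsFiniteMeasure ((volume : Measure E3).restrict (closedBall 0 R)) :=
    ⟨by rw [Measure.restrict_apply_univ]; exact measure_closedBall_lt_top⟩
  refine exists_lintegral_inv_enorm_rpow_le (d := 3) (C := volume (ball (0 : E3) 1))
    measure_ball_lt_top.ne (fun y r hr => ?_) ha0 (by exact_mod_cast ha)
  refine (Measure.restrict_apply_le _ _).trans ?_
  rw [Measure.addHaar_closedBall _ _ hr.le, mul_comm]
  simp

/-- The potential of the density `m` on `Γ` with kernel `|x - y|⁻²`. -/
noncomputable def gradPotential (Γ : Set E3) (m : E3 → ℝ≥0∞) (x : E3) : ℝ≥0∞ :=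
  ∫⁻ y in Γ, m y * ‖x - y‖ₑ⁻¹ ^ 2 ∂μHE[2]

theorem HasLipschitzBoundary.sFinite {D Γ : Set E3} (h : HasLipschitzBoundary D Γ) :
    IsFiniteMeasure ((μHE[2] : Measure E3).restrict Γ) :=
  ⟨by rw [Measure.restrict_apply_univ]; exact h.measure_lt_top⟩

theorem HasLipschitzBoundary.measurable_gradPotential {D Γ : Set E3}
    (h : HasLipschitzBoundary D Γ) {m : E3 → ℝ≥0∞} (hm : Measurable m) :
    Measurable (gradPotential Γ m) := by
  have := h.sFinite
  refine Measurable.lintegral_prod_right' (f := fun p : E3 × E3 => m p.2 * ‖p.1 - p.2‖ₑ⁻¹ ^ 2) ?_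
  exact (hm.comp measurable_snd).mul
    ((measurable_fst.sub measurable_snd).enorm.inv.pow_const 2)

/-- Write `|z|⁻² = |z|^(-5/4) |z|^(-3/4)` and apply Cauchy–Schwarz. The squares have exponents `5/2
< 3`, integrable in the space variable, and `3/2 < 2`, integrable on the surface. -/
theorem HasLipschitzBoundary.lintegral_gradPotential_sq_lt_top {D Γ : Set E3}
    (h : HasLipschitzBoundary D Γ) {m : E3 → ℝ≥0∞} (hm : Measurable m)
    (hm2 : ∫⁻ y in Γ, m y ^ 2 ∂μHE[2] < ∞) (R : ℝ) :
    ∫⁻ x in closedBall (0 : E3) R, gradPotential Γ m x ^ 2 < ∞ := by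
  have := h.sFinite
  obtain ⟨C₁, hC₁, h₁⟩ := h.exists_lintegral_le (a := 3 / 2) (by norm_num) (by norm_num)
  obtain ⟨C₂, hC₂, h₂⟩ := exists_setLIntegral_volume_le R (a := 5 / 2) (by norm_num) (by norm_num)
  have hk : Measurable fun p : E3 × E3 => ‖p.1 - p.2‖ₑ⁻¹ :=
    (measurable_fst.sub measurable_snd).enorm.inv
  have hpt : ∀ x, gradPotential Γ m x ^ 2 ≤
      C₁ * ∫⁻ y in Γ, m y ^ 2 * (‖x - y‖ₑ⁻¹) ^ (5 / 2 : ℝ) ∂μHE[2] := by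
    intro x
    have hkx : Measurable fun y => ‖x - y‖ₑ⁻¹ := (measurable_const.sub measurable_id).enorm.inv
    have hH := ENNReal.lintegral_mul_le_Lp_mul_Lq ((μHE[2] : Measure E3).restrict Γ)
      (p := 2) (q := 2) (by constructor <;> norm_num)
      (f := fun y => m y * (‖x - y‖ₑ⁻¹) ^ (5 / 4 : ℝ)) (g := fun y => (‖x - y‖ₑ⁻¹) ^ (3 / 4 : ℝ))
      (hm.mul (hkx.pow_const _)).aemeasurable (hkx.pow_const _).aemeasurable
    have e0 : gradPotential Γ m x = ∫⁻ y in Γ, ((fun y => m y * (‖x - y‖ₑ⁻¹) ^ (5 / 4 : ℝ)) *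
        fun y => (‖x - y‖ₑ⁻¹) ^ (3 / 4 : ℝ)) y ∂μHE[2] := by
      refine lintegral_congr fun y => ?_
      simp only [Pi.mul_apply]
      rw [mul_assoc, ← ENNReal.rpow_add_of_nonneg _ _ (by norm_num) (by norm_num),
        ← ENNReal.rpow_natCast]
      norm_num
    have e1 : ∀ y, (m y * (‖x - y‖ₑ⁻¹) ^ (5 / 4 : ℝ)) ^ (2 : ℝ) =
        m y ^ 2 * (‖x - y‖ₑ⁻¹) ^ (5 / 2 : ℝ) := by
      intro y
      rw [ENNReal.mul_rpow_of_nonneg _ _ (by norm_num), ← ENNReal.rpow_mul]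
      norm_num
    have e2 : ∀ y, ((‖x - y‖ₑ⁻¹) ^ (3 / 4 : ℝ)) ^ (2 : ℝ) = (‖x - y‖ₑ⁻¹) ^ (3 / 2 : ℝ) := by
      intro y
      rw [← ENNReal.rpow_mul]
      norm_num
    rw [← e0] at hH
    simp only [e1, e2] at hH
    calc gradPotential Γ m x ^ 2 ≤ _ := pow_le_pow_left' hH 2
      _ = (∫⁻ y in Γ, m y ^ 2 * (‖x - y‖ₑ⁻¹) ^ (5 / 2 : ℝ) ∂μHE[2]) *
          ∫⁻ y in Γ, (‖x - y‖ₑ⁻¹) ^ (3 / 2 : ℝ) ∂μHE[2] := by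
        rw [mul_pow, ← ENNReal.rpow_natCast, ← ENNReal.rpow_natCast, ← ENNReal.rpow_mul,
          ← ENNReal.rpow_mul]
        norm_num
      _ ≤ _ := by
        rw [mul_comm]
        gcongr
        exact h₁ x
  calc ∫⁻ x in closedBall (0 : E3) R, gradPotential Γ m x ^ 2
      ≤ ∫⁻ x in closedBall (0 : E3) R,
          C₁ * ∫⁻ y in Γ, m y ^ 2 * (‖x - y‖ₑ⁻¹) ^ (5 / 2 : ℝ) ∂μHE[2] := lintegral_mono hpt
    _ = C₁ * ∫⁻ y in Γ, m y ^ 2 *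
          (∫⁻ x in closedBall (0 : E3) R, (‖x - y‖ₑ⁻¹) ^ (5 / 2 : ℝ)) ∂μHE[2] := by
        rw [lintegral_const_mul' _ _ hC₁, lintegral_lintegral_swap
          (((hm.comp measurable_snd).pow_const 2).mul (hk.pow_const _)).aemeasurable]
        refine congrArg (C₁ * ·) ?_
        refine lintegral_congr fun y => ?_
        exact lintegral_const_mul _ ((measurable_id.sub_const y).enorm.inv.pow_const _)
    _ ≤ C₁ * ∫⁻ y in Γ, m y ^ 2 * C₂ ∂μHE[2] := by
        refine mul_le_mul_right (lintegral_mono fun y => mul_le_mul_right ?_ _) _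
        simpa only [enorm_sub_comm y] using h₂ y
    _ < ∞ := by
        rw [lintegral_mul_const' _ _ hC₂]
        exact ENNReal.mul_lt_top hC₁.lt_top (ENNReal.mul_lt_top hm2 hC₂.lt_top)

/-- By Tonelli and the symmetry of the kernel the double integral over `Γ × Γ` is finite. The points
found here are those at which boundary limits of the potential can be taken. -/
theorem HasLipschitzBoundary.ae_lintegral_mul_inv_enorm_lt_top {D Γ : Set E3}
    (h : HasLipschitzBoundary D Γ) {m : E3 → ℝ≥0∞} (hm : Measurable m)
    (hm1 : ∫⁻ y in Γ, m y ∂μHE[2] < ∞) :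
    ∀ᵐ x ∂(μHE[2] : Measure E3).restrict Γ, ∫⁻ y in Γ, m y * ‖x - y‖ₑ⁻¹ ∂μHE[2] < ∞ := by
  have := h.sFinite
  obtain ⟨C, hC, h₁⟩ := h.exists_lintegral_le (a := 1) (by norm_num) (by norm_num)
  simp only [ENNReal.rpow_one] at h₁
  have hk : Measurable fun p : E3 × E3 => m p.2 * ‖p.1 - p.2‖ₑ⁻¹ :=
    (hm.comp measurable_snd).mul (measurable_fst.sub measurable_snd).enorm.inv
  refine ae_lt_top (Measurable.lintegral_prod_right' hk) ?_
  rw [lintegral_lintegral_swap hk.aemeasurable]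
  refine ne_of_lt (lt_of_le_of_lt (b := ∫⁻ y in Γ, m y * C ∂μHE[2]) ?_ ?_)
  · refine lintegral_mono fun y => ?_
    have hky : Measurable fun x => ‖x - y‖ₑ⁻¹ := (measurable_id.sub_const y).enorm.inv
    refine (lintegral_const_mul _ hky).trans_le ?_
    refine mul_le_mul_right ?_ _
    simpa only [enorm_sub_comm y] using h₁ y
  · rw [lintegral_mul_const' _ _ hC]
    exact ENNReal.mul_lt_top hm1 hC.lt_top

/-! ### Cutoff functions and integration by parts near the boundary -/

section
open scoped Manifold ContDiff

/-- A Lipschitz cutoff function, supported at distance at least `δ` from the complement of `D`. -/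
noncomputable def cutoff (D : Set E3) (δ : ℝ) (x : E3) : ℝ :=
  max 0 (min 1 (infDist x Dᶜ / δ - 1))

theorem cutoff_nonneg (D : Set E3) (δ : ℝ) (x : E3) : 0 ≤ cutoff D δ x := le_max_left _ _

theorem cutoff_eq_one {D : Set E3} {δ : ℝ} (hδ : 0 < δ) {x : E3} (hx : 2 * δ ≤ infDist x Dᶜ) :
    cutoff D δ x = 1 := by
  have : 2 ≤ infDist x Dᶜ / δ := by rwa [le_div_iff₀ hδ]
  rw [cutoff, min_eq_left (by linarith), max_eq_right zero_le_one]

theorem cutoff_eq_zero {D : Set E3} {δ : ℝ} (hδ : 0 < δ) {x : E3} (hx : infDist x Dᶜ ≤ δ) :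
    cutoff D δ x = 0 := by
  have : infDist x Dᶜ / δ ≤ 1 := by rwa [div_le_iff₀ hδ, one_mul]
  rw [cutoff, max_eq_left]
  exact (min_le_right _ _).trans (by linarith)

theorem lipschitzWith_cutoff (D : Set E3) {δ : ℝ} (hδ : 0 < δ) :
    LipschitzWith (Real.toNNReal (1 / δ)) (cutoff D δ) := by
  have h1 : LipschitzWith (Real.toNNReal (1 / δ)) fun x : E3 => infDist x Dᶜ / δ - 1 := by
    refine LipschitzWith.of_dist_le_mul fun x y => ?_
    have := (lipschitz_infDist_pt Dᶜ).dist_le_mul x y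
    rw [NNReal.coe_one, one_mul, Real.dist_eq] at this
    rw [Real.dist_eq, Real.coe_toNNReal _ (by positivity),
      show infDist x Dᶜ / δ - 1 - (infDist y Dᶜ / δ - 1)
        = 1 / δ * (infDist x Dᶜ - infDist y Dᶜ) by ring, abs_mul, abs_of_pos (by positivity)]
    gcongr
  exact (h1.const_min 1).const_max 0

/-- The cutoff is locally constant off the strip. It already equals `1` at distance `2 * δ`; the
width `3 * δ` leaves room for a neighbourhood. -/
theorem lineDeriv_cutoff_eq_zero {D : Set E3} {δ : ℝ} (hδ : 0 < δ) {x v : E3}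
    (hx : x ∉ {x ∈ D | infDist x Dᶜ < 3 * δ}) : lineDeriv ℝ (cutoff D δ) x v = 0 := by
  have hcont : Continuous fun x : E3 => infDist x Dᶜ := continuous_infDist_pt _
  have key : ∃ a : ℝ, cutoff D δ =ᶠ[𝓝 x] fun _ => a := by
    by_cases hxD : x ∈ D
    · refine ⟨1, ?_⟩
      have : 2 * δ < infDist x Dᶜ := by
        have : 3 * δ ≤ infDist x Dᶜ := not_lt.1 fun h => hx ⟨hxD, h⟩
        linarith
      filter_upwards [(isOpen_lt continuous_const hcont).mem_nhds this] with y hy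
      exact cutoff_eq_one hδ (le_of_lt hy)
    · refine ⟨0, ?_⟩
      have : infDist x Dᶜ < δ := by rw [infDist_zero_of_mem hxD]; exact hδ
      filter_upwards [(isOpen_lt hcont continuous_const).mem_nhds this] with y hy
      exact cutoff_eq_zero hδ (le_of_lt hy)
  obtain ⟨a, ha⟩ := key
  rw [ha.lineDeriv_eq]
  simp [lineDeriv]

theorem contDiff_mul_of_contDiffOn {D : Set E3} (hD : IsOpen D) {ξ f : E3 → ℝ}
    (hξ : ContDiff ℝ 1 ξ) (hf : ContDiffOn ℝ 1 f D) (hsupp : tsupport ξ ⊆ D) :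
    ContDiff ℝ 1 fun x => ξ x * f x := by
  rw [contDiff_iff_contDiffAt]
  intro x
  by_cases hx : x ∈ D
  · exact hξ.contDiffAt.mul (hf.contDiffAt (hD.mem_nhds hx))
  · have h0 := notMem_tsupport_iff_eventuallyEq.1 fun h => hx (hsupp h)
    refine (contDiffAt_const (c := (0 : ℝ))).congr_of_eventuallyEq ?_
    filter_upwards [h0] with y hy
    rw [hy, Pi.zero_apply, zero_mul]

/-- As `f` may be singular at the boundary of `D`, integration by parts is applied to `ξ * f`, where
the smooth `ξ` has compact support in `D` and equals `1` wherever both the cutoff and `f` can be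
nonzero. The derivative then falls on the cutoff, whose slope is at most `1 / δ` and which is
locally constant outside the strip. -/
theorem enorm_integral_cutoff_mul_fderiv_le {D : Set E3} (hD : IsOpen D)
    {δ : ℝ} (hδ : 0 < δ) {f : E3 → ℝ} (hf : ContDiffOn ℝ 1 f D) {R : ℝ}
    (hR : ∀ x ∈ D, R < ‖x‖ → f x = 0) {v : E3} (hv : ‖v‖ = 1) :
    ‖∫ x, cutoff D δ x * fderiv ℝ f x v‖ₑ ≤
      ENNReal.ofReal (1 / δ) * ∫⁻ x in {x ∈ D | infDist x Dᶜ < 3 * δ}, ‖f x‖ₑ := by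
  have hcont : Continuous fun x : E3 => infDist x Dᶜ := continuous_infDist_pt _
  have hpos : ∀ x, 0 < infDist x Dᶜ → x ∈ D := fun x hx => by
    by_contra h
    rw [infDist_zero_of_mem h] at hx
    exact lt_irrefl _ hx
  obtain ⟨ξ, hξ1, hξ0, hξI⟩ := exists_contMDiffMap_one_nhds_of_subset_interior (n := 1) 𝓘(ℝ, E3)
    (s := {x : E3 | δ ≤ infDist x Dᶜ} ∩ closedBall 0 (R + 1))
    (t := {x : E3 | δ / 2 ≤ infDist x Dᶜ} ∩ closedBall 0 (R + 2))
    ((isClosed_le continuous_const hcont).inter isClosed_closedBall) (by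
      refine subset_trans ?_ (interior_mono (s := {x : E3 | δ / 2 < infDist x Dᶜ} ∩ ball 0 (R + 2))
        (inter_subset_inter (fun x hx => le_of_lt (Set.mem_ofPred.1 hx)) ball_subset_closedBall))
      rw [((isOpen_lt continuous_const hcont).inter isOpen_ball).interior_eq]
      refine inter_subset_inter (fun x hx => ?_) (closedBall_subset_ball (by linarith))
      rw [Set.mem_ofPred_eq] at hx ⊢
      linarith)
  have hξd : ContDiff ℝ 1 (ξ : E3 → ℝ) := contMDiff_iff_contDiff.1 ξ.contMDiff
  have htclosed : IsClosed ({x : E3 | δ / 2 ≤ infDist x Dᶜ} ∩ closedBall 0 (R + 2)) :=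
    (isClosed_le continuous_const hcont).inter isClosed_closedBall
  have hts : tsupport (ξ : E3 → ℝ) ⊆ {x : E3 | δ / 2 ≤ infDist x Dᶜ} ∩ closedBall 0 (R + 2) :=
    closure_minimal (fun x hx => by_contra fun h => hx (hξ0 x h)) htclosed
  have hg := contDiff_mul_of_contDiffOn hD hξd hf (hts.trans fun x hx =>
    hpos x ((half_pos hδ).trans_le hx.1))
  have hξc : HasCompactSupport (ξ : E3 → ℝ) :=
    ((isCompact_closedBall (0 : E3) (R + 2)).of_isClosed_subset (isClosed_tsupport _)
      (hts.trans inter_subset_right))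
  have hgc : HasCompactSupport fun x => ξ x * f x := hξc.mul_right
  obtain ⟨C, hC⟩ := ContDiff.lipschitzWith_of_hasCompactSupport hgc hg one_ne_zero
  have hIBP := LipschitzWith.integral_lineDeriv_mul_eq (μ := volume) (lipschitzWith_cutoff D hδ) hC hgc (-v)
  rw [neg_neg] at hIBP
  have hL : ∀ x, cutoff D δ x * fderiv ℝ f x v =
      lineDeriv ℝ (fun x => ξ x * f x) x v * cutoff D δ x := by
    intro x
    rw [(hg.differentiable one_ne_zero x).lineDeriv_eq_fderiv, mul_comm]
    by_cases h0 : cutoff D δ x = 0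
    · rw [h0, mul_zero, mul_zero]
    have hx : δ < infDist x Dᶜ := not_le.1 fun h => h0 (cutoff_eq_zero hδ h)
    have hxD : x ∈ D := hpos x (hδ.trans hx)
    congr 2
    refine Filter.EventuallyEq.fderiv_eq ?_
    rcases lt_or_ge R ‖x‖ with h | h
    · filter_upwards [hD.mem_nhds hxD, (isOpen_lt continuous_const continuous_norm).mem_nhds h]
        with y hy1 hy2
      rw [hR y hy1 hy2, mul_zero]
    · have := hξ1.filter_mono (nhds_le_nhdsSet
        (show x ∈ {x : E3 | δ ≤ infDist x Dᶜ} ∩ closedBall 0 (R + 1) from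
          ⟨hx.le, by rw [mem_closedBall_zero_iff]; linarith⟩))
      filter_upwards [this] with y hy
      rw [hy, one_mul]
  simp_rw [hL]
  rw [← hIBP]
  refine (enorm_integral_le_lintegral_enorm _).trans ?_
  have hmeas : MeasurableSet {x ∈ D | infDist x Dᶜ < 3 * δ} :=
    hD.measurableSet.inter (isOpen_lt hcont continuous_const).measurableSet
  rw [← lintegral_const_mul' _ _ ENNReal.ofReal_ne_top, ← lintegral_indicator hmeas]
  refine lintegral_mono fun x => ?_
  by_cases hx : x ∈ {x ∈ D | infDist x Dᶜ < 3 * δ}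
  · rw [indicator_of_mem hx, enorm_mul, enorm_mul]
    have h1 : ‖lineDeriv ℝ (cutoff D δ) x (-v)‖ₑ ≤ ENNReal.ofReal (1 / δ) := by
      rw [← ofReal_norm]
      refine ENNReal.ofReal_le_ofReal ?_
      have := norm_lineDeriv_le_of_lipschitz ℝ (lipschitzWith_cutoff D hδ) (x₀ := x) (v := -v)
      rwa [norm_neg, hv, mul_one, Real.coe_toNNReal _ (by positivity)] at this
    have h2 : ‖ξ x‖ₑ ≤ 1 := by
      rw [← ofReal_norm, Real.norm_of_nonneg (hξI x).1]
      exact ENNReal.ofReal_le_one.2 (hξI x).2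
    calc _ ≤ ENNReal.ofReal (1 / δ) * (1 * ‖f x‖ₑ) := by gcongr
      _ = _ := by rw [one_mul]
  · rw [indicator_of_notMem hx, lineDeriv_cutoff_eq_zero hδ hx, zero_mul, enorm_zero]

end

/-! ### The acoustic system and its energy -/

section
open scoped Manifold ContDiff

/-- The `i`-th standard unit vector. -/
noncomputable def basisVec (i : Fin 3) : E3 := EuclideanSpace.single i (1 : ℝ)

theorem norm_basisVec (i : Fin 3) : ‖basisVec i‖ = 1 := by simp [basisVec]

/-- The points of a closed ball at distance at least `δ` from the complement of `D`. -/
def innerCore (D : Set E3) (δ R : ℝ) : Set E3 := {x | δ ≤ infDist x Dᶜ} ∩ closedBall 0 R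

theorem isCompact_innerCore (D : Set E3) (δ R : ℝ) : IsCompact (innerCore D δ R) :=
  (isCompact_closedBall (0 : E3) R).inter_left
    (isClosed_le continuous_const (continuous_infDist_pt _))

theorem mem_of_lt_infDist_compl {D : Set E3} {δ : ℝ} (hδ : 0 < δ) {x : E3}
    (hx : δ ≤ infDist x Dᶜ) : x ∈ D := by
  by_contra hxD
  rw [infDist_zero_of_mem hxD] at hx
  linarith

theorem innerCore_subset {D : Set E3} {δ : ℝ} (hδ : 0 < δ) (R : ℝ) : innerCore D δ R ⊆ D :=
  fun _ hx => mem_of_lt_infDist_compl hδ hx.1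

/-- The acoustic system `∂ₜ P = c² div V`, `∂ₜ V = ∇ P` in `D × (-∞, N)` with fields
vanishing up to time `t₀`. -/
structure IsAcousticField (c : ℝ) (D : Set E3) (t₀ N : ℝ) (P : E3 × ℝ → ℝ)
    (V : Fin 3 → E3 × ℝ → ℝ) : Prop where
  contDiffOn_fst : ContDiffOn ℝ 1 P (D ×ˢ Iio N)
  contDiffOn_snd : ∀ i, ContDiffOn ℝ 1 (V i) (D ×ˢ Iio N)
  div_eq : ∀ x ∈ D, ∀ t < N,
    fderiv ℝ P (x, t) (0, 1) = c ^ 2 * ∑ i, fderiv ℝ (V i) (x, t) (basisVec i, 0)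
  grad_eq : ∀ x ∈ D, ∀ t < N, ∀ i, fderiv ℝ (V i) (x, t) (0, 1) = fderiv ℝ P (x, t) (basisVec i, 0)
  initial : ∀ x ∈ D, ∀ t < N, t ≤ t₀ → P (x, t) = 0 ∧ ∀ i, V i (x, t) = 0

namespace IsAcousticField

variable {c : ℝ} {D : Set E3} {t₀ N : ℝ} {P : E3 × ℝ → ℝ} {V : Fin 3 → E3 × ℝ → ℝ}

/-- The energy density. -/
noncomputable def energy (c : ℝ) (P : E3 × ℝ → ℝ) (V : Fin 3 → E3 × ℝ → ℝ) (q : E3 × ℝ) : ℝ :=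
  1 / 2 * (P q ^ 2 + c ^ 2 * ∑ i, V i q ^ 2)

/-- The divergence of the energy flux in direction `i`. -/
noncomputable def fluxDeriv (P : E3 × ℝ → ℝ) (V : Fin 3 → E3 × ℝ → ℝ) (i : Fin 3) (q : E3 × ℝ) :
    ℝ :=
  P q * fderiv ℝ (V i) q (basisVec i, 0) + V i q * fderiv ℝ P q (basisVec i, 0)

theorem energy_nonneg (q : E3 × ℝ) : 0 ≤ energy c P V q := by
  unfold energy
  have : 0 ≤ ∑ i, V i q ^ 2 := Finset.sum_nonneg fun i _ => sq_nonneg _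
  positivity

section
variable (hD : IsOpen D) (h : IsAcousticField c D t₀ N P V)

include h in
theorem continuousOn_energy : ContinuousOn (energy c P V) (D ×ˢ Iio N) := by
  unfold energy
  have h1 := h.contDiffOn_fst.continuousOn
  have h2 := fun i => (h.contDiffOn_snd i).continuousOn
  fun_prop

include h in
theorem contDiffOn_flux (i : Fin 3) {t : ℝ} (ht : t < N) :
    ContDiffOn ℝ 1 (fun x => P (x, t) * V i (x, t)) D := by
  have hline : ContDiffOn ℝ 1 (fun y : E3 => (y, t)) D := by fun_prop
  exact (h.contDiffOn_fst.comp hline fun x hx => ⟨hx, ht⟩).mul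
    ((h.contDiffOn_snd i).comp hline fun x hx => ⟨hx, ht⟩)

include hD h

theorem differentiableAt_fst {x : E3} {t : ℝ} (hx : x ∈ D) (ht : t < N) :
    DifferentiableAt ℝ P (x, t) :=
  (h.contDiffOn_fst.contDiffAt ((hD.prod isOpen_Iio).mem_nhds (mk_mem_prod hx ht))).differentiableAt
    one_ne_zero

theorem differentiableAt_snd (i : Fin 3) {x : E3} {t : ℝ} (hx : x ∈ D) (ht : t < N) :
    DifferentiableAt ℝ (V i) (x, t) :=
  ((h.contDiffOn_snd i).contDiffAt ((hD.prod isOpen_Iio).mem_nhds (mk_mem_prod hx ht))).differentiableAt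
    one_ne_zero

theorem continuousOn_fluxDeriv (i : Fin 3) : ContinuousOn (fluxDeriv P V i) (D ×ˢ Iio N) := by
  unfold fluxDeriv
  have h1 := h.contDiffOn_fst.continuousOn
  have h2 := (h.contDiffOn_snd i).continuousOn
  have h3 := h.contDiffOn_fst.continuousOn_fderiv_of_isOpen (hD.prod isOpen_Iio) le_rfl
  have h4 := (h.contDiffOn_snd i).continuousOn_fderiv_of_isOpen (hD.prod isOpen_Iio) le_rfl
  exact (h1.mul (h4.clm_apply continuousOn_const)).add (h2.mul (h3.clm_apply continuousOn_const))

theorem continuousOn_fluxDeriv_slice (i : Fin 3) {t : ℝ} (ht : t < N) :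
    ContinuousOn (fun x => fluxDeriv P V i (x, t)) D :=
  (h.continuousOn_fluxDeriv hD i).comp (f := fun x : E3 => (x, t)) (by fun_prop)
    fun x hx => ⟨hx, ht⟩

/-- The two equations turn the time derivative into `c² (P div V + V · ∇P)`, which is `c² div (P
V)`. -/
theorem hasDerivAt_energy {x : E3} {t : ℝ} (hx : x ∈ D) (ht : t < N) :
    HasDerivAt (fun s => energy c P V (x, s)) (c ^ 2 * ∑ i, fluxDeriv P V i (x, t)) t := by
  have hline : HasDerivAt (fun s : ℝ => (x, s)) ((0 : E3), (1 : ℝ)) t :=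
    (hasDerivAt_const t x).prodMk (hasDerivAt_id t)
  have h1 := (h.differentiableAt_fst hD hx ht).hasFDerivAt.comp_hasDerivAt t hline
  have h2 := fun i => (h.differentiableAt_snd hD i hx ht).hasFDerivAt.comp_hasDerivAt t hline
  have h3 := ((h1.pow 2).add ((HasDerivAt.fun_sum fun i (_ : i ∈ Finset.univ) =>
    (h2 i).pow 2).const_mul (c ^ 2))).const_mul (1 / 2 : ℝ)
  refine (h3.congr_deriv ?_)
  simp only [Function.comp, h.div_eq x hx t ht, h.grad_eq x hx t ht, fluxDeriv, Fin.sum_univ_three]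
  ring

theorem fderiv_flux (i : Fin 3) {x : E3} {t : ℝ} (hx : x ∈ D) (ht : t < N) :
    fderiv ℝ (fun x => P (x, t) * V i (x, t)) x (basisVec i) = fluxDeriv P V i (x, t) := by
  have hline : HasFDerivAt (fun y : E3 => (y, t)) (ContinuousLinearMap.inl ℝ E3 ℝ) x :=
    hasFDerivAt_prodMk_left x t
  have h1 := (h.differentiableAt_fst hD hx ht).hasFDerivAt.comp x hline
  have h2 := (h.differentiableAt_snd hD i hx ht).hasFDerivAt.comp x hline
  have h3 := (h1.fun_mul h2).fderiv
  simp only [Function.comp_def] at h3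
  rw [h3]
  simp [fluxDeriv]

theorem energy_eq_integral {x : E3} {t : ℝ} (hx : x ∈ D) (ht : t < N) (ht0 : t₀ ≤ t) :
    energy c P V (x, t) = ∫ s in t₀..t, c ^ 2 * ∑ i, fluxDeriv P V i (x, s) := by
  have hsub : ∀ s ∈ uIcc t₀ t, s < N := fun s hs => by
    rw [uIcc_of_le ht0] at hs
    exact hs.2.trans_lt ht
  have hc : ContinuousOn (fun s => c ^ 2 * ∑ i, fluxDeriv P V i (x, s)) (uIcc t₀ t) := by
    refine continuousOn_const.mul (continuousOn_finsetSum _ fun i _ => ?_)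
    exact (h.continuousOn_fluxDeriv hD i).comp (by fun_prop) fun s hs => ⟨hx, hsub s hs⟩
  rw [intervalIntegral.integral_eq_sub_of_hasDerivAt
    (fun s hs => h.hasDerivAt_energy hD hx (hsub s hs)) hc.intervalIntegrable]
  have h0 := h.initial x hx t₀ (ht0.trans_lt ht) le_rfl
  simp [energy, h0.1, h0.2]

/-- The local balance is integrated in time from vanishing initial data and then by parts in space.
The slope `1 / δ` of the cutoff cancels the factor `δ` assumed for the strip integral; the factor
`3` counts the components of `V`. -/
theorem enorm_integral_cutoff_energy_le {R : ℝ}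
    (hR : ∀ x ∈ D, R < ‖x‖ → ∀ t < N, P (x, t) = 0) {δ : ℝ} (hδ : 0 < δ) {F : ℝ≥0∞}
    (hF : ∀ t < N, ∀ i, ∫⁻ x in {x ∈ D | infDist x Dᶜ < 3 * δ}, ‖P (x, t) * V i (x, t)‖ₑ ≤
      ENNReal.ofReal δ * F) {R' : ℝ} (hRR : R ≤ R') {T : ℝ} (hT : T < N) (hT0 : t₀ ≤ T) :
    ‖∫ x in innerCore D δ R', cutoff D δ x * energy c P V (x, T)‖ₑ ≤
      ENNReal.ofReal (c ^ 2) * (3 * F) * ENNReal.ofReal (T - t₀) := by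
  have hKc := isCompact_innerCore D δ R'
  have hKD := innerCore_subset (D := D) hδ R'
  set K : Set E3 := innerCore D δ R' with hK
  have hθ : Continuous (cutoff D δ) := (lipschitzWith_cutoff D hδ).continuous
  have hΦ : ContinuousOn (fun q : E3 × ℝ => cutoff D δ q.1 * (c ^ 2 * ∑ i, fluxDeriv P V i q))
      (K ×ˢ Icc t₀ T) := by
    refine (hθ.comp continuous_fst).continuousOn.mul (continuousOn_const.mul
      (continuousOn_finsetSum _ fun i _ => (h.continuousOn_fluxDeriv hD i).mono ?_))
    exact prod_mono hKD fun t ht => ht.2.trans_lt hT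
  have hInt : Integrable (fun q : E3 × ℝ => cutoff D δ q.1 * (c ^ 2 * ∑ i, fluxDeriv P V i q))
      ((volume.restrict K).prod (volume.restrict (Ioc t₀ T))) := by
    rw [Measure.prod_restrict]
    exact (hΦ.integrableOn_compact (hKc.prod isCompact_Icc)).mono_set
      (prod_mono_right Ioc_subset_Icc_self)
  have h1 : ∫ x in K, cutoff D δ x * energy c P V (x, T) =
      ∫ s in Ioc t₀ T, ∫ x in K, cutoff D δ x * (c ^ 2 * ∑ i, fluxDeriv P V i (x, s)) := by
    rw [← integral_integral_swap hInt]
    refine setIntegral_congr_fun hKc.measurableSet fun x hx => ?_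
    rw [h.energy_eq_integral hD (hKD hx) hT hT0, intervalIntegral.integral_of_le hT0,
      ← integral_const_mul]
  have hvan : ∀ s < N, ∀ i, ∀ x ∉ K, cutoff D δ x *
      fderiv ℝ (fun x => P (x, s) * V i (x, s)) x (basisVec i) = 0 := by
    intro s hs i x hx
    by_cases h0 : cutoff D δ x = 0
    · rw [h0, zero_mul]
    have hx1 : δ < infDist x Dᶜ := not_le.1 fun h => h0 (cutoff_eq_zero hδ h)
    have hxD : x ∈ D := mem_of_lt_infDist_compl hδ hx1.le
    have hx2 : R' < ‖x‖ := by
      by_contra! hle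
      exact hx ⟨hx1.le, mem_closedBall_zero_iff.2 hle⟩
    have : (fun x => P (x, s) * V i (x, s)) =ᶠ[𝓝 x] fun _ => 0 := by
      filter_upwards [hD.mem_nhds hxD, (isOpen_lt continuous_const continuous_norm).mem_nhds hx2]
        with y hy1 hy2
      rw [hR y hy1 (hRR.trans_lt hy2) s hs, zero_mul]
    rw [this.fderiv_eq]
    simp
  have h2 : ∀ s ∈ Ioc t₀ T, ‖∫ x in K, cutoff D δ x * (c ^ 2 * ∑ i, fluxDeriv P V i (x, s))‖ₑ ≤
      ENNReal.ofReal (c ^ 2) * (3 * F) := by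
    intro s hs
    have hsN : s < N := hs.2.trans_lt hT
    have hterm : ∀ i, IntegrableOn (fun x => cutoff D δ x * fluxDeriv P V i (x, s)) K := fun i =>
      (hθ.continuousOn.mul
        ((h.continuousOn_fluxDeriv_slice hD i hsN).mono hKD)).integrableOn_compact hKc
    have e1 : ∫ x in K, cutoff D δ x * (c ^ 2 * ∑ i, fluxDeriv P V i (x, s)) =
        c ^ 2 * ∑ i, ∫ x in K, cutoff D δ x * fluxDeriv P V i (x, s) := by
      rw [← integral_finsetSum _ fun i _ => hterm i, ← integral_const_mul]
      refine integral_congr_ae (.of_forall fun x => ?_)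
      dsimp only
      rw [← Finset.mul_sum]
      ring
    have e2 : ∀ i, ‖∫ x in K, cutoff D δ x * fluxDeriv P V i (x, s)‖ₑ ≤ F := by
      intro i
      have e3 : ∫ x in K, cutoff D δ x * fluxDeriv P V i (x, s) =
          ∫ x, cutoff D δ x * fderiv ℝ (fun x => P (x, s) * V i (x, s)) x (basisVec i) := by
        rw [← setIntegral_eq_integral_of_forall_compl_eq_zero (hvan s hsN i)]
        refine setIntegral_congr_fun hKc.measurableSet fun x hx => ?_
        rw [h.fderiv_flux hD i (hKD hx) hsN]
      rw [e3]
      refine (enorm_integral_cutoff_mul_fderiv_le hD hδ (h.contDiffOn_flux i hsN) (R := R)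
        (fun x hx hxR => by rw [hR x hx hxR s hsN, zero_mul]) (norm_basisVec i)).trans ?_
      refine (mul_le_mul_right (hF s hsN i) _).trans ?_
      rw [← mul_assoc, ← ENNReal.ofReal_mul (by positivity), one_div_mul_cancel hδ.ne',
        ENNReal.ofReal_one, one_mul]
    rw [e1, enorm_mul, Real.enorm_of_nonneg (sq_nonneg c)]
    gcongr
    refine (enorm_sum_le _ _).trans ((Finset.sum_le_sum fun i _ => e2 i).trans ?_)
    simp
  rw [h1]
  refine (enorm_integral_le_lintegral_enorm _).trans
    ((setLIntegral_mono measurable_const h2).trans ?_)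
  rw [setLIntegral_const, Real.volume_Ioc]

/-- For small `δ` the cutoff is `1` on a fixed ball about `x`, while the bound on the weighted
energy tends to zero. So the energy vanishes almost everywhere on that ball, and everywhere by
continuity. -/
theorem eq_zero_of_flux_small (hc : 0 < c) (hDc : Dᶜ.Nonempty) {R : ℝ}
    (hR : ∀ x ∈ D, R < ‖x‖ → ∀ t < N, P (x, t) = 0) {F : ℝ → ℝ≥0∞}
    (hF0 : Tendsto F (𝓝[>] 0) (𝓝 0))
    (hF : ∀ᶠ δ in 𝓝[>] (0 : ℝ), ∀ t < N, ∀ i,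
      ∫⁻ x in {x ∈ D | infDist x Dᶜ < 3 * δ}, ‖P (x, t) * V i (x, t)‖ₑ ≤ ENNReal.ofReal δ * F δ)
    {x : E3} (hx : x ∈ D) {T : ℝ} (hT : T < N) : P (x, T) = 0 ∧ ∀ i, V i (x, T) = 0 := by
  rcases le_or_gt T t₀ with hT0 | hT0
  · exact h.initial x hx T hT hT0
  have hdx : 0 < infDist x Dᶜ := (hD.isClosed_compl.notMem_iff_infDist_pos hDc).1 (by simpa)
  set r := infDist x Dᶜ / 2 with hr
  have hr0 : 0 < r := half_pos hdx
  have hball : ∀ y ∈ closedBall x r, r ≤ infDist y Dᶜ := fun y hy => by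
    have := infDist_le_infDist_add_dist (s := Dᶜ) (x := x) (y := y)
    rw [mem_closedBall, dist_comm] at hy
    linarith
  have hballD : closedBall x r ⊆ D := fun y hy => mem_of_lt_infDist_compl hr0 (hball y hy)
  have hE : ContinuousOn (fun y => energy c P V (y, T)) D :=
    h.continuousOn_energy.comp (f := fun y : E3 => (y, T)) (by fun_prop) fun y hy => ⟨hy, hT⟩
  set R' := max R (‖x‖ + r) with hR'
  have hbound : ∀ᶠ δ in 𝓝[>] (0 : ℝ), ENNReal.ofReal (∫ y in ball x r, energy c P V (y, T)) ≤
      ENNReal.ofReal (c ^ 2) * (3 * F δ) * ENNReal.ofReal (T - t₀) := by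
    filter_upwards [hF, self_mem_nhdsWithin,
      (nhdsWithin_le_nhds (Iio_mem_nhds (half_pos hr0)) : Iio (r / 2) ∈ 𝓝[>] (0 : ℝ))]
      with δ h1 hδ h3
    have hδ0 : 0 < δ := hδ
    have hδr : δ < r / 2 := h3
    refine le_trans ?_ (h.enorm_integral_cutoff_energy_le hD hR hδ0 h1 (R' := R')
      (le_max_left _ _) hT hT0.le)
    have hKc := isCompact_innerCore D δ R'
    have hKD := innerCore_subset (D := D) hδ0 R'
    set K : Set E3 := innerCore D δ R' with hK
    have hbK : ball x r ⊆ K := fun y hy => by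
      refine ⟨(by linarith : δ ≤ r).trans (hball y (ball_subset_closedBall hy)), ?_⟩
      rw [mem_closedBall_zero_iff]
      refine le_trans ?_ (le_max_right _ _)
      rw [mem_ball, dist_eq_norm] at hy
      have := norm_add_le x (y - x)
      rw [add_sub_cancel] at this
      linarith
    rw [Real.enorm_of_nonneg (setIntegral_nonneg hKc.measurableSet fun y _ =>
      mul_nonneg (cutoff_nonneg _ _ _) (energy_nonneg _))]
    refine ENNReal.ofReal_le_ofReal ?_
    have e1 : ∫ y in ball x r, energy c P V (y, T) =
        ∫ y in ball x r, cutoff D δ y * energy c P V (y, T) := by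
      refine setIntegral_congr_fun measurableSet_ball fun y hy => ?_
      rw [cutoff_eq_one hδ0 (le_trans (by linarith) (hball y (ball_subset_closedBall hy))), one_mul]
    rw [e1]
    refine setIntegral_mono_set ?_ ?_ (Eventually.of_forall hbK)
    · exact ((lipschitzWith_cutoff D hδ0).continuous.continuousOn.mul
        (hE.mono hKD)).integrableOn_compact hKc
    · exact .of_forall fun y => mul_nonneg (cutoff_nonneg _ _ _) (energy_nonneg _)
  have hlim : Tendsto (fun δ => ENNReal.ofReal (c ^ 2) * (3 * F δ) * ENNReal.ofReal (T - t₀))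
      (𝓝[>] 0) (𝓝 0) := by
    have := ENNReal.Tendsto.mul_const (b := ENNReal.ofReal (T - t₀)) (ENNReal.Tendsto.const_mul
      (a := ENNReal.ofReal (c ^ 2)) (ENNReal.Tendsto.const_mul (a := 3) hF0 (.inr (by simp)))
      (.inr (by simp))) (.inr (by simp))
    simpa using this
  have hzero : ∫ y in ball x r, energy c P V (y, T) = 0 := by
    refine le_antisymm (ENNReal.ofReal_eq_zero.1 (le_antisymm (ge_of_tendsto hlim hbound) bot_le))
      (setIntegral_nonneg measurableSet_ball fun y _ => energy_nonneg _)
  have hint : IntegrableOn (fun y => energy c P V (y, T)) (ball x r) :=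
    ((hE.mono hballD).integrableOn_compact (isCompact_closedBall x _)).mono_set
      ball_subset_closedBall
  have hae := (integral_eq_zero_iff_of_nonneg (fun y => energy_nonneg (c := c) (P := P) (V := V)
    (y, T)) hint).1 hzero
  have heq := Measure.eqOn_open_of_ae_eq hae isOpen_ball
    (hE.mono (ball_subset_closedBall.trans hballD)) continuousOn_const
  have h0 : energy c P V (x, T) = 0 := heq (mem_ball_self hr0)
  have hc2 : 0 < c ^ 2 := by positivity
  have hsum : 0 ≤ ∑ i, V i (x, T) ^ 2 := Finset.sum_nonneg fun i _ => sq_nonneg _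
  have hPsq := sq_nonneg (P (x, T))
  rw [energy] at h0
  have hV0 : ∑ i, V i (x, T) ^ 2 = 0 := by nlinarith
  refine ⟨pow_eq_zero_iff two_ne_zero |>.1 (by nlinarith), fun i => ?_⟩
  exact pow_eq_zero_iff two_ne_zero |>.1
    ((Finset.sum_eq_zero_iff_of_nonneg fun i _ => sq_nonneg _).1 hV0 i (Finset.mem_univ i))

end

end IsAcousticField

end

/-! ### The flux through a thin boundary strip -/

theorem ENNReal_mul_le_sq_add_sq (a b : ℝ≥0∞) : a * b ≤ a ^ 2 + b ^ 2 := by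
  rcases le_total a b with h | h
  · exact (mul_le_mul_left h b).trans (by rw [← sq]; exact le_add_self)
  · exact (mul_le_mul_right h a).trans (by rw [← sq]; exact le_self_add)

/-- Tonelli, `a b ≤ a² + b²`, and translation invariance for each fixed `s`. -/
theorem lintegral_mul_lintegral_translate_le {g : E3 → ℝ≥0∞} (hg : Measurable g) (n : E3)
    (ℓ : ℝ) :
    ∫⁻ x, g x * ∫⁻ s in Ioo 0 ℓ, g (x + s • n) ≤ ENNReal.ofReal ℓ * (2 * ∫⁻ x, g x ^ 2) := by
  have hm : Measurable fun p : E3 × ℝ => g (p.1 + p.2 • n) := hg.comp (by fun_prop)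
  calc ∫⁻ x, g x * ∫⁻ s in Ioo 0 ℓ, g (x + s • n)
      = ∫⁻ x, ∫⁻ s in Ioo 0 ℓ, g x * g (x + s • n) := by
        refine lintegral_congr fun x => ?_
        exact (lintegral_const_mul _ (hm.comp measurable_prodMk_left)).symm
    _ = ∫⁻ s in Ioo 0 ℓ, ∫⁻ x, g x * g (x + s • n) :=
        lintegral_lintegral_swap ((hg.comp measurable_fst).mul hm).aemeasurable
    _ ≤ ∫⁻ s in Ioo 0 ℓ, 2 * ∫⁻ x, g x ^ 2 := by
        refine lintegral_mono fun s => ?_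
        calc ∫⁻ x, g x * g (x + s • n) ≤ ∫⁻ x, (g x ^ 2 + g (x + s • n) ^ 2) :=
              lintegral_mono fun x => ENNReal_mul_le_sq_add_sq _ _
          _ = (∫⁻ x, g x ^ 2) + ∫⁻ x, g (x + s • n) ^ 2 := lintegral_add_left (hg.pow_const 2) _
          _ = _ := by
            rw [lintegral_add_right_eq_self (fun x => g x ^ 2) (s • n), two_mul]
    _ = _ := by
        rw [setLIntegral_const, Real.volume_Ioo, sub_zero, mul_comm]

/-- The fundamental theorem of calculus along the segment. It is applied up to length `s - t` and
then `t → 0`, because `p` is not differentiable, nor known to be continuous, at the boundary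
endpoint. -/
theorem enorm_le_lintegral_of_tendsto_zero {D : Set E3} (hD : IsOpen D) {p : E3 → ℝ}
    (hp : ContDiffOn ℝ 1 p D) {g : E3 → ℝ≥0∞} {x n : E3} (hn : ‖n‖ = 1) {s : ℝ} (hs : 0 < s)
    (hx : ∀ t ∈ Ico 0 s, x + t • n ∈ D) (hg : ∀ t ∈ Ico 0 s, ‖fderiv ℝ p (x + t • n)‖ₑ ≤ g (x + t • n))
    (hlim : Tendsto (fun t : ℝ => p (x + s • n - t • n)) (𝓝[>] 0) (𝓝 0)) :
    ‖p x‖ₑ ≤ ∫⁻ t in Ioo 0 s, g (x + t • n) := by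
  have hcont := hp.continuousOn_fderiv_of_isOpen hD le_rfl
  have hstep : ∀ t ∈ Ioo 0 s,
      ‖p x‖ₑ ≤ ‖p (x + s • n - t • n)‖ₑ + ∫⁻ t in Ioo 0 s, g (x + t • n) := by
    intro t ht
    set r := s - t with hr
    have hr0 : 0 ≤ r := by have := ht.2; linarith
    have hrs : r < s := by have := ht.1; linarith
    have hsub : ∀ u ∈ uIcc 0 r, u ∈ Ico 0 s := fun u hu => by
      rw [uIcc_of_le hr0] at hu
      exact ⟨hu.1, hu.2.trans_lt hrs⟩
    have hder : ∀ u ∈ uIcc 0 r, HasDerivAt (fun u : ℝ => p (x + u • n))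
        (fderiv ℝ p (x + u • n) n) u := by
      intro u hu
      have h1 : HasDerivAt (fun u : ℝ => x + u • n) n u := by
        simpa using ((hasDerivAt_id u).smul_const n).const_add x
      exact ((hp.contDiffAt (hD.mem_nhds (hx u (hsub u hu)))).differentiableAt
        one_ne_zero).hasFDerivAt.comp_hasDerivAt u h1
    have hint : IntervalIntegrable (fun u : ℝ => fderiv ℝ p (x + u • n) n) volume 0 r := by
      refine ContinuousOn.intervalIntegrable ?_
      refine (hcont.comp (f := fun u : ℝ => x + u • n) (by fun_prop)
        fun u hu => hx u (hsub u hu)).clm_apply continuousOn_const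
    have hFTC := intervalIntegral.integral_eq_sub_of_hasDerivAt hder hint
    rw [zero_smul, add_zero, intervalIntegral.integral_of_le hr0] at hFTC
    have e1 : x + s • n - t • n = x + r • n := by rw [hr, sub_smul]; abel
    have e2 : p x = p (x + r • n) - ∫ u in Ioc 0 r, fderiv ℝ p (x + u • n) n := by
      rw [hFTC]; ring
    rw [e1, e2]
    refine (enorm_sub_le).trans (add_le_add le_rfl ?_)
    refine (enorm_integral_le_lintegral_enorm _).trans ?_
    refine (lintegral_mono_set (μ := volume) (show Ioc 0 r ⊆ Ioo 0 s from
      fun u hu => ⟨hu.1, hu.2.trans_lt hrs⟩)).trans ?_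
    refine setLIntegral_mono' measurableSet_Ioo fun u hu => ?_
    refine le_trans ?_ (hg u ⟨hu.1.le, hu.2⟩)
    have := (fderiv ℝ p (x + u • n)).le_opENorm n
    rwa [← ofReal_norm n, hn, ENNReal.ofReal_one, mul_one] at this
  have h0 : Tendsto (fun t : ℝ => ‖p (x + s • n - t • n)‖ₑ + ∫⁻ t in Ioo 0 s, g (x + t • n))
      (𝓝[>] 0) (𝓝 (0 + ∫⁻ t in Ioo 0 s, g (x + t • n))) := by
    refine Tendsto.add ?_ tendsto_const_nhds
    have h1 := (continuous_enorm.tendsto (0 : ℝ)).comp hlim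
    rwa [enorm_zero] at h1
  rw [zero_add] at h0
  refine ge_of_tendsto h0 ?_
  filter_upwards [Ioo_mem_nhdsGT hs] with t ht using hstep t ht

/-- The function `p` on `D` tends to zero at `y` along the direction of each graph chart. -/
def VanishesTransversally (D : Set E3) (p : E3 → ℝ) (y : E3) : Prop :=
  ∀ n φ K x ρ, IsGraphChart D n φ K x ρ → y ∈ ball x ρ →
    Tendsto (fun t : ℝ => p (y - t • n)) (𝓝[>] 0) (𝓝 0)

/-- A strip point reaches `Γ` along a chart direction within length `L * δ`, so `|p|` is at most the
integral of `g` over that segment, while `|w| ≤ g`. The product therefore integrates to at most `2 L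
δ` times the integral of `g²` over a neighbourhood of `Γ` in `D` that shrinks to the empty set. The
function `F` does not depend on `p` and `w`, so the bound holds for all times at once when these are
time slices. -/
theorem HasLipschitzBoundary.exists_strip_bound {D Γ : Set E3} (h : HasLipschitzBoundary D Γ)
    (hΓ : Γ.Nonempty) {R : ℝ} (hR : cthickening 1 Γ ⊆ closedBall 0 R) {g : E3 → ℝ≥0∞}
    (hg : Measurable g) (hg2 : ∫⁻ x in closedBall (0 : E3) R, g x ^ 2 < ∞) :
    ∃ F : ℝ → ℝ≥0∞, Tendsto F (𝓝[>] 0) (𝓝 0) ∧ ∀ᶠ δ in 𝓝[>] (0 : ℝ), ∀ p w : E3 → ℝ,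
      ContDiffOn ℝ 1 p D →
      (∀ x ∈ D ∩ closedBall 0 R, ‖fderiv ℝ p x‖ₑ ≤ g x) →
      (∀ x ∈ D ∩ closedBall 0 R, ‖w x‖ₑ ≤ g x) →
      (∀ᵐ y ∂(μHE[2] : Measure E3).restrict Γ, VanishesTransversally D p y) →
      ∫⁻ x in {x ∈ D | infDist x Dᶜ < 3 * δ}, ‖p x * w x‖ₑ ≤ ENNReal.ofReal δ * F δ := by
  have hΓm : MeasurableSet Γ := h.isCompact.measurableSet
  have hDm : MeasurableSet D := h.isOpen.measurableSet
  have hcontΓ : Continuous fun x : E3 => infDist x Γ := continuous_infDist_pt _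
  choose! n φ K ρ hc using h.exists_chart
  obtain ⟨t, htΓ, ht⟩ := h.isCompact.elim_nhds_subcover (fun x => ball x (ρ x / 2))
    fun x hx => ball_mem_nhds x (half_pos (hc x hx).radius_pos)
  obtain ⟨δ₁, hδ₁, hthick⟩ := h.isCompact.exists_thickening_subset_open
    (isOpen_biUnion fun x _ => isOpen_ball) ht
  -- In a chart with constant `K` the boundary is hit within `(K + 1) * 3δ`. The sum over the finite
  -- cover dominates every single `K`.
  set L : ℝ := 3 * (∑ x ∈ t, (K x : ℝ) + 1) with hL
  have hsum0 : 0 ≤ ∑ x ∈ t, (K x : ℝ) := Finset.sum_nonneg fun x _ => (K x).2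
  have hL3 : 3 ≤ L := by linarith
  have hKL : ∀ x ∈ t, ((K x : ℝ) + 1) * 3 ≤ L := fun x hx => by
    have := Finset.single_le_sum (f := fun x => (K x : ℝ)) (fun x _ => (K x).2) hx
    linarith
  set S : ℝ → Set E3 := fun δ => {x ∈ D | infDist x Γ ≤ L * δ} with hS
  have hSm : ∀ δ, MeasurableSet (S δ) := fun δ =>
    hDm.inter (isClosed_le hcontΓ continuous_const).measurableSet
  set μ : Measure E3 := volume.restrict (closedBall 0 R) with hμ
  have : IsFiniteMeasure μ := ⟨by
    rw [hμ, Measure.restrict_apply_univ]; exact measure_closedBall_lt_top⟩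
  refine ⟨fun δ => t.card * (ENNReal.ofReal L * (2 * ∫⁻ x in S δ, g x ^ 2 ∂μ)), ?_, ?_⟩
  · have h1 : Tendsto (μ ∘ S) (𝓝[>] 0) (𝓝 0) := by
      have h2 := tendsto_measure_biInter_gt (μ := μ) (s := S) (a := 0)
        (fun δ _ => (hSm δ).nullMeasurableSet)
        (fun i j _ hij x hx => ⟨hx.1, hx.2.trans (by gcongr)⟩) ⟨1, one_pos, measure_ne_top _ _⟩
      -- A point common to all these sets would lie both in `D` and in `Γ`.
      have h3 : ⋂ r > (0 : ℝ), S r = ∅ := by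
        refine eq_empty_of_forall_notMem fun x hx => ?_
        have hx' : ∀ r > (0 : ℝ), x ∈ S r := fun r hr => mem_iInter₂.1 hx r hr
        have hle : infDist x Γ ≤ 0 := by
          refine le_of_forall_pos_le_add fun ε hε => ?_
          have := (hx' (ε / L) (by positivity)).2
          rwa [mul_div_cancel₀ _ (by linarith), ← zero_add ε] at this
        have hxΓ : x ∈ Γ := by
          rw [h.isCompact.isClosed.mem_iff_infDist_zero hΓ]
          exact le_antisymm hle infDist_nonneg
        exact disjoint_left.1 h.disjoint (hx' 1 one_pos).1 hxΓ
      rwa [h3, measure_empty] at h2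
    have h4 := tendsto_setLIntegral_zero hg2.ne h1
    have := ENNReal.Tendsto.const_mul (a := (t.card : ℝ≥0∞)) (ENNReal.Tendsto.const_mul
      (a := ENNReal.ofReal L) (ENNReal.Tendsto.const_mul (a := 2) h4 (.inr (by simp)))
      (.inr (by simp))) (.inr (by simp))
    simpa using this
  have hsmall : ∀ᶠ δ in 𝓝[>] (0 : ℝ), 0 < δ ∧ 3 * δ < δ₁ ∧ L * δ < 1 ∧
      ∀ x ∈ t, ((K x : ℝ) + 2) * (3 * δ) < ρ x / 2 := by
    have hlt : ∀ (a b : ℝ), 0 < b → ∀ᶠ δ in 𝓝[>] (0 : ℝ), a * δ < b := fun a b hb => by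
      have hcont : Continuous fun δ : ℝ => a * δ := by fun_prop
      have h1 : Tendsto (fun δ : ℝ => a * δ) (𝓝[>] 0) (𝓝 0) := by
        simpa using (hcont.tendsto 0).mono_left nhdsWithin_le_nhds
      exact h1.eventually (Iio_mem_nhds hb)
    refine eventually_mem_nhdsWithin.and ((hlt 3 _ hδ₁).and ((hlt L 1 one_pos).and ?_))
    rw [eventually_all_finset]
    intro x hx
    simp_rw [← mul_assoc]
    exact hlt _ _ (half_pos (hc x (htΓ x hx)).radius_pos)
  filter_upwards [hsmall] with δ hδ p w hp hpg hwg hpE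
  obtain ⟨hδ0, hδ₁', hLδ, hρδ⟩ := hδ
  have hSR : S δ ⊆ D ∩ closedBall 0 R := fun x hx => ⟨hx.1, hR
    (by
      rw [cthickening_eq_preimage_infEDist, Set.mem_preimage, Set.mem_Iic,
        ENNReal.le_ofReal_iff_toReal_le (infEDist_ne_top hΓ) zero_le_one]
      exact hx.2.trans hLδ.le)⟩
  set G : E3 → ℝ≥0∞ := (S δ).indicator g with hG
  have hGm : Measurable G := hg.indicator (hSm δ)
  have hGint : ∫⁻ x, G x ^ 2 = ∫⁻ x in S δ, g x ^ 2 ∂μ := by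
    rw [hμ, Measure.restrict_restrict (hSm δ), inter_eq_left.2 fun x hx => (hSR hx).2,
      ← lintegral_indicator (hSm δ)]
    refine lintegral_congr fun x => ?_
    by_cases hx : x ∈ S δ <;> simp [hG, hx]
  set strip : Set E3 := {x ∈ D | infDist x Dᶜ < 3 * δ} with hstrip
  have hstripm : MeasurableSet strip :=
    hDm.inter (isOpen_lt (continuous_infDist_pt _) continuous_const).measurableSet
  have hnear : ∀ x ∈ strip, ∃ y ∈ Γ, ‖x - y‖ < 3 * δ := by
    intro x hx
    have hDu : D ≠ univ := by
      rintro rfl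
      rw [← h.frontier_eq, frontier_univ] at hΓ
      exact not_nonempty_empty hΓ
    obtain ⟨y, hy, hxy⟩ := exists_mem_frontier_infDist_compl_eq_dist hx.1 hDu
    exact ⟨y, h.frontier_eq ▸ hy, by rw [← dist_eq_norm, ← hxy]; exact hx.2⟩
  have hcover : strip ⊆ ⋃ x ∈ t, strip ∩ ball x (ρ x / 2) := by
    intro x hx
    obtain ⟨y, hy, hxy⟩ := hnear x hx
    have hxt : x ∈ thickening δ₁ Γ := mem_thickening_iff.2 ⟨y, hy, by
      rw [dist_eq_norm]; linarith⟩
    obtain ⟨z, hz, hxz⟩ := mem_iUnion₂.1 (hthick hxt)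
    exact mem_iUnion₂.2 ⟨z, hz, hx, hxz⟩
  obtain ⟨E, hE, hE0⟩ : ∃ E : Set E3, (∀ y ∈ Γ, y ∉ E → VanishesTransversally D p y) ∧
      μHE[2] E = 0 := by
    rw [ae_restrict_iff' hΓm] at hpE
    refine ⟨_, fun y hy hyE => ?_, hpE⟩
    by_contra hcon
    exact hyE fun hh => hcon (hh hy)
  have hpiece : ∀ z ∈ t, ∫⁻ x in strip ∩ ball z (ρ z / 2), ‖p x * w x‖ₑ ≤
      ENNReal.ofReal (L * δ) * (2 * ∫⁻ x, G x ^ 2) := by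
    intro z hz
    have hcz := hc z (htΓ z hz)
    refine le_trans ?_ (lintegral_mul_lintegral_translate_le hGm (n z) (L * δ))
    refine le_trans ?_ (setLIntegral_le_lintegral (strip ∩ ball z (ρ z / 2)) _)
    refine lintegral_mono_ae ?_
    rw [ae_restrict_iff' (hstripm.inter measurableSet_ball)]
    -- For almost every `x` the whole line in the chart direction misses the null set `E`, so the
    -- endpoint of the segment is a point where `p` tends to zero.
    filter_upwards [ae_forall_add_smul_notMem hE0 hcz.norm_eq_one] with x hxE hx
    obtain ⟨y, hy, hxy⟩ := hnear x hx.1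
    obtain ⟨s, hs0, hsδ, hsΓ, hsb, hsD⟩ := hcz.exists_hit h.isOpen hx.2 hx.1.1
      (h.frontier_eq ▸ hy) hxy (hρδ z hz).le
    rw [h.frontier_eq] at hsΓ
    have hsL : s ≤ L * δ := hsδ.trans (by nlinarith [hKL z hz])
    have hmemS : ∀ u ∈ Ico 0 s, x + u • n z ∈ S δ := by
      intro u hu
      refine ⟨hsD u hu, (infDist_le_dist_of_mem hsΓ).trans ?_⟩
      rw [dist_eq_norm, show x + u • n z - (x + s • n z) = (u - s) • n z by rw [sub_smul]; abel,
        norm_smul, hcz.norm_eq_one, mul_one, Real.norm_eq_abs, abs_sub_comm,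
        abs_of_nonneg (by linarith [hu.2])]
      linarith [hu.1]
    have hxS : x ∈ S δ := by simpa using hmemS 0 ⟨le_rfl, hs0⟩
    have h1 : ‖p x‖ₑ ≤ ∫⁻ u in Ioo 0 s, G (x + u • n z) := by
      refine enorm_le_lintegral_of_tendsto_zero h.isOpen hp hcz.norm_eq_one hs0 hsD
        (fun u hu => ?_) (hE _ hsΓ (hxE s) _ _ _ _ _ hcz hsb)
      rw [hG, indicator_of_mem (hmemS u hu)]
      exact hpg _ (hSR (hmemS u hu))
    have h2 : ‖w x‖ₑ ≤ G x := by
      rw [hG, indicator_of_mem hxS]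
      exact hwg _ (hSR hxS)
    rw [enorm_mul, mul_comm]
    refine mul_le_mul' h2 (h1.trans (lintegral_mono_set (Ioo_subset_Ioo_right hsL)))
  calc ∫⁻ x in strip, ‖p x * w x‖ₑ
      ≤ ∫⁻ x in ⋃ z ∈ t, strip ∩ ball z (ρ z / 2), ‖p x * w x‖ₑ := lintegral_mono_set hcover
    _ ≤ ∑ z ∈ t, ∫⁻ x in strip ∩ ball z (ρ z / 2), ‖p x * w x‖ₑ := by
        rw [show (⋃ z ∈ t, strip ∩ ball z (ρ z / 2)) =
          ⋃ z : {z // z ∈ t}, strip ∩ ball z.1 (ρ z.1 / 2) by rw [iUnion_subtype]]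
        refine (lintegral_iUnion_le _ _).trans_eq ?_
        exact Finset.tsum_subtype t fun z => ∫⁻ x in strip ∩ ball z (ρ z / 2), ‖p x * w x‖ₑ
    _ ≤ ∑ z ∈ t, ENNReal.ofReal (L * δ) * (2 * ∫⁻ x, G x ^ 2) := Finset.sum_le_sum hpiece
    _ = _ := by
        rw [Finset.sum_const, nsmul_eq_mul, hGint, ENNReal.ofReal_mul (by linarith)]
        ring

/-! ### Differentiation of retarded potentials off the boundary -/

theorem contDiffOn_one_of_hasFDerivAt {E : Type*} [NormedAddCommGroup E] [NormedSpace ℝ E]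
    {Q : Set E} (hQ : IsOpen Q) {f : E → ℝ} {f' : E → E →L[ℝ] ℝ}
    (hf : ∀ q ∈ Q, HasFDerivAt f (f' q) q) (hf' : ContinuousOn f' Q) : ContDiffOn ℝ 1 f Q := by
  rw [show (1 : WithTop ℕ∞) = 0 + 1 by norm_num, contDiffOn_succ_iff_fderiv_of_isOpen hQ]
  refine ⟨fun q hq => (hf q hq).differentiableAt.differentiableWithinAt, by simp, ?_⟩
  rw [contDiffOn_zero]
  exact hf'.congr fun q hq => (hf q hq).fderiv

/-- Differentiability and continuity of the derivative are local, so a majorant near each point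
suffices. Off `Γ` the retarded kernels only have locally uniform bounds. -/
theorem contDiffOn_integral_of_dominated {X : Type*} [MeasurableSpace X] {ν : Measure X}
    {E : Type*} [NormedAddCommGroup E] [NormedSpace ℝ E]
    {Q : Set E} (hQ : IsOpen Q) {k : E → X → ℝ} {k' : E → X → E →L[ℝ] ℝ}
    (hk : ∀ q ∈ Q, Integrable (k q) ν) (hk' : ∀ q ∈ Q, AEStronglyMeasurable (k' q) ν)
    (hdiff : ∀ᵐ x ∂ν, ∀ q ∈ Q, HasFDerivAt (fun q => k q x) (k' q x) q)
    (hcont : ∀ᵐ x ∂ν, ContinuousOn (fun q => k' q x) Q)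
    (hbound : ∀ q ∈ Q, ∃ U ∈ 𝓝 q, ∃ bound : X → ℝ, Integrable bound ν ∧
      ∀ᵐ x ∂ν, ∀ q' ∈ U, ‖k' q' x‖ ≤ bound x) :
    ContDiffOn ℝ 1 (fun q => ∫ x, k q x ∂ν) Q ∧
      ∀ q ∈ Q, Integrable (k' q) ν ∧ HasFDerivAt (fun q => ∫ x, k q x ∂ν) (∫ x, k' q x ∂ν) q := by
  have hder : ∀ q ∈ Q, HasFDerivAt (fun q => ∫ x, k q x ∂ν) (∫ x, k' q x ∂ν) q := by
    intro q hq
    obtain ⟨U, hU, bound, hb, hle⟩ := hbound q hq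
    refine hasFDerivAt_integral_of_dominated_of_fderiv_le (s := U ∩ Q) (bound := bound)
      (inter_mem hU (hQ.mem_nhds hq)) ?_ (hk q hq) (hk' q hq) ?_ hb ?_
    · filter_upwards [hQ.mem_nhds hq] with q' hq' using (hk q' hq').aestronglyMeasurable
    · filter_upwards [hle] with x hx q' hq' using hx q' hq'.1
    · filter_upwards [hdiff] with x hx q' hq' using hx q' hq'.2
  refine ⟨contDiffOn_one_of_hasFDerivAt hQ hder fun q hq => ContinuousAt.continuousWithinAt ?_,
    fun q hq => ⟨?_, hder q hq⟩⟩
  · obtain ⟨U, hU, bound, hb, hle⟩ := hbound q hq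
    refine continuousAt_of_dominated (bound := bound) ?_ ?_ hb ?_
    · filter_upwards [hQ.mem_nhds hq] with q' hq' using hk' q' hq'
    · filter_upwards [hU] with q' hq'
      filter_upwards [hle] with x hx using hx q' hq'
    · filter_upwards [hcont] with x hx using hx.continuousAt (hQ.mem_nhds hq)
  · obtain ⟨U, hU, bound, hb, hle⟩ := hbound q hq
    refine hb.mono' (hk' q hq) ?_
    filter_upwards [hle] with x hx using hx q (mem_of_mem_nhds hU)

theorem hasFDerivAt_norm_E3 {z : E3} (hz : z ≠ 0) :
    HasFDerivAt (fun z : E3 => ‖z‖) (‖z‖⁻¹ • innerSL ℝ z) z := by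
  have h1 := (hasStrictFDerivAt_norm_sq z).hasFDerivAt.sqrt (by simpa using hz)
  simp only [Real.sqrt_sq (norm_nonneg _)] at h1
  refine h1.congr_fderiv ?_
  rw [one_div, mul_inv, two_nsmul, ← two_smul ℝ, smul_smul]
  congr 1
  field_simp

/-- The generic retarded potential with density `B` and spatial kernel `a`. -/
noncomputable def retardedPotential (c : ℝ) (Γ : Set E3) (B : E3 → ℝ → ℝ) (a : E3 → ℝ)
    (q : E3 × ℝ) : ℝ :=
  ∫ y in Γ, B y (q.2 - ‖q.1 - y‖ / c) * a (q.1 - y) ∂μHE[2]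

/-- The derivative of the retarded time `t - ‖x - y‖ / c` in terms of `z = x - y`. -/
noncomputable def retardedTimeDeriv (c : ℝ) (z : E3) : E3 × ℝ →L[ℝ] ℝ :=
  ContinuousLinearMap.snd ℝ E3 ℝ -
    (c⁻¹ * ‖z‖⁻¹) • (innerSL ℝ z).comp (ContinuousLinearMap.fst ℝ E3 ℝ)

/-- The derivative of the integrand of `retardedPotential`. -/
noncomputable def retardedKernelDeriv (c : ℝ) (B B' : E3 → ℝ → ℝ) (a : E3 → ℝ)
    (a' : E3 → E3 →L[ℝ] ℝ) (q : E3 × ℝ) (y : E3) : E3 × ℝ →L[ℝ] ℝ :=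
  B' y (q.2 - ‖q.1 - y‖ / c) • a (q.1 - y) • retardedTimeDeriv c (q.1 - y) +
    B y (q.2 - ‖q.1 - y‖ / c) • (a' (q.1 - y)).comp (ContinuousLinearMap.fst ℝ E3 ℝ)

theorem retardedKernelDeriv_apply_fst (c : ℝ) (B B' : E3 → ℝ → ℝ) (a : E3 → ℝ)
    (a' : E3 → E3 →L[ℝ] ℝ) (q : E3 × ℝ) (y e : E3) :
    retardedKernelDeriv c B B' a a' q y (e, 0) =
      B' y (q.2 - ‖q.1 - y‖ / c) * (a (q.1 - y) * -(c⁻¹ * ‖q.1 - y‖⁻¹ * ⟪q.1 - y, e⟫)) +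
        B y (q.2 - ‖q.1 - y‖ / c) * a' (q.1 - y) e := by
  simp [retardedKernelDeriv, retardedTimeDeriv, inner_sub_left]

theorem retardedKernelDeriv_apply_snd (c : ℝ) (B B' : E3 → ℝ → ℝ) (a : E3 → ℝ)
    (a' : E3 → E3 →L[ℝ] ℝ) (q : E3 × ℝ) (y : E3) :
    retardedKernelDeriv c B B' a a' q y (0, 1) =
      B' y (q.2 - ‖q.1 - y‖ / c) * a (q.1 - y) := by
  simp [retardedKernelDeriv, retardedTimeDeriv]

/-- A kernel that is continuously differentiable away from the origin. -/
structure IsSmoothKernel (a : E3 → ℝ) (a' : E3 → E3 →L[ℝ] ℝ) : Prop where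
  hasFDerivAt : ∀ z ≠ 0, HasFDerivAt a (a' z) z
  continuousOn : ContinuousOn a' {0}ᶜ

theorem IsSmoothKernel.continuousOn_self {a : E3 → ℝ} {a' : E3 → E3 →L[ℝ] ℝ}
    (h : IsSmoothKernel a a') : ContinuousOn a {0}ᶜ :=
  fun z hz => (h.hasFDerivAt z hz).continuousAt.continuousWithinAt

/-- A density differentiable in time, vanishing up to time `t₀`, and bounded by an integrable
function of space together with its derivative for times less than `N`. -/
structure IsC1Density (Γ : Set E3) (N : ℝ) (m : E3 → ℝ) (B B' : E3 → ℝ → ℝ) : Prop where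
  measurable : Measurable fun p : E3 × ℝ => B p.1 p.2
  measurable' : Measurable fun p : E3 × ℝ => B' p.1 p.2
  hasDerivAt : ∀ y t, HasDerivAt (B y) (B' y t) t
  continuous : ∀ y, Continuous (B' y)
  abs_le : ∀ y, ∀ t < N, |B y t| ≤ m y
  abs_le' : ∀ y, ∀ t < N, |B' y t| ≤ m y
  integrable : IntegrableOn m Γ μHE[2]

theorem continuousOn_retardedTimeDeriv (c : ℝ) : ContinuousOn (retardedTimeDeriv c) {0}ᶜ := by
  unfold retardedTimeDeriv
  have h1 : ContinuousOn (fun z : E3 => c⁻¹ * ‖z‖⁻¹) {0}ᶜ :=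
    continuousOn_const.mul (continuous_norm.continuousOn.inv₀ fun z hz => by simpa using hz)
  have h2 : ContinuousOn (fun z : E3 => (innerSL ℝ z).comp (ContinuousLinearMap.fst ℝ E3 ℝ)) {0}ᶜ :=
    ((innerSL ℝ).continuous.continuousOn).clm_comp continuousOn_const
  exact continuousOn_const.sub (h1.smul h2)

/-- For `x` near a point off `Γ` the differences `x - y` stay in a compact set avoiding the origin,
where the kernel and its derivative are bounded. Retarded times stay below `N`, so `m` bounds the
density and its time derivative. -/
theorem contDiffOn_retardedPotential {c : ℝ} (hc : 0 < c) {Γ : Set E3} (hΓ : IsCompact Γ) {N : ℝ}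
    {m : E3 → ℝ} {B B' : E3 → ℝ → ℝ} (hB : IsC1Density Γ N m B B') {a : E3 → ℝ}
    {a' : E3 → E3 →L[ℝ] ℝ} (ha : IsSmoothKernel a a') :
    ContDiffOn ℝ 1 (retardedPotential c Γ B a) (Γᶜ ×ˢ Iio N) ∧ ∀ q ∈ Γᶜ ×ˢ Iio N,
      IntegrableOn (retardedKernelDeriv c B B' a a' q) Γ μHE[2] ∧
      HasFDerivAt (retardedPotential c Γ B a)
        (∫ y in Γ, retardedKernelDeriv c B B' a a' q y ∂μHE[2]) q := by
  have hΓm := hΓ.measurableSet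
  have hne : ∀ {x y : E3}, x ∈ Γᶜ → y ∈ Γ → x - y ∈ ({0}ᶜ : Set E3) := fun hx hy h =>
    hx (by rw [mem_singleton_iff, sub_eq_zero] at h; rwa [h])
  have hret : ∀ {x y : E3} {t : ℝ}, t < N → t - ‖x - y‖ / c < N := fun {x y t} ht =>
    (sub_le_self t (by positivity : 0 ≤ ‖x - y‖ / c)).trans_lt ht
  have hrettime : ∀ q : E3 × ℝ, Measurable fun y : E3 => (y, q.2 - ‖q.1 - y‖ / c) := fun q => by
    fun_prop
  have hslice : ∀ (f : E3 → ℝ) (x : E3), x ∈ Γᶜ → ContinuousOn f {0}ᶜ →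
      ContinuousOn (fun y => f (x - y)) Γ := fun f x hx hf =>
    hf.comp (by fun_prop) fun y hy => hne hx hy
  have hsliceL : ∀ (f : E3 → E3 × ℝ →L[ℝ] ℝ) (x : E3), x ∈ Γᶜ → ContinuousOn f {0}ᶜ →
      ContinuousOn (fun y => f (x - y)) Γ := fun f x hx hf =>
    hf.comp (by fun_prop) fun y hy => hne hx hy
  set W₁ : E3 → E3 × ℝ →L[ℝ] ℝ := fun z => a z • retardedTimeDeriv c z with hW₁
  set W₂ : E3 → E3 × ℝ →L[ℝ] ℝ := fun z => (a' z).comp (ContinuousLinearMap.fst ℝ E3 ℝ) with hW₂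
  have hW₁c : ContinuousOn W₁ {0}ᶜ := ha.continuousOn_self.smul (continuousOn_retardedTimeDeriv c)
  have hW₂c : ContinuousOn W₂ {0}ᶜ := ha.continuousOn.clm_comp continuousOn_const
  refine contDiffOn_integral_of_dominated (hΓ.isClosed.isOpen_compl.prod isOpen_Iio) ?_ ?_ ?_ ?_ ?_
  · rintro ⟨x, t⟩ ⟨hx, ht⟩
    have hac := hslice a x hx ha.continuousOn_self
    obtain ⟨C, hC⟩ := hΓ.exists_bound_of_continuousOn hac
    refine (hB.integrable.mul_const C).mono' (((hB.measurable.comp (hrettime (x, t))).aestronglyMeasurable).mul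
      (hac.aestronglyMeasurable hΓm)) ?_
    filter_upwards [ae_restrict_mem hΓm] with y hy
    rw [norm_mul]
    have h1 := hB.abs_le y _ (hret (x := x) (y := y) ht)
    exact mul_le_mul h1 (hC y hy) (norm_nonneg _) ((abs_nonneg _).trans h1)
  · rintro ⟨x, t⟩ ⟨hx, ht⟩
    refine AEStronglyMeasurable.add ?_ ?_
    · exact ((hB.measurable'.comp (hrettime (x, t))).aestronglyMeasurable).smul
        ((hsliceL W₁ x hx hW₁c).aestronglyMeasurable hΓm)
    · exact ((hB.measurable.comp (hrettime (x, t))).aestronglyMeasurable).smul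
        ((hsliceL W₂ x hx hW₂c).aestronglyMeasurable hΓm)
  · filter_upwards [ae_restrict_mem hΓm] with y hy
    rintro ⟨x, t⟩ ⟨hx, ht⟩
    have hz : x - y ≠ 0 := hne hx hy
    have hsub : HasFDerivAt (fun q : E3 × ℝ => q.1 - y) (ContinuousLinearMap.fst ℝ E3 ℝ) (x, t) :=
      (ContinuousLinearMap.fst ℝ E3 ℝ).hasFDerivAt.sub_const y
    have h1 : HasFDerivAt (fun q : E3 × ℝ => q.2 - ‖q.1 - y‖ / c) (retardedTimeDeriv c (x - y))
        (x, t) := by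
      have h2 := (HasFDerivAt.comp (x, t) (hasFDerivAt_norm_E3 hz) hsub).mul_const c⁻¹
      refine ((ContinuousLinearMap.snd ℝ E3 ℝ).hasFDerivAt.fun_sub h2).congr_fderiv ?_
      rw [retardedTimeDeriv, ContinuousLinearMap.smul_comp, smul_smul]
    have h3 := (hB.hasDerivAt y (t - ‖x - y‖ / c)).comp_hasFDerivAt (x, t) h1
    have h4 := HasFDerivAt.comp (x, t) (ha.hasFDerivAt _ hz) hsub
    refine (h3.mul h4).congr_fderiv ?_
    simp only [retardedKernelDeriv, Function.comp]
    rw [add_comm, smul_smul, smul_smul, mul_comm]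
  · filter_upwards [ae_restrict_mem hΓm] with y hy
    have hτ : Continuous fun q : E3 × ℝ => q.2 - ‖q.1 - y‖ / c := by fun_prop
    have hBc : Continuous (B y) := continuous_iff_continuousAt.2 fun t => (hB.hasDerivAt y t).continuousAt
    have hmap : MapsTo (fun q : E3 × ℝ => q.1 - y) (Γᶜ ×ˢ Iio N) {0}ᶜ := fun q hq => hne hq.1 hy
    refine ContinuousOn.add ?_ ?_
    · exact ((hB.continuous y).comp hτ).continuousOn.smul (hW₁c.comp (by fun_prop) hmap)
    · exact (hBc.comp hτ).continuousOn.smul (hW₂c.comp (by fun_prop) hmap)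
  · rintro ⟨x, t⟩ ⟨hx, ht⟩
    obtain ⟨ε, hε, hball⟩ := nhds_basis_closedBall.mem_iff.1 (hΓ.isClosed.isOpen_compl.mem_nhds hx)
    set Z : Set E3 := (fun p : E3 × E3 => p.1 - p.2) '' (closedBall x ε ×ˢ Γ) with hZ
    have hZc : IsCompact Z := ((isCompact_closedBall x ε).prod hΓ).image (by fun_prop)
    have hZ0 : Z ⊆ {0}ᶜ := by
      rintro _ ⟨⟨x', y⟩, ⟨hx', hy⟩, rfl⟩
      exact hne (hball hx') hy
    obtain ⟨C₁, hC₁⟩ := hZc.exists_bound_of_continuousOn (hW₁c.mono hZ0)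
    obtain ⟨C₂, hC₂⟩ := hZc.exists_bound_of_continuousOn (hW₂c.mono hZ0)
    refine ⟨closedBall x ε ×ˢ Iio N, prod_mem_nhds (closedBall_mem_nhds x hε) (Iio_mem_nhds ht),
      fun y => m y * (C₁ + C₂), hB.integrable.mul_const _, ?_⟩
    filter_upwards [ae_restrict_mem hΓm] with y hy
    rintro ⟨x', t'⟩ ⟨hx', ht'⟩
    have hz : x' - y ∈ Z := ⟨(x', y), ⟨hx', hy⟩, rfl⟩
    have b1 := hB.abs_le' y _ (hret (x := x') (y := y) ht')
    have b2 := hB.abs_le y _ (hret (x := x') (y := y) ht')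
    have hm0 := (abs_nonneg _).trans b1
    refine (norm_add_le _ _).trans ?_
    rw [norm_smul, norm_smul (B y _), mul_add]
    exact add_le_add (mul_le_mul b1 (hC₁ _ hz) (norm_nonneg _) hm0)
      (mul_le_mul b2 (hC₂ _ hz) (norm_nonneg _) hm0)

theorem fderiv_retardedPotential_apply {c : ℝ} (hc : 0 < c) {Γ : Set E3} (hΓ : IsCompact Γ) {N : ℝ}
    {m : E3 → ℝ} {B B' : E3 → ℝ → ℝ} (hB : IsC1Density Γ N m B B') {a : E3 → ℝ}
    {a' : E3 → E3 →L[ℝ] ℝ} (ha : IsSmoothKernel a a') {q : E3 × ℝ} (hq : q ∈ Γᶜ ×ˢ Iio N)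
    (w : E3 × ℝ) :
    IntegrableOn (fun y => retardedKernelDeriv c B B' a a' q y w) Γ μHE[2] ∧
    fderiv ℝ (retardedPotential c Γ B a) q w =
      ∫ y in Γ, retardedKernelDeriv c B B' a a' q y w ∂μHE[2] := by
  obtain ⟨h1, h2⟩ := (contDiffOn_retardedPotential hc hΓ hB ha).2 q hq
  exact ⟨h1.apply_continuousLinearMap w,
    by rw [h2.fderiv, ContinuousLinearMap.integral_apply h1]⟩

/-! ### The retarded Newtonian kernel and the wave equation -/

/-- The derivative of `z ↦ ℓ z / ‖z‖ ^ k`. -/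
noncomputable def quotKernelDeriv (ℓ : E3 → ℝ) (ℓ' : E3 →L[ℝ] ℝ) (k : ℕ) (z : E3) : E3 →L[ℝ] ℝ :=
  (‖z‖ ^ k)⁻¹ • ℓ' - (k * ℓ z * (‖z‖ ^ (k + 2))⁻¹) • innerSL ℝ z

theorem isSmoothKernel_quot {ℓ : E3 → ℝ} {ℓ' : E3 →L[ℝ] ℝ} (hℓ : ∀ z, HasFDerivAt ℓ ℓ' z) (k : ℕ) :
    IsSmoothKernel (fun z => ℓ z * (‖z‖ ^ k)⁻¹) (quotKernelDeriv ℓ ℓ' k) where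
  hasFDerivAt z hz := by
    have hz' : ‖z‖ ≠ 0 := norm_ne_zero_iff.2 hz
    have h1 : HasDerivAt (fun r : ℝ => (r ^ k)⁻¹) (-(k * ‖z‖ ^ (k - 1)) / (‖z‖ ^ k) ^ 2) ‖z‖ :=
      (hasDerivAt_pow k ‖z‖).fun_inv (pow_ne_zero _ hz')
    have h2 := h1.comp_hasFDerivAt z (hasFDerivAt_norm_E3 hz)
    refine ((hℓ z).mul h2).congr_fderiv ?_
    simp only [Function.comp, quotKernelDeriv]
    rw [smul_smul, smul_smul, sub_eq_neg_add]
    congr 1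
    refine (congrArg (· • innerSL ℝ z) ?_).trans (neg_smul _ _)
    -- For `k = 0` the truncated exponent `k - 1` is harmless, as the factor `k` removes the term.
    rcases Nat.eq_zero_or_pos k with rfl | hk
    · simp
    · obtain ⟨j, rfl⟩ : ∃ j, k = j + 1 := ⟨k - 1, by omega⟩
      simp only [Nat.add_sub_cancel]
      field_simp
      ring
  continuousOn := by
    have hinv : ∀ j : ℕ, ContinuousOn (fun z : E3 => (‖z‖ ^ j)⁻¹) {0}ᶜ := fun j =>
      (continuous_norm.pow j).continuousOn.inv₀ fun z hz => by
        have : z ≠ 0 := by simpa using hz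
        exact pow_ne_zero _ (norm_ne_zero_iff.2 this)
    have hc : Continuous ℓ := continuous_iff_continuousAt.2 fun z => (hℓ z).continuousAt
    have h2 : ContinuousOn (fun z : E3 => k * ℓ z * (‖z‖ ^ (k + 2))⁻¹) {0}ᶜ :=
      (continuousOn_const.mul hc.continuousOn).mul (hinv _)
    exact ((hinv k).smul continuousOn_const).sub (h2.smul (innerSL ℝ).continuous.continuousOn)

/-- The Newtonian kernel `1 / (4π|z|)`. -/
noncomputable def newtonKernel (z : E3) : ℝ := (4 * Real.pi)⁻¹ * (‖z‖ ^ 1)⁻¹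

/-- The part of order `|z|⁻¹` of the gradient of the retarded kernel. -/
noncomputable def farKernel (c : ℝ) (i : Fin 3) (z : E3) : ℝ :=
  -(4 * Real.pi * c)⁻¹ * ⟪basisVec i, z⟫ * (‖z‖ ^ 2)⁻¹

/-- The part of order `|z|⁻²` of the gradient of the retarded kernel. -/
noncomputable def nearKernel (i : Fin 3) (z : E3) : ℝ :=
  -(4 * Real.pi)⁻¹ * ⟪basisVec i, z⟫ * (‖z‖ ^ 3)⁻¹

/-- The derivative of `newtonKernel`. -/
noncomputable def newtonKernelDeriv (z : E3) : E3 →L[ℝ] ℝ :=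
  quotKernelDeriv (fun _ => (4 * Real.pi)⁻¹) 0 1 z

/-- The derivative of `farKernel`. -/
noncomputable def farKernelDeriv (c : ℝ) (i : Fin 3) (z : E3) : E3 →L[ℝ] ℝ :=
  quotKernelDeriv (fun z => -(4 * Real.pi * c)⁻¹ * ⟪basisVec i, z⟫)
    (-(4 * Real.pi * c)⁻¹ • innerSL ℝ (basisVec i)) 2 z

/-- The derivative of `nearKernel`. -/
noncomputable def nearKernelDeriv (i : Fin 3) (z : E3) : E3 →L[ℝ] ℝ :=
  quotKernelDeriv (fun z => -(4 * Real.pi)⁻¹ * ⟪basisVec i, z⟫)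
    (-(4 * Real.pi)⁻¹ • innerSL ℝ (basisVec i)) 3 z

theorem isSmoothKernel_newton : IsSmoothKernel newtonKernel newtonKernelDeriv :=
  isSmoothKernel_quot (fun z => hasFDerivAt_const _ z) 1

theorem isSmoothKernel_far (c : ℝ) (i : Fin 3) :
    IsSmoothKernel (farKernel c i) (farKernelDeriv c i) :=
  isSmoothKernel_quot (fun _ => ((innerSL ℝ (basisVec i)).hasFDerivAt).const_mul _) 2

theorem isSmoothKernel_near (i : Fin 3) : IsSmoothKernel (nearKernel i) (nearKernelDeriv i) :=
  isSmoothKernel_quot (fun _ => ((innerSL ℝ (basisVec i)).hasFDerivAt).const_mul _) 3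

theorem inner_basisVec (i : Fin 3) (z : E3) : ⟪basisVec i, z⟫ = z i := by
  rw [basisVec, EuclideanSpace.inner_single_left]
  simp

theorem inner_basisVec' (i : Fin 3) (z : E3) : ⟪z, basisVec i⟫ = z i := by
  rw [real_inner_comm, inner_basisVec]

theorem newtonKernelDeriv_apply (z e : E3) :
    newtonKernelDeriv z e = -((4 * Real.pi)⁻¹ * (‖z‖ ^ 3)⁻¹ * ⟪z, e⟫) := by
  simp [newtonKernelDeriv, quotKernelDeriv]

theorem newtonKernelDeriv_basis (i : Fin 3) (z : E3) :
    newtonKernelDeriv z (basisVec i) = nearKernel i z := by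
  rw [newtonKernelDeriv_apply, nearKernel, inner_basisVec, inner_basisVec']
  ring

theorem newtonKernel_mul (c : ℝ) (i : Fin 3) (z : E3) :
    newtonKernel z * -(c⁻¹ * ‖z‖⁻¹ * ⟪z, basisVec i⟫) = farKernel c i z := by
  rw [newtonKernel, farKernel, inner_basisVec, inner_basisVec', mul_inv, pow_one, ← inv_pow]
  ring

theorem basisVec_apply_self (i : Fin 3) : basisVec i i = 1 := by simp [basisVec]

theorem sum_sq_E3 (z : E3) : ∑ i, z i ^ 2 = ‖z‖ ^ 2 := by
  rw [EuclideanSpace.norm_sq_eq]; simp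

/-- This and the next three sums are the coefficients in the divergence of `layerGradient`: that of
`A 2` gives back the Newtonian kernel, the two belonging to `A 1` cancel, and that of `A 0` vanishes
because `1 / |z|` is harmonic. -/
theorem sum_farKernel_mul {c : ℝ} (hc : c ≠ 0) {z : E3} (hz : z ≠ 0) :
    c ^ 2 * ∑ i, farKernel c i z * -(c⁻¹ * ‖z‖⁻¹ * ⟪z, basisVec i⟫) = newtonKernel z := by
  have hz' : ‖z‖ ≠ 0 := norm_ne_zero_iff.2 hz
  have h : ∀ i, farKernel c i z * -(c⁻¹ * ‖z‖⁻¹ * ⟪z, basisVec i⟫) =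
      (4 * Real.pi * c)⁻¹ * (‖z‖ ^ 2)⁻¹ * c⁻¹ * ‖z‖⁻¹ * z i ^ 2 := fun i => by
    rw [farKernel, inner_basisVec, inner_basisVec']; ring
  simp_rw [h]
  rw [← Finset.mul_sum, sum_sq_E3, newtonKernel]
  field_simp

theorem sum_farKernelDeriv {c : ℝ} (hc : c ≠ 0) {z : E3} (hz : z ≠ 0) :
    ∑ i, farKernelDeriv c i z (basisVec i) = -(4 * Real.pi * c)⁻¹ * (‖z‖ ^ 2)⁻¹ := by
  have hz' : ‖z‖ ≠ 0 := norm_ne_zero_iff.2 hz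
  have h : ∀ i, farKernelDeriv c i z (basisVec i) = -(4 * Real.pi * c)⁻¹ * (‖z‖ ^ 2)⁻¹
      + 2 * (4 * Real.pi * c)⁻¹ * (‖z‖ ^ 4)⁻¹ * z i ^ 2 := fun i => by
    simp only [farKernelDeriv, quotKernelDeriv, _root_.sub_apply,
      _root_.smul_apply, innerSL_apply_apply, inner_basisVec, inner_basisVec',
      basisVec_apply_self, smul_eq_mul]
    push_cast; ring
  simp_rw [h]
  rw [Finset.sum_add_distrib, ← Finset.mul_sum _ _ (_ * _), sum_sq_E3, Finset.sum_const,
    Finset.card_univ, Fintype.card_fin, nsmul_eq_mul]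
  have := Real.pi_ne_zero
  field_simp
  norm_num

theorem sum_nearKernel_mul {c : ℝ} (hc : c ≠ 0) {z : E3} (hz : z ≠ 0) :
    ∑ i, nearKernel i z * -(c⁻¹ * ‖z‖⁻¹ * ⟪z, basisVec i⟫) = (4 * Real.pi * c)⁻¹ * (‖z‖ ^ 2)⁻¹ := by
  have hz' : ‖z‖ ≠ 0 := norm_ne_zero_iff.2 hz
  have h : ∀ i, nearKernel i z * -(c⁻¹ * ‖z‖⁻¹ * ⟪z, basisVec i⟫) =
      (4 * Real.pi)⁻¹ * (‖z‖ ^ 3)⁻¹ * c⁻¹ * ‖z‖⁻¹ * z i ^ 2 := fun i => by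
    rw [nearKernel, inner_basisVec, inner_basisVec']; ring
  simp_rw [h]
  rw [← Finset.mul_sum, sum_sq_E3]
  have := Real.pi_ne_zero
  field_simp

theorem sum_nearKernelDeriv {z : E3} (hz : z ≠ 0) :
    ∑ i, nearKernelDeriv i z (basisVec i) = 0 := by
  have hz' : ‖z‖ ≠ 0 := norm_ne_zero_iff.2 hz
  have h : ∀ i, nearKernelDeriv i z (basisVec i) = -(4 * Real.pi)⁻¹ * (‖z‖ ^ 3)⁻¹
      + 3 * (4 * Real.pi)⁻¹ * (‖z‖ ^ 5)⁻¹ * z i ^ 2 := fun i => by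
    simp only [nearKernelDeriv, quotKernelDeriv, _root_.sub_apply,
      _root_.smul_apply, innerSL_apply_apply, inner_basisVec, inner_basisVec',
      basisVec_apply_self, smul_eq_mul]
    push_cast; ring
  simp_rw [h]
  rw [Finset.sum_add_distrib, ← Finset.mul_sum _ _ (_ * _), sum_sq_E3, Finset.sum_const,
    Finset.card_univ, Fintype.card_fin, nsmul_eq_mul]
  have := Real.pi_ne_zero
  field_simp
  norm_num

/-! ### Layer potentials of densities smooth in time -/

/-- A density `A 0` with its time derivatives `A 1`, `A 2`, vanishing up to time `t₀` and bounded
by a square integrable function of space for times less than `N`. -/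
structure IsSmoothDensity (Γ : Set E3) (t₀ N : ℝ) (m : E3 → ℝ) (A : ℕ → E3 → ℝ → ℝ) : Prop where
  measurable : ∀ j, Measurable fun p : E3 × ℝ => A j p.1 p.2
  hasDerivAt : ∀ j y t, HasDerivAt (A j y) (A (j + 1) y t) t
  abs_le : ∀ j ≤ 2, ∀ y, ∀ t < N, |A j y t| ≤ m y
  eq_zero : ∀ j y, ∀ t ≤ t₀, A j y t = 0
  measurable_bound : Measurable m
  lintegral_sq_lt_top : ∫⁻ y in Γ, ‖m y‖ₑ ^ 2 ∂μHE[2] < ∞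

namespace IsSmoothDensity

variable {Γ : Set E3} {t₀ N : ℝ} {m : E3 → ℝ} {A : ℕ → E3 → ℝ → ℝ}

theorem bound_nonneg (h : IsSmoothDensity Γ t₀ N m A) (y : E3) : 0 ≤ m y :=
  (abs_nonneg _).trans (h.abs_le 0 (by norm_num) y (N - 1) (by linarith))

theorem integrable (h : IsSmoothDensity Γ t₀ N m A)
    [IsFiniteMeasure ((μHE[2] : Measure E3).restrict Γ)] : IntegrableOn m Γ μHE[2] := by
  have : MemLp m 2 ((μHE[2] : Measure E3).restrict Γ) := by
    refine ⟨h.measurable_bound.aestronglyMeasurable, ?_⟩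
    rw [eLpNorm_lt_top_iff_lintegral_rpow_enorm_lt_top (by norm_num) (by norm_num)]
    simpa using h.lintegral_sq_lt_top
  exact this.integrable (by norm_num)

theorem isC1Density (h : IsSmoothDensity Γ t₀ N m A)
    [IsFiniteMeasure ((μHE[2] : Measure E3).restrict Γ)] {j : ℕ} (hj : j + 1 ≤ 2) :
    IsC1Density Γ N m (A j) (A (j + 1)) where
  measurable := h.measurable j
  measurable' := h.measurable (j + 1)
  hasDerivAt := h.hasDerivAt j
  continuous y := continuous_iff_continuousAt.2 fun t => (h.hasDerivAt (j + 1) y t).continuousAt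
  abs_le := h.abs_le j (by omega)
  abs_le' := h.abs_le (j + 1) hj
  integrable := h.integrable

end IsSmoothDensity

/-- The retarded single layer potential with density `A j`. -/
noncomputable def layerPotential (c : ℝ) (Γ : Set E3) (A : ℕ → E3 → ℝ → ℝ) (j : ℕ) : E3 × ℝ → ℝ :=
  retardedPotential c Γ (A j) newtonKernel

/-- The `i`-th component of the gradient of the retarded single layer potential with
density `A 0`. -/
noncomputable def layerGradient (c : ℝ) (Γ : Set E3) (A : ℕ → E3 → ℝ → ℝ) (i : Fin 3)
    (q : E3 × ℝ) : ℝ :=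
  retardedPotential c Γ (A 1) (farKernel c i) q + retardedPotential c Γ (A 0) (nearKernel i) q

section
variable {c : ℝ} (hc : 0 < c) {D Γ : Set E3} (hΓ : HasLipschitzBoundary D Γ) {t₀ N : ℝ} {m : E3 → ℝ}
  {A : ℕ → E3 → ℝ → ℝ} (hA : IsSmoothDensity Γ t₀ N m A)
include hc hΓ hA

theorem contDiffOn_layerPotential {j : ℕ} (hj : j + 1 ≤ 2) :
    ContDiffOn ℝ 1 (layerPotential c Γ A j) (Γᶜ ×ˢ Iio N) :=
  have := hΓ.sFinite
  (contDiffOn_retardedPotential hc hΓ.isCompact (hA.isC1Density hj) isSmoothKernel_newton).1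

theorem contDiffOn_layerGradient (i : Fin 3) :
    ContDiffOn ℝ 1 (layerGradient c Γ A i) (Γᶜ ×ˢ Iio N) :=
  have := hΓ.sFinite
  (contDiffOn_retardedPotential hc hΓ.isCompact (hA.isC1Density le_rfl)
    (isSmoothKernel_far c i)).1.add
  (contDiffOn_retardedPotential hc hΓ.isCompact (hA.isC1Density (by norm_num))
    (isSmoothKernel_near i)).1

theorem fderiv_layerPotential_time {j : ℕ} (hj : j + 1 ≤ 2) {q : E3 × ℝ} (hq : q ∈ Γᶜ ×ˢ Iio N) :
    fderiv ℝ (layerPotential c Γ A j) q (0, 1) = layerPotential c Γ A (j + 1) q := by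
  have := hΓ.sFinite
  rw [layerPotential, (fderiv_retardedPotential_apply hc hΓ.isCompact (hA.isC1Density hj)
    isSmoothKernel_newton hq _).2]
  simp only [retardedKernelDeriv_apply_snd]
  rfl

theorem fderiv_layerGradient (i : Fin 3) {q : E3 × ℝ} (hq : q ∈ Γᶜ ×ˢ Iio N) (w : E3 × ℝ) :
    IntegrableOn (fun y => retardedKernelDeriv c (A 1) (A 2) (farKernel c i) (farKernelDeriv c i) q y w +
      retardedKernelDeriv c (A 0) (A 1) (nearKernel i) (nearKernelDeriv i) q y w) Γ μHE[2] ∧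
    fderiv ℝ (layerGradient c Γ A i) q w =
      ∫ y in Γ, (retardedKernelDeriv c (A 1) (A 2) (farKernel c i) (farKernelDeriv c i) q y w +
        retardedKernelDeriv c (A 0) (A 1) (nearKernel i) (nearKernelDeriv i) q y w) ∂μHE[2] := by
  have := hΓ.sFinite
  have hopen : IsOpen (Γᶜ ×ˢ Iio N) := hΓ.isCompact.isClosed.isOpen_compl.prod isOpen_Iio
  have h1 := contDiffOn_retardedPotential hc hΓ.isCompact (hA.isC1Density le_rfl)
    (isSmoothKernel_far c i)
  have h2 := contDiffOn_retardedPotential hc hΓ.isCompact (hA.isC1Density (j := 0) (by norm_num))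
    (isSmoothKernel_near i)
  have e1 := fderiv_retardedPotential_apply hc hΓ.isCompact (hA.isC1Density le_rfl)
    (isSmoothKernel_far c i) hq w
  have e2 := fderiv_retardedPotential_apply hc hΓ.isCompact (hA.isC1Density (j := 0) (by norm_num))
    (isSmoothKernel_near i) hq w
  refine ⟨e1.1.add e2.1, ?_⟩
  unfold layerGradient
  rw [fderiv_fun_add ((h1.1.contDiffAt (hopen.mem_nhds hq)).differentiableAt one_ne_zero)
    ((h2.1.contDiffAt (hopen.mem_nhds hq)).differentiableAt one_ne_zero),
    _root_.add_apply, e1.2, e2.2, integral_add e1.1 e2.1]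

/-- Both sides have the same integrand: the time derivative raises the index of `A`, while the space
derivative of the retarded Newtonian kernel is exactly the far part plus the near part. -/
theorem fderiv_layerGradient_time (i : Fin 3) {q : E3 × ℝ} (hq : q ∈ Γᶜ ×ˢ Iio N) :
    fderiv ℝ (layerGradient c Γ A i) q (0, 1) =
      fderiv ℝ (layerPotential c Γ A 1) q (basisVec i, 0) := by
  have := hΓ.sFinite
  rw [(fderiv_layerGradient hc hΓ hA i hq _).2, layerPotential,
    (fderiv_retardedPotential_apply hc hΓ.isCompact (hA.isC1Density le_rfl)
    isSmoothKernel_newton hq _).2]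
  refine integral_congr_ae (.of_forall fun y => ?_)
  dsimp only
  rw [retardedKernelDeriv_apply_snd, retardedKernelDeriv_apply_snd, retardedKernelDeriv_apply_fst,
    newtonKernel_mul, newtonKernelDeriv_basis]

theorem fderiv_layerPotential_div {q : E3 × ℝ} (hq : q ∈ Γᶜ ×ˢ Iio N) :
    fderiv ℝ (layerPotential c Γ A 1) q (0, 1) =
      c ^ 2 * ∑ i, fderiv ℝ (layerGradient c Γ A i) q (basisVec i, 0) := by
  have h1 := fun i => fderiv_layerGradient hc hΓ hA i hq (basisVec i, 0)
  rw [fderiv_layerPotential_time hc hΓ hA le_rfl hq, Finset.sum_congr rfl fun i _ => (h1 i).2,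
    ← integral_finsetSum _ fun i _ => (h1 i).1, ← integral_const_mul]
  refine setIntegral_congr_fun hΓ.isCompact.measurableSet fun y hy => ?_
  have hz : q.1 - y ≠ 0 := fun h => hq.1 (by rwa [sub_eq_zero.1 h])
  have e1 := sum_farKernel_mul hc.ne' hz
  have e2 := sum_farKernelDeriv hc.ne' hz
  have e3 := sum_nearKernel_mul hc.ne' hz
  have e4 := sum_nearKernelDeriv hz
  simp only [retardedKernelDeriv_apply_fst, Finset.sum_add_distrib, ← Finset.mul_sum]
  rw [e2, e3, e4, ← e1]
  ring

end

/-! ### Gradient bounds and boundary limits of layer fields -/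

theorem measure_singleton_eq_zero (y : E3) : (μHE[2] : Measure E3) {y} = 0 := by
  rw [Measure.euclideanHausdorffMeasure_def, Measure.smul_apply]
  have : NullSingletonClass (μH[(2 : ℕ)] : Measure E3) :=
    Measure.nullSingletonClass_hausdorff E3 (by norm_num)
  rw [measure_singleton, smul_zero]

theorem enorm_inv_eq {z : E3} (hz : z ≠ 0) : ‖z‖ₑ⁻¹ = ENNReal.ofReal ‖z‖⁻¹ := by
  rw [ENNReal.ofReal_inv_of_pos (norm_pos_iff.2 hz), ofReal_norm]

theorem abs_inner_basisVec_le (i : Fin 3) (z : E3) : |⟪basisVec i, z⟫| ≤ ‖z‖ := by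
  simpa [norm_basisVec] using abs_real_inner_le_norm (basisVec i) z

theorem abs_farKernel_le {c : ℝ} (hc : 0 < c) (i : Fin 3) {z : E3} (hz : z ≠ 0) :
    |farKernel c i z| ≤ (4 * Real.pi * c)⁻¹ * ‖z‖⁻¹ := by
  have hz' : 0 < ‖z‖ := norm_pos_iff.2 hz
  rw [farKernel, abs_mul, abs_mul, abs_neg, abs_of_pos (by positivity),
    abs_of_pos (a := (‖z‖ ^ 2)⁻¹) (by positivity), mul_assoc]
  gcongr
  calc _ ≤ ‖z‖ * (‖z‖ ^ 2)⁻¹ := by gcongr; exact abs_inner_basisVec_le i z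
    _ = _ := by field_simp

theorem abs_nearKernel_le (i : Fin 3) {z : E3} (hz : z ≠ 0) :
    |nearKernel i z| ≤ (4 * Real.pi)⁻¹ * ‖z‖⁻¹ ^ 2 := by
  have hz' : 0 < ‖z‖ := norm_pos_iff.2 hz
  rw [nearKernel, abs_mul, abs_mul, abs_neg, abs_of_pos (by positivity),
    abs_of_pos (a := (‖z‖ ^ 3)⁻¹) (by positivity), mul_assoc]
  gcongr
  calc _ ≤ ‖z‖ * (‖z‖ ^ 3)⁻¹ := by gcongr; exact abs_inner_basisVec_le i z
    _ = _ := by field_simp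

theorem apply_eq_sum_basisVec (L : E3 →L[ℝ] ℝ) (x : E3) : L x = ∑ i, x i * L (basisVec i) := by
  have hx : x = ∑ i, x i • basisVec i := by
    ext j
    simp [basisVec, Finset.sum_apply, Pi.single_apply]
  conv_lhs => rw [hx]
  simp

theorem opNorm_le_sum_basisVec (L : E3 →L[ℝ] ℝ) : ‖L‖ ≤ ∑ i, |L (basisVec i)| := by
  refine L.opNorm_le_bound (Finset.sum_nonneg fun i _ => abs_nonneg _) fun x => ?_
  rw [apply_eq_sum_basisVec L x, Real.norm_eq_abs, Finset.sum_mul]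
  refine (Finset.abs_sum_le_sum_abs _ _).trans (Finset.sum_le_sum fun i _ => ?_)
  rw [abs_mul, mul_comm]
  gcongr
  have := abs_inner_basisVec_le i x
  rwa [inner_basisVec] at this

/-- In a bounded region `|z|⁻¹ ≤ (|R| + R₁) |z|⁻²`, so the far kernel is absorbed into the near one.
The constant does not depend on the density values, hence not on time. -/
theorem enorm_integral_gradient_le {c : ℝ} (hc : 0 < c) {Γ : Set E3} (hΓ : IsCompact Γ) (R : ℝ) :
    ∃ C : ℝ≥0∞, C ≠ ∞ ∧ ∀ (m : E3 → ℝ) (i : Fin 3) (f g : E3 → ℝ) (x : E3), x ∉ Γ →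
      x ∈ closedBall (0 : E3) R → (∀ y ∈ Γ, |f y| ≤ m y) → (∀ y ∈ Γ, |g y| ≤ m y) →
      ‖∫ y in Γ, (f y * farKernel c i (x - y) + g y * nearKernel i (x - y)) ∂μHE[2]‖ₑ ≤
        C * gradPotential Γ (fun y => ‖m y‖ₑ) x := by
  obtain ⟨R₁, hR₁0, hR₁⟩ := hΓ.isBounded.subset_closedBall_lt 0 0
  set C₀ : ℝ := (4 * Real.pi * c)⁻¹ * (|R| + R₁) + (4 * Real.pi)⁻¹ with hC₀
  have hC₀0 : 0 ≤ C₀ := by positivity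
  refine ⟨ENNReal.ofReal C₀, ENNReal.ofReal_ne_top, fun m i f g x hx hxR hf hg => ?_⟩
  refine (enorm_integral_le_lintegral_enorm _).trans ?_
  rw [gradPotential, ← lintegral_const_mul' _ _ ENNReal.ofReal_ne_top]
  refine setLIntegral_mono' hΓ.measurableSet fun y hy => ?_
  have hz : x - y ≠ 0 := fun h => hx (by rwa [sub_eq_zero.1 h])
  have hz' : 0 < ‖x - y‖ := norm_pos_iff.2 hz
  have hzR : ‖x - y‖ ≤ |R| + R₁ := by
    refine (norm_sub_le _ _).trans (add_le_add ?_ ?_)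
    · exact (mem_closedBall_zero_iff.1 hxR).trans (le_abs_self R)
    · exact mem_closedBall_zero_iff.1 (hR₁ hy)
  have hm := (abs_nonneg _).trans (hf y hy)
  rw [enorm_inv_eq hz, ← ENNReal.ofReal_pow (by positivity), Real.enorm_of_nonneg hm,
    ← ENNReal.ofReal_mul hm, ← ENNReal.ofReal_mul hC₀0, ← ofReal_norm]
  refine ENNReal.ofReal_le_ofReal ?_
  have h1 : |farKernel c i (x - y)| ≤ (4 * Real.pi * c)⁻¹ * (|R| + R₁) * ‖x - y‖⁻¹ ^ 2 := by
    refine (abs_farKernel_le hc i hz).trans ?_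
    rw [mul_assoc _ (|R| + R₁)]
    refine mul_le_mul_of_nonneg_left ?_ (by positivity)
    calc ‖x - y‖⁻¹ = ‖x - y‖ * ‖x - y‖⁻¹ ^ 2 := by field_simp
      _ ≤ _ := by gcongr
  have h2 := abs_nearKernel_le i hz
  calc ‖f y * farKernel c i (x - y) + g y * nearKernel i (x - y)‖
      ≤ |f y| * |farKernel c i (x - y)| + |g y| * |nearKernel i (x - y)| := by
        rw [← abs_mul, ← abs_mul]; exact abs_add_le _ _
    _ ≤ m y * ((4 * Real.pi * c)⁻¹ * (|R| + R₁) * ‖x - y‖⁻¹ ^ 2) +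
        m y * ((4 * Real.pi)⁻¹ * ‖x - y‖⁻¹ ^ 2) :=
        add_le_add (mul_le_mul (hf y hy) h1 (abs_nonneg _) hm)
          (mul_le_mul (hg y hy) h2 (abs_nonneg _) hm)
    _ = _ := by rw [hC₀]; ring

section
variable {c : ℝ} (hc : 0 < c) {D Γ : Set E3} (hΓ : HasLipschitzBoundary D Γ) {t₀ N : ℝ} {m : E3 → ℝ}
  {A : ℕ → E3 → ℝ → ℝ} (hA : IsSmoothDensity Γ t₀ N m A)

include hc in
theorem retarded_lt {t N : ℝ} (ht : t < N) (x y : E3) : t - ‖x - y‖ / c < N :=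
  (sub_le_self t (by positivity : 0 ≤ ‖x - y‖ / c)).trans_lt ht

include hc in
theorem retarded_le {t N : ℝ} (ht : t ≤ N) (x y : E3) : t - ‖x - y‖ / c ≤ N :=
  (sub_le_self t (by positivity : 0 ≤ ‖x - y‖ / c)).trans ht

include hA in
theorem layerPotential_eq_zero {x : E3} {t : ℝ} (h : ∀ y ∈ Γ, t - ‖x - y‖ / c ≤ t₀) (j : ℕ) :
    layerPotential c Γ A j (x, t) = 0 := by
  rw [layerPotential, retardedPotential]
  refine setIntegral_eq_zero_of_forall_eq_zero fun y hy => ?_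
  rw [hA.eq_zero j y _ (h y hy), zero_mul]

include hc hΓ hA

theorem integrableOn_layer {j : ℕ} (hj : j ≤ 2) {a : E3 → ℝ} {a' : E3 → E3 →L[ℝ] ℝ}
    (ha : IsSmoothKernel a a') {q : E3 × ℝ} (hq : q ∈ Γᶜ ×ˢ Iio N) :
    IntegrableOn (fun y => A j y (q.2 - ‖q.1 - y‖ / c) * a (q.1 - y)) Γ μHE[2] := by
  have := hΓ.sFinite
  have hac : ContinuousOn (fun y => a (q.1 - y)) Γ :=
    ha.continuousOn_self.comp (by fun_prop) fun y hy h => hq.1 (by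
      rw [mem_singleton_iff, sub_eq_zero] at h; rwa [h])
  obtain ⟨C, hC⟩ := hΓ.isCompact.exists_bound_of_continuousOn hac
  refine (hA.integrable.mul_const C).mono' (((hA.measurable j).comp (by fun_prop :
    Measurable fun y : E3 => (y, q.2 - ‖q.1 - y‖ / c))).aestronglyMeasurable.mul
    (hac.aestronglyMeasurable hΓ.isCompact.measurableSet)) ?_
  filter_upwards [ae_restrict_mem hΓ.isCompact.measurableSet] with y hy
  rw [norm_mul]
  have h1 := hA.abs_le j hj y _ (retarded_lt hc hq.2 q.1 y)
  exact mul_le_mul h1 (hC y hy) (norm_nonneg _) ((abs_nonneg _).trans h1)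

theorem layerGradient_eq (i : Fin 3) {q : E3 × ℝ} (hq : q ∈ Γᶜ ×ˢ Iio N) :
    layerGradient c Γ A i q = ∫ y in Γ, (A 1 y (q.2 - ‖q.1 - y‖ / c) * farKernel c i (q.1 - y) +
      A 0 y (q.2 - ‖q.1 - y‖ / c) * nearKernel i (q.1 - y)) ∂μHE[2] := by
  have := hΓ.sFinite
  rw [layerGradient, retardedPotential, retardedPotential,
    integral_add (integrableOn_layer hc hΓ hA (by norm_num) (isSmoothKernel_far c i) hq)
      (integrableOn_layer hc hΓ hA (by norm_num) (isSmoothKernel_near i) hq)]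

theorem fderiv_layerPotential_basis (i : Fin 3) {q : E3 × ℝ} (hq : q ∈ Γᶜ ×ˢ Iio N) :
    fderiv ℝ (layerPotential c Γ A 1) q (basisVec i, 0) =
      ∫ y in Γ, (A 2 y (q.2 - ‖q.1 - y‖ / c) * farKernel c i (q.1 - y) +
      A 1 y (q.2 - ‖q.1 - y‖ / c) * nearKernel i (q.1 - y)) ∂μHE[2] := by
  have := hΓ.sFinite
  rw [layerPotential, (fderiv_retardedPotential_apply hc hΓ.isCompact (hA.isC1Density le_rfl)
    isSmoothKernel_newton hq _).2]
  refine integral_congr_ae (.of_forall fun y => ?_)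
  dsimp only
  rw [retardedKernelDeriv_apply_fst, newtonKernel_mul, newtonKernelDeriv_basis]

/-- Here `P` is the time derivative of the potential of `A 0` and `V` its gradient, so first
derivatives of the fields involve nothing beyond `A 2`. -/
theorem isAcousticField_layer : IsAcousticField c D t₀ N (layerPotential c Γ A 1)
    (layerGradient c Γ A) := by
  have hsub : D ×ˢ Iio N ⊆ Γᶜ ×ˢ Iio N :=
    prod_mono_left fun x hx hxΓ => disjoint_left.1 hΓ.disjoint hx hxΓ
  refine ⟨(contDiffOn_layerPotential hc hΓ hA le_rfl).mono hsub,
    fun i => (contDiffOn_layerGradient hc hΓ hA i).mono hsub, fun x hx t ht => ?_,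
    fun x hx t ht i => ?_, fun x hx t _ ht => ⟨?_, fun i => ?_⟩⟩
  · exact fderiv_layerPotential_div hc hΓ hA (hsub (mk_mem_prod hx ht))
  · exact fderiv_layerGradient_time hc hΓ hA i (hsub (mk_mem_prod hx ht))
  · exact layerPotential_eq_zero hA (fun y _ => retarded_le hc ht x y) 1
  · simp only [layerGradient, retardedPotential]
    simp [hA.eq_zero _ _ _ (retarded_le hc ht x _)]

/-- Dominated convergence with majorant a multiple of `m z / |y - z|`, integrable by `hfin`:
approaching `y` transversally never brings the observer much closer to a point of `Γ` than `y`
itself is. -/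
theorem tendsto_layerPotential {n : E3} {φ : E3 → ℝ} {K : ℝ≥0} {x : E3} {ρ : ℝ}
    (hch : IsGraphChart D n φ K x ρ) {y : E3} (hy : y ∈ Γ) (hyx : y ∈ ball x ρ)
    (hfin : ∫⁻ z in Γ, ‖m z‖ₑ * ‖y - z‖ₑ⁻¹ ∂μHE[2] < ∞) {t : ℝ} (ht : t < N) {j : ℕ} (hj : j ≤ 2) :
    Tendsto (fun s : ℝ => layerPotential c Γ A j (y - s • n, t)) (𝓝[>] 0)
      (𝓝 (layerPotential c Γ A j (y, t))) := by
  have hΓm := hΓ.isCompact.measurableSet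
  have hne : ∀ᵐ z ∂(μHE[2] : Measure E3).restrict Γ, z ≠ y :=
    ae_restrict_of_ae (measure_eq_zero_iff_ae_notMem.1 (measure_singleton_eq_zero y))
  set η : ℝ := (ρ - dist y x) / 2 with hη
  have hη0 : 0 < η := half_pos (sub_pos.2 hyx)
  set C : ℝ := (4 * Real.pi)⁻¹ * ((1 + K) + 2) with hC
  have hmeask : ∀ x : E3, Measurable fun z => newtonKernel (x - z) := fun x => by
    unfold newtonKernel; fun_prop
  refine tendsto_integral_filter_of_dominated_convergence (fun z => m z * (C * ‖y - z‖⁻¹)) ?_ ?_ ?_ ?_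
  · refine .of_forall fun s => (Measurable.mul ?_ (hmeask _)).aestronglyMeasurable
    exact (hA.measurable j).comp (by fun_prop :
      Measurable fun z : E3 => (z, t - ‖y - s • n - z‖ / c))
  · filter_upwards [Ioo_mem_nhdsGT hη0] with s hs
    filter_upwards [hne, ae_restrict_mem hΓm] with z hzy hz
    have hyz : 0 < ‖y - z‖ := norm_pos_iff.2 (sub_ne_zero.2 hzy.symm)
    rw [norm_mul]
    have hm := hA.abs_le j hj z _ (retarded_lt hc ht (y - s • n) z)
    -- Inside the chart ball this is the graph estimate with constant `1 + K`. Outside it, `|y - z|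
    -- ≥ 2η` and `s < η` give the constant `2`.
    have key : ‖y - z‖ ≤ ((1 + K) + 2) * ‖y - s • n - z‖ := by
      have hK : (0 : ℝ) ≤ K := K.2
      have h0 := norm_nonneg (y - s • n - z)
      by_cases hzx : z ∈ ball x ρ
      · have := hch.norm_sub_le_of_mem_frontier hΓ.isOpen hyx hzx
          (hΓ.frontier_eq.symm ▸ hy) (hΓ.frontier_eq.symm ▸ hz) (-s)
        rw [neg_smul, ← sub_eq_add_neg] at this
        nlinarith
      · have h1 : ρ ≤ dist z x := not_lt.1 hzx
        have h2 : ρ - dist y x ≤ ‖y - z‖ := by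
          have := dist_triangle z y x
          rw [dist_comm z y, dist_eq_norm y z] at this
          linarith
        have h3 : ‖y - z‖ ≤ ‖y - s • n - z‖ + s := by
          have := norm_add_le (y - s • n - z) (s • n)
          rwa [norm_smul, hch.norm_eq_one, mul_one, Real.norm_eq_abs, abs_of_pos hs.1,
            show y - s • n - z + s • n = y - z by abel] at this
        have h4 := hs.2
        nlinarith
    have hpos : 0 < ‖y - s • n - z‖ := by
      by_contra! hle
      have : ‖y - s • n - z‖ = 0 := le_antisymm hle (norm_nonneg _)
      rw [this, mul_zero] at key
      linarith
    have hker : ‖newtonKernel (y - s • n - z)‖ ≤ C * ‖y - z‖⁻¹ := by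
      rw [newtonKernel, pow_one, Real.norm_of_nonneg (by positivity), hC, mul_assoc]
      gcongr
      rw [← div_eq_mul_inv, inv_le_iff_one_le_mul₀ hpos, div_mul_eq_mul_div, one_le_div hyz]
      exact key
    exact mul_le_mul hm hker (norm_nonneg _) (hA.bound_nonneg z)
  · have hm := hA.measurable_bound
    refine ⟨by fun_prop, ?_⟩
    rw [hasFiniteIntegral_iff_enorm]
    have hC0 : 0 ≤ C := by positivity
    refine lt_of_le_of_lt (lintegral_mono_ae (g := fun z => ENNReal.ofReal C * (‖m z‖ₑ * ‖y - z‖ₑ⁻¹)) ?_) ?_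
    · filter_upwards [hne] with z hz
      rw [enorm_inv_eq (sub_ne_zero.2 hz.symm), enorm_mul, enorm_mul,
        Real.enorm_of_nonneg hC0, Real.enorm_of_nonneg (by positivity : 0 ≤ ‖y - z‖⁻¹)]
      exact le_of_eq (by ring)
    · rw [lintegral_const_mul' _ _ ENNReal.ofReal_ne_top]
      exact ENNReal.mul_lt_top ENNReal.ofReal_lt_top hfin
  · filter_upwards [hne] with z hz
    have hyz : y - z ≠ 0 := sub_ne_zero.2 hz.symm
    have hpath : Tendsto (fun s : ℝ => y - s • n - z) (𝓝[>] 0) (𝓝 (y - z)) := by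
      have hcont : Continuous fun s : ℝ => y - s • n - z := by fun_prop
      simpa using (hcont.tendsto 0).mono_left nhdsWithin_le_nhds
    refine Tendsto.mul ?_ ?_
    · have h1 : Tendsto (fun s : ℝ => t - ‖y - s • n - z‖ / c) (𝓝[>] 0) (𝓝 (t - ‖y - z‖ / c)) :=
        tendsto_const_nhds.sub (hpath.norm.div_const c)
      exact ((hA.hasDerivAt j z _).continuousAt.tendsto).comp h1
    · exact ((isSmoothKernel_newton.hasFDerivAt _ hyz).continuousAt.tendsto).comp hpath

end

/-! ### Uniqueness for the Dirichlet problem -/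

theorem IsAcousticField.sub {c : ℝ} {D : Set E3} (hD : IsOpen D) {t₀ N : ℝ} {P P' : E3 × ℝ → ℝ}
    {V V' : Fin 3 → E3 × ℝ → ℝ} (h : IsAcousticField c D t₀ N P V)
    (h' : IsAcousticField c D t₀ N P' V') :
    IsAcousticField c D t₀ N (P - P') (fun i => V i - V' i) := by
  have hd : ∀ {f : E3 × ℝ → ℝ}, ContDiffOn ℝ 1 f (D ×ˢ Iio N) → ∀ x ∈ D, ∀ t < N,
      DifferentiableAt ℝ f (x, t) := fun hf x hx t ht =>
    (hf.contDiffAt ((hD.prod isOpen_Iio).mem_nhds (mk_mem_prod hx ht))).differentiableAt one_ne_zero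
  refine ⟨h.contDiffOn_fst.sub h'.contDiffOn_fst,
    fun i => (h.contDiffOn_snd i).sub (h'.contDiffOn_snd i), fun x hx t ht => ?_,
    fun x hx t ht i => ?_, fun x hx t ht ht0 => ?_⟩
  · rw [fderiv_sub (hd h.contDiffOn_fst x hx t ht) (hd h'.contDiffOn_fst x hx t ht),
      _root_.sub_apply, h.div_eq x hx t ht, h'.div_eq x hx t ht, ← mul_sub,
      ← Finset.sum_sub_distrib]
    refine congrArg (c ^ 2 * ·) (Finset.sum_congr rfl fun i _ => ?_)
    rw [fderiv_sub (hd (h.contDiffOn_snd i) x hx t ht) (hd (h'.contDiffOn_snd i) x hx t ht),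
      _root_.sub_apply]
  · rw [fderiv_sub (hd (h.contDiffOn_snd i) x hx t ht) (hd (h'.contDiffOn_snd i) x hx t ht),
      fderiv_sub (hd h.contDiffOn_fst x hx t ht) (hd h'.contDiffOn_fst x hx t ht),
      _root_.sub_apply, _root_.sub_apply, h.grad_eq x hx t ht i, h'.grad_eq x hx t ht i]
  · have e := h.initial x hx t ht ht0
    have e' := h'.initial x hx t ht ht0
    exact ⟨by simp [e.1, e'.1], fun i => by simp [e.2 i, e'.2 i]⟩

theorem HasLipschitzBoundary.nonempty_compl {D Γ : Set E3} (h : HasLipschitzBoundary D Γ)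
    (hΓ : Γ.Nonempty) : (Dᶜ).Nonempty :=
  hΓ.mono fun _ hx hxD => disjoint_left.1 h.disjoint hxD hx

theorem fderiv_slice {f : E3 × ℝ → ℝ} {x : E3} {t : ℝ} (hf : DifferentiableAt ℝ f (x, t)) (v : E3) :
    HasFDerivAt (fun y => f (y, t)) ((fderiv ℝ f (x, t)).comp (ContinuousLinearMap.inl ℝ E3 ℝ)) x ∧
    fderiv ℝ (fun y => f (y, t)) x v = fderiv ℝ f (x, t) (v, 0) := by
  have h1 : HasFDerivAt (fun y : E3 => (y, t)) (ContinuousLinearMap.inl ℝ E3 ℝ) x :=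
    hasFDerivAt_prodMk_left x t
  have h2 := hf.hasFDerivAt.comp x h1
  refine ⟨h2, ?_⟩
  have := h2.fderiv
  simp only [Function.comp_def] at this
  rw [this]
  rfl

/-- Auxiliary acoustic fields that are regular up to the boundary. -/
structure IsRegularBackground (D Γ : Set E3) (N : ℝ) (P : E3 × ℝ → ℝ) (V : Fin 3 → E3 × ℝ → ℝ) :
    Prop where
  bounded : ∀ R, ∃ C : ℝ, ∀ x ∈ D ∩ closedBall 0 R, ∀ t < N,
    (∀ i, |V i (x, t)| ≤ C) ∧ ‖fderiv ℝ (fun y => P (y, t)) x‖ ≤ C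
  continuousAt : ∀ y ∈ Γ, ∀ t < N, ContinuousAt (fun x => P (x, t)) y
  eq_zero : ∃ R, ∀ x ∈ D, R < ‖x‖ → ∀ t < N, P (x, t) = 0

/-- A layer field whose trace on the boundary coincides with that of a background field coincides
with it throughout the domain. -/
theorem layer_eq_background {c : ℝ} (hc : 0 < c) {D Γ : Set E3} (hΓ : HasLipschitzBoundary D Γ)
    (hne : Γ.Nonempty) {t₀ N : ℝ} {m : E3 → ℝ} {A : ℕ → E3 → ℝ → ℝ}
    (hA : IsSmoothDensity Γ t₀ N m A) {PB : E3 × ℝ → ℝ} {VB : Fin 3 → E3 × ℝ → ℝ}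
    (hB : IsAcousticField c D t₀ N PB VB) (hreg : IsRegularBackground D Γ N PB VB)
    (htr : ∀ᵐ y ∂(μHE[2] : Measure E3).restrict Γ, ∀ t < N,
      layerPotential c Γ A 1 (y, t) = PB (y, t)) {x : E3} (hx : x ∈ D) {t : ℝ} (ht : t < N) :
    layerPotential c Γ A 1 (x, t) = PB (x, t) ∧ ∀ i, layerGradient c Γ A i (x, t) = VB i (x, t) := by
  have hfin := hΓ.sFinite
  have hL := isAcousticField_layer hc hΓ hA
  have hF := hL.sub hΓ.isOpen hB
  obtain ⟨R₀, hR₀⟩ := hreg.eq_zero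
  obtain ⟨R₁, hR₁0, hR₁⟩ := hΓ.isCompact.isBounded.cthickening (δ := 1) |>.subset_closedBall_lt 0 0
  have hR₁Γ : ∀ y ∈ Γ, ‖y‖ ≤ R₁ := fun y hy =>
    mem_closedBall_zero_iff.1 (hR₁ (self_subset_cthickening Γ hy))
  -- Finite speed of propagation: before time `N` the layer field has not left the ball of radius
  -- `R₁ + c |N - t₀|`.
  set R := max R₀ (R₁ + c * |N - t₀|) with hRdef
  have hRR₁ : R₁ ≤ R := (le_add_of_nonneg_right (by positivity)).trans (le_max_right _ _)
  have hR : cthickening 1 Γ ⊆ closedBall 0 R := hR₁.trans (closedBall_subset_closedBall hRR₁)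
  obtain ⟨C₁, hC₁, hgrad⟩ := enorm_integral_gradient_le hc hΓ.isCompact R
  obtain ⟨C₂, hC₂⟩ := hreg.bounded R
  have hsub : ∀ x ∈ D, ∀ t < N, (x, t) ∈ Γᶜ ×ˢ Iio N := fun x hx t ht =>
    ⟨fun hxΓ => disjoint_left.1 hΓ.disjoint hx hxΓ, ht⟩
  have hmm : Measurable fun y => ‖m y‖ₑ := hA.measurable_bound.enorm
  set G := gradPotential Γ (fun y => ‖m y‖ₑ) with hG
  have hGm : Measurable G := hΓ.measurable_gradPotential hmm
  -- One majorant for `∇P` and for `V`: three partial derivatives, each at most `C₁ * G`, plus the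
  -- bound on the background field.
  set g : E3 → ℝ≥0∞ := fun x => 3 * C₁ * G x + ENNReal.ofReal |C₂| with hg
  have hgm : Measurable g := (hGm.const_mul _).add_const _
  have hg2 : ∫⁻ x in closedBall (0 : E3) R, g x ^ 2 < ∞ := by
    have hsq : ∀ a b : ℝ≥0∞, (a + b) ^ 2 ≤ 2 * (a ^ 2 + b ^ 2) := fun a b => by
      have := ENNReal.rpow_add_le_mul_rpow_add_rpow a b (p := 2) (by norm_num)
      norm_num at this
      exact this
    refine (lintegral_mono fun x => hsq _ _).trans_lt ?_
    rw [lintegral_const_mul' _ _ (by norm_num), lintegral_add_right _ measurable_const]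
    refine ENNReal.mul_lt_top (by norm_num) (ENNReal.add_lt_top.2 ⟨?_, ?_⟩)
    · simp_rw [mul_pow (3 * C₁)]
      rw [lintegral_const_mul' _ _ (by finiteness)]
      exact ENNReal.mul_lt_top (by finiteness)
        (hΓ.lintegral_gradPotential_sq_lt_top hmm hA.lintegral_sq_lt_top R)
    · rw [lintegral_const, Measure.restrict_apply_univ]
      exact ENNReal.mul_lt_top (by finiteness) measure_closedBall_lt_top
  have hdiff : ∀ {f : E3 × ℝ → ℝ}, ContDiffOn ℝ 1 f (D ×ˢ Iio N) → ∀ x ∈ D, ∀ t < N,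
      DifferentiableAt ℝ f (x, t) := fun hf x hx t ht =>
    (hf.contDiffAt ((hΓ.isOpen.prod isOpen_Iio).mem_nhds
      (mk_mem_prod hx ht))).differentiableAt one_ne_zero
  obtain ⟨F, hF0, hFb⟩ := hΓ.exists_strip_bound hne hR hgm hg2
  have hC₂' : ∀ s : ℝ, |s| ≤ C₂ → ‖s‖ₑ ≤ ENNReal.ofReal |C₂| := fun s hs => by
    rw [← ofReal_norm]
    exact ENNReal.ofReal_le_ofReal (hs.trans (le_abs_self _))
  have hm1 : ∫⁻ y in Γ, ‖m y‖ₑ ∂μHE[2] < ∞ := hA.integrable.2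
  have key := hF.eq_zero_of_flux_small hΓ.isOpen hc (hΓ.nonempty_compl hne) (R := R) ?_ hF0 ?_ hx ht
  · exact ⟨sub_eq_zero.1 key.1, fun i => sub_eq_zero.1 (key.2 i)⟩
  · intro x hx hxR t ht
    rw [Pi.sub_apply, hR₀ x hx ((le_max_left _ _).trans_lt hxR) t ht, sub_zero]
    refine layerPotential_eq_zero hA (fun y hy => ?_) 1
    have h1 : ‖x‖ ≤ ‖x - y‖ + ‖y‖ := by simpa using norm_add_le (x - y) y
    have h2 := hR₁Γ y hy
    have h3 : R₁ + c * |N - t₀| < ‖x‖ := (le_max_right _ _).trans_lt hxR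
    have h4 : N - t₀ ≤ ‖x - y‖ / c := by
      rw [le_div_iff₀ hc]
      nlinarith [le_abs_self (N - t₀)]
    linarith
  · filter_upwards [hFb] with δ hδ t ht i
    refine hδ (fun x => (layerPotential c Γ A 1 - PB) (x, t)) (fun x => (layerGradient c Γ A i - VB i) (x, t)) ?_ ?_ ?_ ?_
    · exact hF.contDiffOn_fst.comp (by fun_prop : ContDiffOn ℝ 1 (fun y : E3 => (y, t)) D)
        fun x hx => ⟨hx, ht⟩
    · intro x hx
      have d1 := hdiff hL.contDiffOn_fst x hx.1 t ht
      have d2 := hdiff hB.contDiffOn_fst x hx.1 t ht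
      have s1 := fun v => fderiv_slice d1 v
      have s2 := fun v => fderiv_slice d2 v
      have e : fderiv ℝ (fun x => (layerPotential c Γ A 1 - PB) (x, t)) x =
          fderiv ℝ (fun x => layerPotential c Γ A 1 (x, t)) x - fderiv ℝ (fun x => PB (x, t)) x :=
        fderiv_fun_sub (s1 0).1.differentiableAt (s2 0).1.differentiableAt
      rw [e, hg]
      refine (enorm_sub_le).trans (add_le_add ?_ ?_)
      · set L := fderiv ℝ (fun x => layerPotential c Γ A 1 (x, t)) x with hLdef
        have h1 : ‖L‖ₑ ≤ ∑ i, ‖L (basisVec i)‖ₑ := by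
          simp_rw [← ofReal_norm]
          rw [← ENNReal.ofReal_sum_of_nonneg fun i _ => norm_nonneg _]
          exact ENNReal.ofReal_le_ofReal (opNorm_le_sum_basisVec L)
        refine h1.trans ?_
        have h2 : ∀ i ∈ Finset.univ, ‖L (basisVec i)‖ₑ ≤ C₁ * G x := fun i _ => by
          rw [hLdef, (s1 (basisVec i)).2, fderiv_layerPotential_basis hc hΓ hA i (hsub x hx.1 t ht)]
          exact hgrad m i _ _ x (hsub x hx.1 t ht).1 hx.2
            (fun y _ => hA.abs_le 2 le_rfl y _ (retarded_lt hc ht x y))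
            (fun y _ => hA.abs_le 1 (by norm_num) y _ (retarded_lt hc ht x y))
        refine (Finset.sum_le_sum h2).trans (le_of_eq ?_)
        simp [mul_assoc]
      · rw [← ofReal_norm]
        exact ENNReal.ofReal_le_ofReal ((hC₂ x hx t ht).2.trans (le_abs_self _))
    · intro x hx
      rw [hg, Pi.sub_apply]
      refine (enorm_sub_le).trans (add_le_add ?_ (hC₂' _ ((hC₂ x hx t ht).1 i)))
      rw [layerGradient_eq hc hΓ hA i (hsub x hx.1 t ht)]
      refine (hgrad m i _ _ x (hsub x hx.1 t ht).1 hx.2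
            (fun y _ => hA.abs_le 1 (by norm_num) y _ (retarded_lt hc ht x y))
            (fun y _ => hA.abs_le 0 (by norm_num) y _ (retarded_lt hc ht x y))).trans ?_
      rw [mul_assoc]
      exact le_mul_of_one_le_left zero_le (by norm_num)
    · filter_upwards [htr, hΓ.ae_lintegral_mul_inv_enorm_lt_top hmm hm1,
        ae_restrict_mem hΓ.isCompact.measurableSet] with y hy hyfin hyΓ
      intro n φ K x ρ hch hyx
      have h1 := tendsto_layerPotential hc hΓ hA hch hyΓ hyx hyfin ht (j := 1) (by norm_num)
      have h2 : Tendsto (fun s : ℝ => PB (y - s • n, t)) (𝓝[>] 0) (𝓝 (PB (y, t))) := by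
        have hcont : Continuous fun s : ℝ => y - s • n := by fun_prop
        have h3 : Tendsto (fun s : ℝ => y - s • n) (𝓝[>] 0) (𝓝 y) := by
          simpa using (hcont.tendsto 0).mono_left nhdsWithin_le_nhds
        exact (hreg.continuousAt y hyΓ t ht).tendsto.comp h3
      have h4 := h1.sub h2
      rwa [hy t ht, sub_self] at h4

/-! ### Null sets on light cones and regular representatives of densities -/

theorem measurable_retarded (c : ℝ) :
    Measurable fun q : (E3 × ℝ) × E3 => (q.2, q.1.2 - ‖q.1.1 - q.2‖ / c) := by
  fun_prop

/-- A property that holds for almost all `(y, t)` holds along almost all backward light cones. -/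
theorem ae_retarded {ν : Measure E3} [SFinite ν] (c : ℝ) {p : E3 × ℝ → Prop}
    (h : ∀ᵐ q ∂ν.prod volume, p q) :
    (∀ r, ∀ᵐ t : ℝ, ∀ᵐ y ∂ν, p (y, t - ‖r - y‖ / c)) ∧
      ∀ᵐ q ∂ν.prod (volume : Measure ℝ), ∀ᵐ y ∂ν, p (y, q.2 - ‖q.1 - y‖ / c) := by
  -- A measurable null superset of the exceptional set, so that the order of the almost-everywhere
  -- quantifiers can be exchanged.
  set E := toMeasurable (ν.prod volume) {q | ¬ p q} with hE
  have hEm : MeasurableSet E := measurableSet_toMeasurable _ _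
  have hE0 : ∀ᵐ q ∂ν.prod volume, q ∉ E := by
    rw [ae_iff]
    simp only [not_not, ofPred_mem_eq]
    rw [measure_toMeasurable]
    exact h
  have hEp : ∀ q, q ∉ E → p q := fun q hq => by
    by_contra hp
    exact hq (subset_toMeasurable _ _ hp)
  have h1 : ∀ r, ∀ᵐ t : ℝ, ∀ᵐ y ∂ν, (y, t - ‖r - y‖ / c) ∉ E := by
    intro r
    -- For fixed `y` the retardation is a translation in time, which preserves null sets.
    rw [Measure.ae_ae_comm]
    · filter_upwards [Measure.ae_ae_of_ae_prod hE0] with y hy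
      exact (measurePreserving_sub_right volume (‖r - y‖ / c)).quasiMeasurePreserving.ae hy
    · exact hEm.compl.preimage (by fun_prop : Measurable fun q : ℝ × E3 => (q.2, q.1 - ‖r - q.2‖ / c))
  have hm : MeasurableSet {q : E3 × ℝ | ∀ᵐ y ∂ν, (y, q.2 - ‖q.1 - y‖ / c) ∉ E} := by
    have h2 := measurable_measure_prodMk_left (ν := ν) (hEm.preimage (measurable_retarded c))
    have h3 := h2 (measurableSet_singleton (0 : ℝ≥0∞))
    convert h3 using 1
    ext q
    simp [ae_iff, preimage]
  refine ⟨fun r => (h1 r).mono fun t ht => ht.mono fun y => hEp _, ?_⟩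
  have h4 : ∀ᵐ q ∂ν.prod (volume : Measure ℝ), ∀ᵐ y ∂ν, (y, q.2 - ‖q.1 - y‖ / c) ∉ E :=
    (Measure.ae_prod_iff_ae_ae hm).2 (.of_forall fun r => h1 r)
  exact h4.mono fun q hq => hq.mono fun y => hEp _

/-- A jointly measurable causal density, square integrable up to each time. -/
structure IsRegularDensity (ν : Measure E3) (α : ℝ) (ψ : E3 → ℝ → ℝ) : Prop where
  measurable : Measurable fun p : E3 × ℝ => ψ p.1 p.2
  eq_zero : ∀ y, ∀ t < α, ψ y t = 0
  sq_lt_top : ∀ N : ℝ, ∫⁻ y, (∫⁻ s in Iic N, ‖ψ y s‖ₑ ^ 2) ∂ν < ∞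
  integrableOn : ∀ y N, IntegrableOn (ψ y) (Iic N)

theorem setLIntegral_Iic_eq {α N : ℝ} {f : ℝ → ℝ≥0∞} (hf : ∀ t < α, f t = 0) :
    ∫⁻ s in Iic N, f s = ∫⁻ s in Icc α N, f s := by
  rw [← lintegral_indicator measurableSet_Iic, ← lintegral_indicator measurableSet_Icc]
  refine lintegral_congr fun s => ?_
  by_cases hs : s < α
  · rw [indicator_apply, indicator_apply, hf s hs]; simp
  · simp [indicator_apply, not_lt.1 hs]

/-- Three corrections on null sets: a jointly measurable representative, exact vanishing before `α`,
and removal of those `y` whose time slice is not square integrable up to some integer time.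
Afterwards every single slice can be mollified. -/
theorem exists_isRegularDensity {ν : Measure E3} [SFinite ν] {α : ℝ} {ψ : E3 → ℝ → ℝ}
    (h2 : ∀ t₀ t₁ : ℝ, MemLp (fun p : E3 × ℝ => ψ p.1 p.2) 2 (ν.prod (volume.restrict (Icc t₀ t₁))))
    (h0 : ∀ᵐ p ∂ν.prod (volume : Measure ℝ), p.2 < α → ψ p.1 p.2 = 0) :
    ∃ ψ', IsRegularDensity ν α ψ' ∧
      ∀ᵐ p ∂ν.prod (volume : Measure ℝ), ψ p.1 p.2 = ψ' p.1 p.2 := by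
  have hres : ∀ t₀ t₁ : ℝ, ν.prod (volume.restrict (Icc t₀ t₁)) =
      (ν.prod volume).restrict (univ ×ˢ Icc t₀ t₁) := fun t₀ t₁ => by
    rw [← Measure.prod_restrict, Measure.restrict_univ]
  have hmeas : AEStronglyMeasurable (fun p : E3 × ℝ => ψ p.1 p.2) (ν.prod volume) := by
    have hU : (⋃ k : ℕ, (univ : Set E3) ×ˢ Icc (-k : ℝ) k) = univ := by
      refine eq_univ_of_forall fun p => mem_iUnion.2 ?_
      obtain ⟨k, hk⟩ := exists_nat_ge |p.2|
      exact ⟨k, mem_univ _, abs_le.1 hk⟩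
    rw [← Measure.restrict_univ (μ := ν.prod volume), ← hU, aestronglyMeasurable_iUnion_iff]
    intro k
    rw [← hres]
    exact (h2 _ _).aestronglyMeasurable
  set g : E3 × ℝ → ℝ := {p | α ≤ p.2}.indicator (hmeas.mk _) with hg
  have hgm : Measurable g := hmeas.stronglyMeasurable_mk.measurable.indicator
    (measurableSet_le measurable_const measurable_snd)
  have hg0 : ∀ y, ∀ t < α, g (y, t) = 0 := fun y t ht => by
    rw [hg, indicator_of_notMem]
    exact not_le.2 ht
  have hψg : ∀ᵐ p ∂ν.prod (volume : Measure ℝ), ψ p.1 p.2 = g p := by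
    filter_upwards [hmeas.ae_eq_mk, h0] with p hp hp0
    by_cases h : α ≤ p.2
    · rw [hg, indicator_of_mem (by exact h), ← hp]
    · rw [hg, indicator_of_notMem (by exact h), hp0 (not_le.1 h)]
  have hgsq : ∀ N : ℝ, ∫⁻ y, (∫⁻ s in Iic N, ‖g (y, s)‖ₑ ^ 2) ∂ν < ∞ := by
    intro N
    have e1 : ∀ y, ∫⁻ s in Iic N, ‖g (y, s)‖ₑ ^ 2 = ∫⁻ s in Icc α N, ‖g (y, s)‖ₑ ^ 2 := fun y =>
      setLIntegral_Iic_eq fun t ht => by rw [hg0 y t ht]; simp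
    simp_rw [e1]
    rw [lintegral_lintegral (f := fun y s => ‖g (y, s)‖ₑ ^ 2) (by fun_prop)]
    have h3 := (h2 α N).2
    rw [eLpNorm_lt_top_iff_lintegral_rpow_enorm_lt_top (by norm_num) (by norm_num)] at h3
    refine lt_of_eq_of_lt (lintegral_congr_ae ?_) h3
    rw [hres]
    filter_upwards [ae_restrict_of_ae hψg] with p hp
    simp [hp]
  have hinner : ∀ N : ℝ, Measurable fun y => ∫⁻ s in Iic N, ‖g (y, s)‖ₑ ^ 2 := fun N =>
    Measurable.lintegral_prod_right' (f := fun p : E3 × ℝ => ‖g p‖ₑ ^ 2) (by fun_prop)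
  set Z : Set E3 := ⋃ k : ℕ, {y | ∫⁻ s in Iic (k : ℝ), ‖g (y, s)‖ₑ ^ 2 = ∞} with hZ
  have hZm : MeasurableSet Z := .iUnion fun k => hinner k (measurableSet_singleton ∞)
  have hZ0 : ∀ᵐ y ∂ν, y ∉ Z := by
    rw [hZ]
    simp only [mem_iUnion, mem_ofPred_eq, not_exists, ae_all_iff]
    intro k
    exact (ae_lt_top (hinner k) (hgsq k).ne).mono fun y hy => hy.ne
  set f : E3 × ℝ → ℝ := (Zᶜ ×ˢ univ).indicator g with hf
  have hfm : Measurable f := hgm.indicator (hZm.compl.prod .univ)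
  have hfg : ∀ y s, ‖f (y, s)‖ₑ ≤ ‖g (y, s)‖ₑ := fun y s => by
    rw [hf]; exact enorm_indicator_le_enorm_self _ _
  have hf0 : ∀ y, ∀ t < α, f (y, t) = 0 := fun y t ht => by
    have := hfg y t
    rw [hg0 y t ht] at this
    simpa using this
  refine ⟨fun y s => f (y, s), ⟨hfm, hf0, fun N => ?_, fun y N => ?_⟩, ?_⟩
  · refine lt_of_le_of_lt (lintegral_mono fun y => lintegral_mono fun s => ?_) (hgsq N)
    exact pow_le_pow_left' (hfg y s) 2
  · have hfy : Measurable fun s => f (y, s) := hfm.comp (by fun_prop)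
    by_cases hy : y ∈ Z
    · have : (fun s => f (y, s)) = 0 := by
        funext s
        simp [hf, hy]
      rw [this]
      exact integrableOn_zero
    · obtain ⟨k, hk⟩ := exists_nat_ge N
      have h4 : ∫⁻ s in Iic (k : ℝ), ‖g (y, s)‖ₑ ^ 2 < ∞ := by
        simp only [hZ, mem_iUnion, mem_ofPred_eq, not_exists] at hy
        exact lt_top_iff_ne_top.2 (hy k)
      have h5 : MemLp (fun s => f (y, s)) 2 (volume.restrict (Icc α N)) := by
        refine ⟨hfy.aestronglyMeasurable, ?_⟩
        rw [eLpNorm_lt_top_iff_lintegral_rpow_enorm_lt_top (by norm_num) (by norm_num)]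
        refine lt_of_le_of_lt ?_ h4
        refine (lintegral_mono fun s => ?_).trans
          (lintegral_mono_set (Icc_subset_Iic_self.trans (Iic_subset_Iic.2 hk)))
        simpa using pow_le_pow_left' (hfg y s) 2
      have h6 : IntegrableOn (fun s => f (y, s)) (Icc α N) := h5.integrable (by norm_num)
      refine ⟨hfy.aestronglyMeasurable, ?_⟩
      rw [hasFiniteIntegral_iff_enorm, setLIntegral_Iic_eq (α := α) fun t ht => by
        rw [hf0 y t ht]; simp]
      exact h6.2
  · have h7 : ∀ᵐ p ∂ν.prod (volume : Measure ℝ), p.1 ∉ Z :=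
      Measure.quasiMeasurePreserving_fst.ae hZ0
    filter_upwards [hψg, h7] with p hp hpZ
    rw [hp, hf, indicator_of_mem]
    exact ⟨hpZ, mem_univ _⟩

/-- The integral of `|ψ(y, ·)|` up to time `N`. -/
noncomputable def massUpTo (ψ : E3 → ℝ → ℝ) (N : ℝ) (y : E3) : ℝ≥0∞ := ∫⁻ s in Iic N, ‖ψ y s‖ₑ

theorem massUpTo_mono (ψ : E3 → ℝ → ℝ) {N N' : ℝ} (h : N ≤ N') (y : E3) :
    massUpTo ψ N y ≤ massUpTo ψ N' y :=
  lintegral_mono_set (Iic_subset_Iic.2 h)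

namespace IsRegularDensity
variable {ν : Measure E3} {α : ℝ} {ψ : E3 → ℝ → ℝ}

theorem massUpTo_lt_top (h : IsRegularDensity ν α ψ) (N : ℝ) (y : E3) : massUpTo ψ N y < ∞ :=
  (h.integrableOn y N).2

theorem measurable_massUpTo (h : IsRegularDensity ν α ψ) (N : ℝ) : Measurable (massUpTo ψ N) :=
  Measurable.lintegral_prod_right' (f := fun p : E3 × ℝ => ‖ψ p.1 p.2‖ₑ) h.measurable.enorm

theorem measurable_slice (h : IsRegularDensity ν α ψ) (y : E3) : Measurable (ψ y) :=
  h.measurable.comp (by fun_prop : Measurable fun s : ℝ => (y, s))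

theorem locallyIntegrable (h : IsRegularDensity ν α ψ) (y : E3) : LocallyIntegrable (ψ y) :=
  fun t => ⟨Iic (t + 1), Iic_mem_nhds (by linarith), h.integrableOn y _⟩

/-- Cauchy–Schwarz in time on `[α, N]`; causality makes the interval finite. -/
theorem lintegral_massUpTo_sq_lt_top (h : IsRegularDensity ν α ψ) (N : ℝ) :
    ∫⁻ y, massUpTo ψ N y ^ 2 ∂ν < ∞ := by
  have hle : ∀ y, massUpTo ψ N y ^ 2 ≤
      ENNReal.ofReal (N - α) * ∫⁻ s in Iic N, ‖ψ y s‖ₑ ^ 2 := by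
    intro y
    have hH := ENNReal.lintegral_mul_le_Lp_mul_Lq (volume.restrict (Icc α N))
      (p := 2) (q := 2) (by constructor <;> norm_num)
      (f := fun s => ‖ψ y s‖ₑ) (g := fun _ => 1)
      (h.measurable_slice y).enorm.aemeasurable aemeasurable_const
    rw [massUpTo, setLIntegral_Iic_eq fun t ht => by rw [h.eq_zero y t ht]; simp,
      setLIntegral_Iic_eq (f := fun s => ‖ψ y s‖ₑ ^ 2) fun t ht => by rw [h.eq_zero y t ht]; simp]
    simp only [Pi.mul_def, mul_one, lintegral_const,
      Measure.restrict_apply_univ, Real.volume_Icc, ENNReal.rpow_ofNat] at hH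
    refine (pow_le_pow_left' hH 2).trans (le_of_eq ?_)
    rw [mul_pow, ← ENNReal.rpow_natCast, ← ENNReal.rpow_natCast, ← ENNReal.rpow_mul,
      ← ENNReal.rpow_mul, mul_comm]
    norm_num
  refine (lintegral_mono hle).trans_lt ?_
  rw [lintegral_const_mul' _ _ ENNReal.ofReal_ne_top]
  exact ENNReal.mul_lt_top ENNReal.ofReal_lt_top (h.sq_lt_top N)

theorem lintegral_massUpTo_lt_top [IsFiniteMeasure ν] (h : IsRegularDensity ν α ψ) (N : ℝ) :
    ∫⁻ y, massUpTo ψ N y ∂ν < ∞ := by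
  have h1 : ∀ a : ℝ≥0∞, a ≤ 1 + a ^ 2 := fun a => by
    rcases le_total a 1 with ha | ha
    · exact ha.trans (le_add_right le_rfl)
    · exact (le_self_pow₀ ha two_ne_zero).trans (le_add_left le_rfl)
  refine (lintegral_mono fun y => h1 _).trans_lt ?_
  rw [lintegral_add_left measurable_const, lintegral_const, one_mul]
  exact ENNReal.add_lt_top.2 ⟨measure_lt_top _ _, h.lintegral_massUpTo_sq_lt_top N⟩

end IsRegularDensity

/-! ### Good points, mollification in time, and its commutation with the potential -/

/-- The points at which the layer potential of `ψ` is finite at almost all times. -/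
def IsGoodPoint (ν : Measure E3) (ψ : E3 → ℝ → ℝ) (r : E3) : Prop :=
  ∀ N : ℝ, ∫⁻ y, massUpTo ψ N y * ‖r - y‖ₑ⁻¹ ∂ν < ∞

/-- A smooth function supported in `[-L, L]`. -/
structure IsMollifier (L : ℝ) (η : ℝ → ℝ) : Prop where
  contDiff : ContDiff ℝ (⊤ : ℕ∞) η
  eq_zero : ∀ s, L < |s| → η s = 0

namespace IsMollifier
variable {L : ℝ} {η : ℝ → ℝ}

theorem iteratedDeriv_contDiff (h : IsMollifier L η) (j : ℕ) :
    ContDiff ℝ (⊤ : ℕ∞) (iteratedDeriv j η) := by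
  induction j with
  | zero => simpa using h.contDiff
  | succ j ih =>
    rw [iteratedDeriv_succ]
    exact ((contDiff_succ_iff_deriv (n := ((⊤ : ℕ∞) : WithTop ℕ∞))).1 ih).2.2

theorem continuous (h : IsMollifier L η) (j : ℕ) : Continuous (iteratedDeriv j η) :=
  (h.iteratedDeriv_contDiff j).continuous

theorem hasDerivAt (h : IsMollifier L η) (j : ℕ) (s : ℝ) :
    HasDerivAt (iteratedDeriv j η) (iteratedDeriv (j + 1) η s) s := by
  rw [iteratedDeriv_succ]
  exact ((h.iteratedDeriv_contDiff j).differentiable (by simp) s).hasDerivAt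

theorem iteratedDeriv_eq_zero (h : IsMollifier L η) (j : ℕ) {s : ℝ} (hs : L < |s|) :
    iteratedDeriv j η s = 0 := by
  have hev : η =ᶠ[𝓝 s] fun _ => 0 := by
    filter_upwards [(isOpen_lt continuous_const continuous_abs).mem_nhds hs] with u hu
      using h.eq_zero u hu
  rw [hev.iteratedDeriv_eq j]
  simp

theorem hasCompactSupport (h : IsMollifier L η) (j : ℕ) :
    HasCompactSupport (iteratedDeriv j η) :=
  HasCompactSupport.intro (K := Icc (-L) L) isCompact_Icc fun s hs =>
    h.iteratedDeriv_eq_zero j (by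
      by_contra! hle
      exact hs (abs_le.1 hle))

theorem exists_bound (h : IsMollifier L η) (j : ℕ) : ∃ C, 0 ≤ C ∧ ∀ s, |iteratedDeriv j η s| ≤ C := by
  obtain ⟨C, hC⟩ := (h.hasCompactSupport j).exists_bound_of_continuous (h.continuous j)
  exact ⟨C, (norm_nonneg _).trans (hC 0), hC⟩

theorem exists_bound_le (h : IsMollifier L η) (n : ℕ) :
    ∃ C, 0 ≤ C ∧ ∀ j ≤ n, ∀ s, |iteratedDeriv j η s| ≤ C := by
  choose C hC0 hC using h.exists_bound
  refine ⟨∑ j ∈ Finset.range (n + 1), C j, Finset.sum_nonneg fun j _ => hC0 j, fun j hj s => ?_⟩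
  exact (hC j s).trans (Finset.single_le_sum (fun j _ => hC0 j) (Finset.mem_range.2 (by omega)))

end IsMollifier

/-- Convolution in time with the `j`-th derivative of a mollifier. -/
noncomputable def timeMollify (η : ℝ → ℝ) (f : ℝ → ℝ) (j : ℕ) (t : ℝ) : ℝ :=
  ∫ s, f s * iteratedDeriv j η (t - s)

theorem timeMollify_congr {η : ℝ → ℝ} {f g : ℝ → ℝ} (h : ∀ᵐ s : ℝ, f s = g s) (j : ℕ) (t : ℝ) :
    timeMollify η f j t = timeMollify η g j t :=
  integral_congr_ae (h.mono fun s hs => by simp only [hs])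

theorem hasDerivAt_timeMollify {L : ℝ} {η : ℝ → ℝ} (h : IsMollifier L η) {f : ℝ → ℝ}
    (hf : LocallyIntegrable f) (j : ℕ) (t : ℝ) :
    HasDerivAt (timeMollify η f j) (timeMollify η f (j + 1) t) t := by
  have := (h.hasCompactSupport j).hasDerivAt_convolution_right (ContinuousLinearMap.mul ℝ ℝ) hf
    ((h.iteratedDeriv_contDiff j).of_le (by simp)) t
  rwa [← iteratedDeriv_succ] at this

theorem timeMollify_eq_zero {L : ℝ} {η : ℝ → ℝ} (h : IsMollifier L η) {f : ℝ → ℝ} {α : ℝ}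
    (hf : ∀ s < α, f s = 0) (j : ℕ) {t : ℝ} (ht : t ≤ α - L - 1) : timeMollify η f j t = 0 := by
  refine integral_eq_zero_of_ae (.of_forall fun s => ?_)
  rcases lt_or_ge s α with hs | hs
  · simp [hf s hs]
  · have : L < |t - s| := by rw [lt_abs]; right; linarith
    simp [h.iteratedDeriv_eq_zero j this]

namespace IsRegularDensity
variable {α : ℝ} {ψ : E3 → ℝ → ℝ}

/-- The mollifier looks at most `L` into the future, so values before `N` are controlled by the mass
up to `N + L`, a square integrable function of `y`. The vanishing time moves to `α - L - 1`, where
the extra `1` makes inequalities strict. -/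
theorem isSmoothDensity {Ω : Set E3} (h : IsRegularDensity (surfaceMeasure Ω) α ψ) {L : ℝ}
    {η : ℝ → ℝ} (hη : IsMollifier L η) (N : ℝ) :
    ∃ m, IsSmoothDensity (frontier Ω) (α - L - 1) N m (fun j y => timeMollify η (ψ y) j) := by
  obtain ⟨C, hC0, hC⟩ := hη.exists_bound_le 2
  refine ⟨fun y => C * (massUpTo ψ (N + L) y).toReal, fun j => ?_, fun j y t =>
    hasDerivAt_timeMollify hη (h.locallyIntegrable y) j t, fun j hj y t ht => ?_,
    fun j y t ht => timeMollify_eq_zero hη (h.eq_zero y) j ht,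
    (h.measurable_massUpTo _).ennreal_toReal.const_mul _, ?_⟩
  · refine (StronglyMeasurable.integral_prod_right'
      (f := fun q : (E3 × ℝ) × ℝ => ψ q.1.1 q.2 * iteratedDeriv j η (q.1.2 - q.2)) ?_).measurable
    refine (Measurable.mul (h.measurable.comp (by fun_prop :
      Measurable fun q : (E3 × ℝ) × ℝ => (q.1.1, q.2))) ?_).stronglyMeasurable
    exact (hη.continuous j).measurable.comp (by fun_prop)
  · have hsupp : ∀ s, s ∉ Iic (N + L) → ψ y s * iteratedDeriv j η (t - s) = 0 := fun s hs => by
      have : L < |t - s| := by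
        rw [lt_abs]; right
        have := not_le.1 (mem_Iic.not.1 hs)
        linarith
      rw [hη.iteratedDeriv_eq_zero j this, mul_zero]
    rw [timeMollify, ← setIntegral_eq_integral_of_forall_compl_eq_zero hsupp, massUpTo,
      ← integral_norm_eq_lintegral_enorm (h.integrableOn y _).aestronglyMeasurable,
      ← integral_const_mul, ← Real.norm_eq_abs]
    refine norm_integral_le_of_norm_le ((h.integrableOn y _).norm.const_mul C)
      (.of_forall fun s => ?_)
    rw [norm_mul, mul_comm]
    exact mul_le_mul_of_nonneg_right (hC j hj _) (norm_nonneg _)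
  · have e : ∀ y, ‖C * (massUpTo ψ (N + L) y).toReal‖ₑ ^ 2 =
        ‖C‖ₑ ^ 2 * massUpTo ψ (N + L) y ^ 2 := fun y => by
      rw [enorm_mul, mul_pow, Real.enorm_of_nonneg (r := ENNReal.toReal _) ENNReal.toReal_nonneg,
        ENNReal.ofReal_toReal (h.massUpTo_lt_top _ y).ne]
    simp_rw [e]
    rw [lintegral_const_mul' _ _ (by finiteness)]
    exact ENNReal.mul_lt_top (by finiteness) (h.lintegral_massUpTo_sq_lt_top _)

end IsRegularDensity

/-- Off the compact `Γ` the kernel is bounded by the inverse of the radius of a ball about `r` that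
misses `Γ`. -/
theorem isGoodPoint_of_notMem {Ω : Set E3} (hΓ : HasLipschitzBoundary Ω (frontier Ω)) {α : ℝ}
    {ψ : E3 → ℝ → ℝ} (h : IsRegularDensity (surfaceMeasure Ω) α ψ) {r : E3} (hr : r ∉ frontier Ω) :
    IsGoodPoint (surfaceMeasure Ω) ψ r := by
  have hfin : IsFiniteMeasure (surfaceMeasure Ω) := hΓ.sFinite
  intro N
  obtain ⟨δ, hδ, hδr⟩ := Metric.isOpen_iff.1 hΓ.isCompact.isClosed.isOpen_compl r hr
  refine lt_of_le_of_lt (setLIntegral_mono' (g := fun y => massUpTo ψ N y * ENNReal.ofReal δ⁻¹)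
    hΓ.isCompact.measurableSet fun y hy => ?_) ?_
  · have hry : δ ≤ ‖r - y‖ := by
      by_contra! hlt
      exact hδr (by rwa [mem_ball, dist_comm, dist_eq_norm] : y ∈ ball r δ) hy
    have hne : r - y ≠ 0 := norm_pos_iff.1 (hδ.trans_le hry)
    rw [enorm_inv_eq hne]
    gcongr
  · rw [lintegral_mul_const' _ _ ENNReal.ofReal_ne_top]
    exact ENNReal.mul_lt_top (h.lintegral_massUpTo_lt_top N) ENNReal.ofReal_lt_top

theorem ae_isGoodPoint {Ω : Set E3} (hΓ : HasLipschitzBoundary Ω (frontier Ω)) {α : ℝ}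
    {ψ : E3 → ℝ → ℝ} (h : IsRegularDensity (surfaceMeasure Ω) α ψ) :
    ∀ᵐ r ∂surfaceMeasure Ω, IsGoodPoint (surfaceMeasure Ω) ψ r := by
  have hfin : IsFiniteMeasure (surfaceMeasure Ω) := hΓ.sFinite
  have h1 : ∀ᵐ r ∂surfaceMeasure Ω, ∀ k : ℕ,
      ∫⁻ y, massUpTo ψ k y * ‖r - y‖ₑ⁻¹ ∂surfaceMeasure Ω < ∞ := ae_all_iff.2 fun k =>
    hΓ.ae_lintegral_mul_inv_enorm_lt_top (h.measurable_massUpTo k) (h.lintegral_massUpTo_lt_top k)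
  filter_upwards [h1] with r hr N
  obtain ⟨k, hk⟩ := exists_nat_ge N
  refine lt_of_le_of_lt (lintegral_mono fun y => ?_) (hr k)
  gcongr
  exact massUpTo_mono ψ hk y

theorem enorm_retardedIntegrand_le (c : ℝ) (ψ : E3 → ℝ → ℝ) (r : E3) (t : ℝ) (y : E3) :
    ‖retardedIntegrand c ψ r t y‖ₑ ≤ ‖ψ y (t - ‖r - y‖ / c)‖ₑ * ‖r - y‖ₑ⁻¹ := by
  rcases eq_or_ne (r - y) 0 with h | h
  · simp [retardedIntegrand, h]
  · rw [retardedIntegrand, div_eq_mul_inv, enorm_mul]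
    gcongr
    have hpos : 0 < ‖r - y‖ := norm_pos_iff.2 h
    rw [enorm_inv_eq h, Real.enorm_of_nonneg (by positivity)]
    refine ENNReal.ofReal_le_ofReal (inv_anti₀ hpos ?_)
    exact le_mul_of_one_le_left hpos.le (by nlinarith [Real.pi_gt_three])

theorem retardedIntegrand_eq (c : ℝ) (ψ : E3 → ℝ → ℝ) (r : E3) (t : ℝ) (y : E3) :
    retardedIntegrand c ψ r t y = ψ y (t - ‖r - y‖ / c) * newtonKernel (r - y) := by
  rw [retardedIntegrand, newtonKernel, div_eq_mul_inv, mul_inv, pow_one]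

section
variable {c : ℝ} (hc : 0 < c) {Ω : Set E3} {α : ℝ} {ψ : E3 → ℝ → ℝ}
  (h : IsRegularDensity (surfaceMeasure Ω) α ψ)

include h in
theorem IsRegularDensity.measurable_retardedIntegrand :
    Measurable fun q : (E3 × ℝ) × E3 => retardedIntegrand c ψ q.1.1 q.1.2 q.2 := by
  unfold retardedIntegrand
  exact (h.measurable.comp (measurable_retarded c)).div (by fun_prop)

include hc h in
theorem IsRegularDensity.singleLayer_eq_zero (r : E3) {t : ℝ} (ht : t < α) :
    singleLayer c Ω ψ r t = 0 := by
  refine integral_eq_zero_of_ae (.of_forall fun y => ?_)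
  simp [retardedIntegrand, h.eq_zero y _ (retarded_lt hc ht r y)]

variable [SFinite (surfaceMeasure Ω)] {r : E3} (hr : IsGoodPoint (surfaceMeasure Ω) ψ r)
include hc h hr

-- Undoing the delay by a translation in time bounds the time integral by the mass up to `N`,
-- because a retarded time never exceeds the time itself. What remains is the integral in
-- `IsGoodPoint`.
omit [SFinite (surfaceMeasure Ω)] in
theorem IsGoodPoint.integrable_prod (N : ℝ) :
    Integrable (fun q : E3 × ℝ => retardedIntegrand c ψ r q.2 q.1)
      ((surfaceMeasure Ω).prod (volume.restrict (Iic N))) := by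
  have hm : Measurable fun q : E3 × ℝ => retardedIntegrand c ψ r q.2 q.1 :=
    h.measurable_retardedIntegrand.comp
      (by fun_prop : Measurable fun q : E3 × ℝ => ((r, q.2), q.1))
  refine ⟨hm.aestronglyMeasurable, ?_⟩
  rw [hasFiniteIntegral_iff_enorm, lintegral_prod _ hm.enorm.aemeasurable]
  refine lt_of_le_of_lt (lintegral_mono_ae (.of_forall fun y => ?_)) (hr N)
  refine (lintegral_mono fun u => enorm_retardedIntegrand_le c ψ r u y).trans ?_
  have hmy := h.measurable_slice y
  rw [lintegral_mul_const _ (by fun_prop)]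
  gcongr
  rw [massUpTo, ← lintegral_indicator measurableSet_Iic, ← lintegral_indicator measurableSet_Iic,
    ← lintegral_sub_right_eq_self ((Iic N).indicator fun s => ‖ψ y s‖ₑ) (‖r - y‖ / c)]
  refine lintegral_mono fun u => ?_
  have hd : 0 ≤ ‖r - y‖ / c := by positivity
  by_cases hu : u ≤ N
  · rw [indicator_of_mem (by exact hu), indicator_of_mem]
    exact (sub_le_self u hd).trans hu
  · rw [indicator_of_notMem (by exact hu)]
    exact zero_le

theorem IsGoodPoint.ae_converges : ∀ᵐ t : ℝ, SingleLayerConverges c Ω ψ r t := by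
  have h1 : ∀ k : ℕ, ∀ᵐ t : ℝ, t ∈ Iic (k : ℝ) → SingleLayerConverges c Ω ψ r t := fun k => by
    have := (hr.integrable_prod hc h k).prod_left_ae
    exact (ae_restrict_iff' measurableSet_Iic).1 this
  filter_upwards [ae_all_iff.2 h1] with t ht
  obtain ⟨k, hk⟩ := exists_nat_ge t
  exact ht k hk

theorem IsGoodPoint.locallyIntegrable : LocallyIntegrable (singleLayer c Ω ψ r) :=
  fun t => ⟨Iic (t + 1), Iic_mem_nhds (by linarith),
    (hr.integrable_prod hc h (t + 1)).integral_prod_right⟩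

/-- The delay at fixed `y` is absorbed by a translation of the integration variable. Fubini then
applies because the mollifier vanishes for times beyond `t + L`, where absolute integrability is not
available. -/
theorem IsGoodPoint.layerPotential_eq {L : ℝ} {η : ℝ → ℝ} (hη : IsMollifier L η) (j : ℕ) (t : ℝ) :
    layerPotential c (frontier Ω) (fun j y => timeMollify η (ψ y) j) j (r, t) =
      timeMollify η (singleLayer c Ω ψ r) j t := by
  have e1 : layerPotential c (frontier Ω) (fun j y => timeMollify η (ψ y) j) j (r, t) =
      ∫ y, (∫ u, retardedIntegrand c ψ r u y * iteratedDeriv j η (t - u)) ∂surfaceMeasure Ω := by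
    rw [layerPotential, retardedPotential]
    refine integral_congr_ae (.of_forall fun y => ?_)
    dsimp only
    rw [timeMollify, ← integral_mul_const, ← integral_sub_right_eq_self _ (‖r - y‖ / c)]
    refine integral_congr_ae (.of_forall fun u => ?_)
    dsimp only
    rw [retardedIntegrand_eq, sub_sub_sub_cancel_right]
    ring
  rw [e1, integral_integral_swap, timeMollify]
  · refine integral_congr_ae (.of_forall fun u => ?_)
    dsimp only
    rw [integral_mul_const]
    rfl
  · obtain ⟨C, hC0, hC⟩ := hη.exists_bound j
    have h1 := hr.integrable_prod hc h (t + L)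
    rw [show (surfaceMeasure Ω).prod (volume.restrict (Iic (t + L))) =
      ((surfaceMeasure Ω).prod volume).restrict (univ ×ˢ Iic (t + L)) by
        rw [← Measure.prod_restrict, Measure.restrict_univ]] at h1
    have h2 : IntegrableOn (fun q : E3 × ℝ => retardedIntegrand c ψ r q.2 q.1 *
        iteratedDeriv j η (t - q.2)) (univ ×ˢ Iic (t + L)) ((surfaceMeasure Ω).prod volume) :=
      h1.mul_bdd (c := C) ((hη.continuous j).comp (by fun_prop :
        Continuous fun q : E3 × ℝ => t - q.2)).aestronglyMeasurable (.of_forall fun q => hC _)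
    refine h2.integrable_of_forall_notMem_eq_zero fun q hq => ?_
    have : L < |t - q.2| := by
      rw [lt_abs]; right
      by_contra! hle
      exact hq ⟨mem_univ _, by simp only [mem_Iic]; linarith⟩
    rw [hη.iteratedDeriv_eq_zero j this, mul_zero]

end

/-! ### The mollified incident field -/

theorem IsMollifier.integrable_mul {L : ℝ} {η : ℝ → ℝ} (hη : IsMollifier L η) {g : ℝ → ℝ}
    (hg : Continuous g) (j : ℕ) (t : ℝ) : Integrable fun s => g s * iteratedDeriv j η (t - s) := by
  refine Continuous.integrable_of_hasCompactSupport
    (hg.mul ((hη.continuous j).comp (by fun_prop))) ?_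
  refine HasCompactSupport.intro (K := Icc (t - L) (t + L)) isCompact_Icc fun s hs => ?_
  rw [hη.iteratedDeriv_eq_zero j, mul_zero]
  by_contra! hle
  exact hs ⟨by linarith [(abs_le.1 hle).2], by linarith [(abs_le.1 hle).1]⟩

/-- Integration by parts moves one derivative from the mollifier to `g`; compact support removes the
boundary terms. -/
theorem timeMollify_succ {L : ℝ} {η : ℝ → ℝ} (hη : IsMollifier L η) {g g' : ℝ → ℝ}
    (hg : ∀ s, HasDerivAt g (g' s) s) (hg' : Continuous g') (j : ℕ) (t : ℝ) :
    timeMollify η g (j + 1) t = timeMollify η g' j t := by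
  have hgc : Continuous g := continuous_iff_continuousAt.2 fun s => (hg s).continuousAt
  have hd : ∀ s, HasDerivAt (fun s => iteratedDeriv j η (t - s))
      (-iteratedDeriv (j + 1) η (t - s)) s := fun s =>
    (hη.hasDerivAt j (t - s)).comp_const_sub t s
  have key := integral_mul_deriv_eq_deriv_mul_of_integrable (fun s _ => hg s) (fun s _ => hd s)
    (by simpa [Pi.mul_def] using (hη.integrable_mul hgc (j + 1) t).neg)
    (hη.integrable_mul hg' j t) (hη.integrable_mul hgc j t)
  simp only [mul_neg, integral_neg] at key
  exact neg_injective key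

/-- The derivative of `(x, t) ↦ f (x, s) * η^{(j)} (t - s)`. -/
noncomputable def mollifiedDeriv (f : E3 × ℝ → ℝ) (η : ℝ → ℝ) (j : ℕ) (q : E3 × ℝ) (s : ℝ) :
    E3 × ℝ →L[ℝ] ℝ :=
  f (q.1, s) • iteratedDeriv (j + 1) η (q.2 - s) • ContinuousLinearMap.snd ℝ E3 ℝ +
    iteratedDeriv j η (q.2 - s) • ((fderiv ℝ f (q.1, s)).comp
      (ContinuousLinearMap.inl ℝ E3 ℝ)).comp (ContinuousLinearMap.fst ℝ E3 ℝ)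

section
variable {U : Set E3} {f : E3 × ℝ → ℝ}

theorem continuous_slice (hf : ContinuousOn f (U ×ˢ univ)) {x : E3} (hx : x ∈ U) :
    Continuous fun s => f (x, s) :=
  continuousOn_univ.1 (hf.comp (by fun_prop) fun s _ => mk_mem_prod hx (mem_univ s))

variable (hU : IsOpen U) (hf : ContDiffOn ℝ 1 f (U ×ˢ univ)) {L : ℝ} {η : ℝ → ℝ} (hη : IsMollifier L η)
include hU hf hη

/-- Near a given point only times in a fixed compact interval contribute, and there the derivative
of the integrand is bounded by continuity. -/
theorem timeMollify_deriv_aux (j : ℕ) :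
    ContDiffOn ℝ 1 (fun q : E3 × ℝ => timeMollify η (fun s => f (q.1, s)) j q.2) (U ×ˢ univ) ∧
    ∀ q ∈ U ×ˢ univ, Integrable (mollifiedDeriv f η j q) ∧
      HasFDerivAt (fun q : E3 × ℝ => timeMollify η (fun s => f (q.1, s)) j q.2)
        (∫ s, mollifiedDeriv f η j q s) q := by
  have hopen : IsOpen (U ×ˢ (univ : Set ℝ)) := hU.prod isOpen_univ
  have hmaps : ∀ p ∈ (U ×ˢ (univ : Set ℝ)) ×ˢ (univ : Set ℝ), (p.1.1, p.2) ∈ U ×ˢ (univ : Set ℝ) :=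
    fun p hp => mk_mem_prod hp.1.1 (mem_univ _)
  have hfd : ContinuousOn (fderiv ℝ f) (U ×ˢ univ) :=
    hf.continuousOn_fderiv_of_isOpen hopen le_rfl
  have hcont : ContinuousOn (fun p : (E3 × ℝ) × ℝ => mollifiedDeriv f η j p.1 p.2)
      ((U ×ˢ univ) ×ˢ univ) := by
    unfold mollifiedDeriv
    have h1 : ContinuousOn (fun p : (E3 × ℝ) × ℝ => f (p.1.1, p.2)) ((U ×ˢ univ) ×ˢ univ) :=
      hf.continuousOn.comp (by fun_prop) hmaps
    have h2 : ContinuousOn (fun p : (E3 × ℝ) × ℝ => fderiv ℝ f (p.1.1, p.2))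
        ((U ×ˢ univ) ×ˢ univ) := hfd.comp (by fun_prop) hmaps
    have h3 : ∀ k, ContinuousOn (fun p : (E3 × ℝ) × ℝ => iteratedDeriv k η (p.1.2 - p.2))
        ((U ×ˢ univ) ×ˢ univ) := fun k =>
      ((hη.continuous k).comp (by fun_prop)).continuousOn
    exact (h1.smul ((h3 _).smul continuousOn_const)).add ((h3 _).smul
      ((h2.clm_comp continuousOn_const).clm_comp continuousOn_const))
  have hslice : ∀ q ∈ U ×ˢ (univ : Set ℝ), Continuous (mollifiedDeriv f η j q) := fun q hq =>
    continuousOn_univ.1 (hcont.comp (f := fun s : ℝ => (q, s)) (by fun_prop) fun s _ =>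
      mk_mem_prod hq (mem_univ s))
  refine contDiffOn_integral_of_dominated hopen
    (fun q hq => hη.integrable_mul (continuous_slice hf.continuousOn hq.1) j q.2)
    (fun q hq => (hslice q hq).aestronglyMeasurable) (.of_forall fun s q hq => ?_)
    (.of_forall fun s => hcont.comp (f := fun q : E3 × ℝ => (q, s)) (by fun_prop) fun q hq =>
      mk_mem_prod hq (mem_univ s)) fun q hq => ?_
  · have h1 : HasFDerivAt (fun q : E3 × ℝ => f (q.1, s)) (((fderiv ℝ f (q.1, s)).comp
        (ContinuousLinearMap.inl ℝ E3 ℝ)).comp (ContinuousLinearMap.fst ℝ E3 ℝ)) q := by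
      have hd : DifferentiableAt ℝ f (q.1, s) := (hf.contDiffAt (hopen.mem_nhds
        (mk_mem_prod hq.1 (mem_univ s)))).differentiableAt one_ne_zero
      exact (fderiv_slice hd 0).1.comp q hasFDerivAt_fst
    have h2 : HasFDerivAt (fun q : E3 × ℝ => iteratedDeriv j η (q.2 - s))
        (iteratedDeriv (j + 1) η (q.2 - s) • ContinuousLinearMap.snd ℝ E3 ℝ) q :=
      (hη.hasDerivAt j _).comp_hasFDerivAt q (hasFDerivAt_snd.sub_const s)
    exact h1.mul h2
  · obtain ⟨ρ, hρ, hρU⟩ := nhds_basis_closedBall.mem_iff.1 (hU.mem_nhds hq.1)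
    set K := closedBall q.1 ρ ×ˢ Icc (q.2 - 1) (q.2 + 1) with hK
    set J := Icc (q.2 - 1 - L) (q.2 + 1 + L) with hJ
    obtain ⟨C, hC⟩ := (((isCompact_closedBall q.1 ρ).prod (isCompact_Icc (a := q.2 - 1)
      (b := q.2 + 1))).prod (isCompact_Icc (a := q.2 - 1 - L)
      (b := q.2 + 1 + L))).exists_bound_of_continuousOn
      (hcont.mono (prod_mono (prod_mono hρU (subset_univ _)) (subset_univ _)))
    refine ⟨K, prod_mem_nhds (closedBall_mem_nhds _ hρ)
      (Icc_mem_nhds (by linarith) (by linarith)), J.indicator fun _ => C,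
      (integrable_indicator_iff measurableSet_Icc).2 (by simp), .of_forall fun s q' hq' => ?_⟩
    by_cases hs : s ∈ J
    · rw [indicator_of_mem hs]
      exact hC (q', s) (mk_mem_prod hq' hs)
    · rw [indicator_of_notMem hs, norm_le_zero_iff, mollifiedDeriv]
      have : L < |q'.2 - s| := by
        by_contra! hle
        have h2 := hq'.2
        exact hs ⟨by linarith [h2.1, (abs_le.1 hle).2], by linarith [h2.2, (abs_le.1 hle).1]⟩
      rw [hη.iteratedDeriv_eq_zero _ this, hη.iteratedDeriv_eq_zero _ this]
      simp

theorem contDiffOn_timeMollify (j : ℕ) :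
    ContDiffOn ℝ 1 (fun q : E3 × ℝ => timeMollify η (fun s => f (q.1, s)) j q.2) (U ×ˢ univ) :=
  (timeMollify_deriv_aux hU hf hη j).1

theorem fderiv_timeMollify_time (j : ℕ) {q : E3 × ℝ} (hq : q.1 ∈ U) :
    fderiv ℝ (fun q : E3 × ℝ => timeMollify η (fun s => f (q.1, s)) j q.2) q (0, 1) =
      timeMollify η (fun s => f (q.1, s)) (j + 1) q.2 := by
  obtain ⟨h1, h2⟩ := (timeMollify_deriv_aux hU hf hη j).2 q ⟨hq, mem_univ _⟩
  rw [h2.fderiv, ContinuousLinearMap.integral_apply h1]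
  simp [mollifiedDeriv, timeMollify, Prod.mk_zero_zero]

theorem fderiv_timeMollify_space (j : ℕ) {q : E3 × ℝ} (hq : q.1 ∈ U) (e : E3) :
    fderiv ℝ (fun q : E3 × ℝ => timeMollify η (fun s => f (q.1, s)) j q.2) q (e, 0) =
      timeMollify η (fun s => fderiv ℝ f (q.1, s) (e, 0)) j q.2 := by
  obtain ⟨h1, h2⟩ := (timeMollify_deriv_aux hU hf hη j).2 q ⟨hq, mem_univ _⟩
  rw [h2.fderiv, ContinuousLinearMap.integral_apply h1]
  simp [mollifiedDeriv, timeMollify, mul_comm]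

end

theorem hasDerivAt_slice_time {U : Set E3} (hU : IsOpen U) {f : E3 × ℝ → ℝ}
    (hf : ContDiffOn ℝ 1 f (U ×ˢ univ)) {x : E3} (hx : x ∈ U) (t : ℝ) :
    HasDerivAt (fun s => f (x, s)) (fderiv ℝ f (x, t) (0, 1)) t := by
  have hd : DifferentiableAt ℝ f (x, t) := (hf.contDiffAt ((hU.prod isOpen_univ).mem_nhds
    (mk_mem_prod hx (mem_univ t)))).differentiableAt one_ne_zero
  have h1 : HasDerivAt (fun s : ℝ => (x, s)) (0, 1) t :=
    (hasDerivAt_const t x).prodMk (hasDerivAt_id t)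
  exact hd.hasFDerivAt.comp_hasDerivAt t h1

section
variable {c : ℝ} {Ω Ωinc : Set E3} {b : E3 → ℝ → ℝ} (hb : IsIncidentField c Ω Ωinc b)

/-- The time derivative of the mollified incident field. -/
noncomputable def incidentPressure (η : ℝ → ℝ) (b : E3 → ℝ → ℝ) (q : E3 × ℝ) : ℝ :=
  timeMollify η (b q.1) 1 q.2

/-- The gradient of the mollified incident field. -/
noncomputable def incidentGradient (η : ℝ → ℝ) (b : E3 → ℝ → ℝ) (i : Fin 3) (q : E3 × ℝ) : ℝ :=
  timeMollify η (fun s => fderiv ℝ (fun p : E3 × ℝ => b p.1 p.2) (q.1, s) (basisVec i, 0)) 0 q.2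

include hb

theorem IsIncidentField.contDiffOn_dir (v : E3 × ℝ) :
    ContDiffOn ℝ 1 (fun q => fderiv ℝ (fun p : E3 × ℝ => b p.1 p.2) q v) (Ωinc ×ˢ univ) :=
  (hb.contDiffOn.fderiv_of_isOpen (hb.isOpen.prod isOpen_univ) (by norm_num)).clm_apply
    contDiffOn_const

theorem IsIncidentField.contDiffOn_one :
    ContDiffOn ℝ 1 (fun p : E3 × ℝ => b p.1 p.2) (Ωinc ×ˢ univ) :=
  hb.contDiffOn.of_le (by norm_num)

/-- The wave equation as a relation between first derivatives of the space-time derivatives of `b`,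
the form in which it matches the acoustic system. -/
theorem IsIncidentField.wave_fderiv {x : E3} (hx : x ∈ Ωinc) (t : ℝ) :
    fderiv ℝ (fun q => fderiv ℝ (fun p : E3 × ℝ => b p.1 p.2) q (0, 1)) (x, t) (0, 1) =
      c ^ 2 * ∑ i, fderiv ℝ (fun q => fderiv ℝ (fun p : E3 × ℝ => b p.1 p.2) q (basisVec i, 0))
        (x, t) (basisVec i, 0) := by
  have hd : ∀ {f : E3 × ℝ → ℝ}, ContDiffOn ℝ 1 f (Ωinc ×ˢ univ) → ∀ y ∈ Ωinc,
      DifferentiableAt ℝ f (y, t) := fun hf y hy => (hf.contDiffAt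
        ((hb.isOpen.prod isOpen_univ).mem_nhds
          (mk_mem_prod hy (mem_univ t)))).differentiableAt one_ne_zero
  have h1 := sub_eq_zero.1 (hb.wave x hx t)
  rw [iteratedDeriv_succ, iteratedDeriv_one,
    InnerProductSpace.laplacian_eq_iteratedFDeriv_orthonormalBasis _
      (EuclideanSpace.basisFun (Fin 3) ℝ)] at h1
  have e1 : deriv (fun s => b x s) = fun s => fderiv ℝ (fun p : E3 × ℝ => b p.1 p.2) (x, s) (0, 1) :=
    funext fun s => (hasDerivAt_slice_time hb.isOpen hb.contDiffOn_one hx s).deriv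
  rw [e1, (hasDerivAt_slice_time hb.isOpen (hb.contDiffOn_dir (0, 1)) hx t).deriv] at h1
  rw [h1]
  refine congrArg (c ^ 2 * ·) (Finset.sum_congr rfl fun i _ => ?_)
  rw [iteratedFDeriv_two_apply]
  have hbas : (EuclideanSpace.basisFun (Fin 3) ℝ) i = basisVec i := by
    rw [EuclideanSpace.basisFun_apply, basisVec]
  simp only [hbas, Matrix.cons_val_zero, Matrix.cons_val_one]
  have e2 : (fun y => fderiv ℝ (fun y => b y t) y (basisVec i)) =ᶠ[𝓝 x]
      fun y => fderiv ℝ (fun p : E3 × ℝ => b p.1 p.2) (y, t) (basisVec i, 0) := by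
    filter_upwards [hb.isOpen.mem_nhds hx] with y hy
    exact (fderiv_slice (hd hb.contDiffOn_one y hy) _).2
  rw [← (fderiv_slice (hd (hb.contDiffOn_dir (basisVec i, 0)) x hx) (basisVec i)).2, ← e2.fderiv_eq]
  have h3 : DifferentiableAt ℝ (fderiv ℝ fun y => b y t) x := by
    have h4 : ContDiffAt ℝ 2 (fun y => b y t) x :=
      ContDiffAt.comp (g := fun p : E3 × ℝ => b p.1 p.2) x
        (hb.contDiffOn.contDiffAt ((hb.isOpen.prod isOpen_univ).mem_nhds
          (mk_mem_prod hx (mem_univ t)))) (by fun_prop : ContDiffAt ℝ 2 (fun y : E3 => (y, t)) x)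
    exact (h4.fderiv_right (m := 1) (by norm_num)).differentiableAt one_ne_zero
  rw [fderiv_clm_apply h3 (differentiableAt_const _)]
  simp

variable {L : ℝ} {η : ℝ → ℝ} (hη : IsMollifier L η) (hΩ : IsOpen Ω) {α : ℝ}
  (hbα : ∀ r ∈ closure Ω, ∀ t ≤ α, b r t = 0)

omit hb in
include hbα hΩ in
theorem fderiv_incident_eq_zero {x : E3} (hx : x ∈ Ω) {t : ℝ} (ht : t < α) :
    fderiv ℝ (fun p : E3 × ℝ => b p.1 p.2) (x, t) = 0 := by
  have hev : (fun p : E3 × ℝ => b p.1 p.2) =ᶠ[𝓝 (x, t)] fun _ => 0 := by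
    filter_upwards [(hΩ.prod isOpen_Iio).mem_nhds (mk_mem_prod hx ht)] with p hp
    exact hbα p.1 (subset_closure hp.1) p.2 (le_of_lt hp.2)
  rw [hev.fderiv_eq]
  simp

include hη in
theorem contDiffOn_incidentPressure : ContDiffOn ℝ 1 (incidentPressure η b) (Ωinc ×ˢ univ) :=
  contDiffOn_timeMollify hb.isOpen hb.contDiffOn_one hη 1

include hη in
theorem contDiffOn_incidentGradient (i : Fin 3) :
    ContDiffOn ℝ 1 (incidentGradient η b i) (Ωinc ×ˢ univ) :=
  contDiffOn_timeMollify hb.isOpen (hb.contDiffOn_dir (basisVec i, 0)) hη 0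

include hη hΩ hbα

omit hb in
theorem incident_eq_zero {x : E3} {t : ℝ} (ht : t ≤ α - L - 1) :
    (x ∈ closure Ω → incidentPressure η b (x, t) = 0) ∧
      (x ∈ Ω → ∀ i, incidentGradient η b i (x, t) = 0) :=
  ⟨fun hx => timeMollify_eq_zero hη (fun s hs => hbα x hx s hs.le) 1 ht,
    fun hx i => timeMollify_eq_zero hη (fun s hs => by
      dsimp only
      rw [fderiv_incident_eq_zero hΩ hbα hx hs]
      rfl) 0 ht⟩

/-- Mollification in time commutes with space derivatives, and by `timeMollify_succ` with time
derivatives, so the wave equation for `b` is inherited by the mollified fields. -/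
theorem isAcousticField_incident (N : ℝ) :
    IsAcousticField c Ω (α - L - 1) N (incidentPressure η b) (incidentGradient η b) := by
  have hsub : Ω ⊆ Ωinc := subset_closure.trans hb.closure_subset
  have hsub' : Ω ×ˢ Iio N ⊆ Ωinc ×ˢ univ := prod_mono hsub (subset_univ _)
  refine ⟨(contDiffOn_incidentPressure hb hη).mono hsub',
    fun i => (contDiffOn_incidentGradient hb hη i).mono hsub', fun x hx t _ => ?_,
    fun x hx t _ i => ?_, fun x hx t _ ht => ?_⟩
  · have hx' := hsub hx
    have e1 : fderiv ℝ (incidentPressure η b) (x, t) (0, 1) = timeMollify η (b x) 2 t :=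
      fderiv_timeMollify_time hb.isOpen hb.contDiffOn_one hη 1 hx'
    have e2 : ∀ i, fderiv ℝ (incidentGradient η b i) (x, t) (basisVec i, 0) = timeMollify η (fun s =>
        fderiv ℝ (fun q => fderiv ℝ (fun p : E3 × ℝ => b p.1 p.2) q (basisVec i, 0))
        (x, s) (basisVec i, 0)) 0 t := fun i =>
      fderiv_timeMollify_space hb.isOpen (hb.contDiffOn_dir (basisVec i, 0)) hη 0 hx' (basisVec i)
    have hcd : ∀ v w : E3 × ℝ, Continuous fun s => fderiv ℝ (fun q =>
        fderiv ℝ (fun p : E3 × ℝ => b p.1 p.2) q v) (x, s) w := fun v w =>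
      continuous_slice (f := fun q => fderiv ℝ (fun q =>
        fderiv ℝ (fun p : E3 × ℝ => b p.1 p.2) q v) q w)
        (((hb.contDiffOn_dir v).continuousOn_fderiv_of_isOpen
          (hb.isOpen.prod isOpen_univ) le_rfl).clm_apply continuousOn_const) hx'
    rw [e1, Finset.sum_congr rfl fun i _ => e2 i, timeMollify_succ hη (j := 1)
      (fun s => hasDerivAt_slice_time hb.isOpen hb.contDiffOn_one hx' s)
      (continuous_slice (hb.contDiffOn_dir (0, 1)).continuousOn hx'),
      timeMollify_succ hη (j := 0)
      (fun s => hasDerivAt_slice_time hb.isOpen (hb.contDiffOn_dir (0, 1)) hx' s) (hcd _ _)]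
    simp only [timeMollify]
    rw [← integral_finsetSum _ fun i _ => hη.integrable_mul (hcd _ _) 0 t, ← integral_const_mul]
    refine integral_congr_ae (.of_forall fun s => ?_)
    dsimp only
    rw [hb.wave_fderiv hx' s, ← Finset.sum_mul, mul_assoc]
  · have e1 : fderiv ℝ (incidentGradient η b i) (x, t) (0, 1) = _ :=
      fderiv_timeMollify_time hb.isOpen (hb.contDiffOn_dir (basisVec i, 0)) hη 0 (hsub hx)
    have e2 : fderiv ℝ (incidentPressure η b) (x, t) (basisVec i, 0) = _ :=
      fderiv_timeMollify_space hb.isOpen hb.contDiffOn_one hη 1 (hsub hx) (basisVec i)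
    rw [e1, e2]
  · have := incident_eq_zero hη hΩ hbα (x := x) ht
    exact ⟨this.1 (subset_closure hx), this.2 hx⟩

theorem isRegularBackground_incident (hbd : Bornology.IsBounded Ω) (N : ℝ) :
    IsRegularBackground Ω (frontier Ω) N (incidentPressure η b) (incidentGradient η b) := by
  have hsub : Ω ⊆ Ωinc := subset_closure.trans hb.closure_subset
  have hopen : IsOpen (Ωinc ×ˢ (univ : Set ℝ)) := hb.isOpen.prod isOpen_univ
  refine ⟨fun R => ?_, fun y hy t _ => ?_, ?_⟩
  -- At earlier times the mollified field vanishes identically, so bounds on this compact set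
  -- suffice.
  · have hK : IsCompact (closure Ω ×ˢ Icc (α - L - 1) N) := hbd.isCompact_closure.prod isCompact_Icc
    have hKsub : closure Ω ×ˢ Icc (α - L - 1) N ⊆ Ωinc ×ˢ univ :=
      prod_mono hb.closure_subset (subset_univ _)
    have h1 : ∀ i, ∃ C, ∀ q ∈ closure Ω ×ˢ Icc (α - L - 1) N, ‖incidentGradient η b i q‖ ≤ C :=
      fun i => hK.exists_bound_of_continuousOn
        ((contDiffOn_incidentGradient hb hη i).continuousOn.mono hKsub)
    choose C hC using h1
    obtain ⟨C', hC'⟩ := hK.exists_bound_of_continuousOn (f := fun q =>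
      (fderiv ℝ (incidentPressure η b) q).comp (ContinuousLinearMap.inl ℝ E3 ℝ))
      ((((contDiffOn_incidentPressure hb hη).continuousOn_fderiv_of_isOpen hopen
        le_rfl).mono hKsub).clm_comp continuousOn_const)
    refine ⟨∑ i, |C i| + |C'|, fun x hx t ht => ?_⟩
    have hx1 : x ∈ Ω := hx.1
    rcases le_or_gt t (α - L - 1) with ht0 | ht0
    · have hz := fun y (hy : y ∈ Ω) => incident_eq_zero hη hΩ hbα (x := y) ht0
      have hpos : 0 ≤ ∑ i, |C i| + |C'| :=
        add_nonneg (Finset.sum_nonneg fun i _ => abs_nonneg _) (abs_nonneg _)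
      refine ⟨fun i => ?_, ?_⟩
      · rw [(hz x hx1).2 hx1 i, abs_zero]
        exact hpos
      · have hev : (fun y => incidentPressure η b (y, t)) =ᶠ[𝓝 x] fun _ => 0 := by
          filter_upwards [hΩ.mem_nhds hx1] with y hy
          exact (hz y hy).1 (subset_closure hy)
        rw [hev.fderiv_eq]
        simpa using hpos
    · have hq : (x, t) ∈ closure Ω ×ˢ Icc (α - L - 1) N :=
        mk_mem_prod (subset_closure hx1) ⟨ht0.le, ht.le⟩
      refine ⟨fun i => ?_, ?_⟩
      · refine (hC i _ hq).trans ((le_abs_self _).trans ?_)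
        exact (Finset.single_le_sum (f := fun i => |C i|) (fun i _ => abs_nonneg _)
          (Finset.mem_univ i)).trans (le_add_of_nonneg_right (abs_nonneg _))
      · have hd : DifferentiableAt ℝ (incidentPressure η b) (x, t) :=
          ((contDiffOn_incidentPressure hb hη).contDiffAt
            (hopen.mem_nhds (hKsub hq))).differentiableAt one_ne_zero
        rw [(fderiv_slice hd 0).1.fderiv]
        exact (hC' _ hq).trans ((le_abs_self _).trans (le_add_of_nonneg_left
          (Finset.sum_nonneg fun i _ => abs_nonneg _)))
  · have hy' : (y, t) ∈ Ωinc ×ˢ (univ : Set ℝ) :=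
      mk_mem_prod (hb.closure_subset (frontier_subset_closure hy)) (mem_univ t)
    have h1 := ((contDiffOn_incidentPressure hb hη).contDiffAt (hopen.mem_nhds hy')).continuousAt
    exact h1.comp (f := fun x : E3 => (x, t)) (by fun_prop)
  · obtain ⟨R, hR⟩ := hbd.subset_closedBall 0
    exact ⟨R, fun x hx hxR => absurd (mem_closedBall_zero_iff.1 (hR hx)) (not_le.2 hxR)⟩

end

/-! ### Removing the mollification: vanishing and representation off the boundary -/

/-- At time `0`, mollification with the reflection `φ (-s)` is the pairing with the test function
`φ`. -/
theorem ae_eq_zero_of_timeMollify {g : ℝ → ℝ} (hg : LocallyIntegrable g)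
    (h : ∀ L η, IsMollifier L η → timeMollify η g 0 0 = 0) : ∀ᵐ s : ℝ, g s = 0 := by
  refine ae_eq_zero_of_integral_contDiff_smul_eq_zero hg fun φ hφ hsupp => ?_
  obtain ⟨L, hL⟩ := hsupp.isCompact.isBounded.subset_closedBall 0
  have h1 := h L (fun s => φ (-s)) ⟨hφ.comp contDiff_neg, fun s hs => ?_⟩
  · simpa [timeMollify, mul_comm] using h1
  · refine image_eq_zero_of_notMem_tsupport fun hmem => ?_
    have := hL hmem
    rw [mem_closedBall_zero_iff, Real.norm_eq_abs, abs_neg] at this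
    linarith

theorem timeMollify_sub {L : ℝ} {η : ℝ → ℝ} (hη : IsMollifier L η) {f g : ℝ → ℝ}
    (hf : LocallyIntegrable f) (hg : LocallyIntegrable g) (j : ℕ) (t : ℝ) :
    timeMollify η (fun s => f s - g s) j t = timeMollify η f j t - timeMollify η g j t := by
  have hint : ∀ {f : ℝ → ℝ}, LocallyIntegrable f →
      Integrable fun s => f s * iteratedDeriv j η (t - s) := fun hf =>
    (hη.hasCompactSupport j).convolutionExists_right (ContinuousLinearMap.mul ℝ ℝ) hf
      (hη.continuous j) t
  simp only [timeMollify, sub_mul]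
  exact integral_sub (hint hf) (hint hg)

/-- A causal function is determined by the time derivatives of its mollifications. -/
theorem ae_eq_of_timeMollify_one {f g : ℝ → ℝ} (hf : LocallyIntegrable f)
    (hg : LocallyIntegrable g) {α : ℝ} (hf0 : ∀ s < α, f s = 0) (hg0 : ∀ s < α, g s = 0)
    (h : ∀ L η, IsMollifier L η → ∀ t, timeMollify η f 1 t = timeMollify η g 1 t) :
    ∀ᵐ s : ℝ, f s = g s := by
  have h1 : ∀ᵐ s : ℝ, f s - g s = 0 := by
    refine ae_eq_zero_of_timeMollify (hf.sub hg) fun L η hη => ?_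
    have hd : ∀ t, HasDerivAt (timeMollify η (fun s => f s - g s) 0) 0 t := fun t => by
      have := hasDerivAt_timeMollify hη (hf.sub hg) 0 t
      rwa [Pi.sub_def, timeMollify_sub hη hf hg, h L η hη t, sub_self] at this
    -- The mollified difference is constant in time, and causality forces the constant to be zero.
    rw [is_const_of_deriv_eq_zero (fun t => (hd t).differentiableAt) (fun t => (hd t).deriv) 0
      (α - L - 1)]
    exact timeMollify_eq_zero hη (fun s hs => by rw [hf0 s hs, hg0 s hs, sub_zero]) 0 le_rfl
  exact h1.mono fun s hs => sub_eq_zero.1 hs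

theorem IsLipschitzObstacle.frontier_nonempty {Ω : Set E3} (hΩ : IsLipschitzObstacle Ω)
    (hne : Ω.Nonempty) : (frontier Ω).Nonempty := by
  refine nonempty_frontier_iff.2 ⟨hne, fun h => ?_⟩
  exact NormedSpace.unbounded_univ ℝ E3 (h ▸ hΩ.isBounded)

section
variable {c : ℝ} (hc : 0 < c) {Ω : Set E3} (hΩ : IsLipschitzObstacle Ω) {α : ℝ} {ψ : E3 → ℝ → ℝ}
  (h : IsRegularDensity (surfaceMeasure Ω) α ψ)
include hc hΩ h

theorem ae_layerPotential_eq {f : E3 → ℝ → ℝ}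
    (heq : ∀ᵐ p ∂surfaceTimeMeasure Ω, singleLayer c Ω ψ p.1 p.2 = f p.1 p.2) {L : ℝ} {η : ℝ → ℝ}
    (hη : IsMollifier L η) (j : ℕ) :
    ∀ᵐ y ∂surfaceMeasure Ω, ∀ t, layerPotential c (frontier Ω)
      (fun j y => timeMollify η (ψ y) j) j (y, t) = timeMollify η (f y) j t := by
  have hΓ := hΩ.hasLipschitzBoundary
  have hfin : IsFiniteMeasure (surfaceMeasure Ω) := hΓ.sFinite
  filter_upwards [ae_isGoodPoint hΓ h, Measure.ae_ae_of_ae_prod heq] with y hy hye t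
  rw [hy.layerPotential_eq hc h hη j t]
  exact timeMollify_congr hye j t

/-- The solution of the integral equation represents the incident field inside the obstacle. -/
theorem ae_singleLayer_eq {Ωinc : Set E3} {b : E3 → ℝ → ℝ} (hb : IsIncidentField c Ω Ωinc b)
    (hbα : ∀ r ∈ closure Ω, ∀ t ≤ α, b r t = 0)
    (heq : ∀ᵐ p ∂surfaceTimeMeasure Ω, singleLayer c Ω ψ p.1 p.2 = b p.1 p.2) {r : E3}
    (hr : r ∈ Ω) : ∀ᵐ t : ℝ, singleLayer c Ω ψ r t = b r t := by
  have hΓ := hΩ.hasLipschitzBoundary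
  have hfin : IsFiniteMeasure (surfaceMeasure Ω) := hΓ.sFinite
  have hrΓ : r ∉ frontier Ω := fun hrΓ => disjoint_left.1 hΓ.disjoint hr hrΓ
  have hgood := isGoodPoint_of_notMem hΓ h hrΓ
  have hbc : Continuous (b r) := continuous_slice (f := fun p : E3 × ℝ => b p.1 p.2)
    hb.contDiffOn.continuousOn (hb.closure_subset (subset_closure hr))
  refine ae_eq_of_timeMollify_one (hgood.locallyIntegrable hc h) hbc.locallyIntegrable
    (fun s hs => h.singleLayer_eq_zero hc r hs)
    (fun s hs => hbα r (subset_closure hr) s hs.le) fun L η hη t => ?_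
  obtain ⟨m, hA⟩ := h.isSmoothDensity hη (t + 1)
  rw [← hgood.layerPotential_eq hc h hη]
  refine (layer_eq_background hc hΓ (hΩ.frontier_nonempty ⟨r, hr⟩) hA
    (isAcousticField_incident hb hη hΩ.isOpen hbα (t + 1))
    (isRegularBackground_incident hb hη hΩ.isOpen hbα hΩ.isBounded (t + 1)) ?_ hr
    (lt_add_one t)).1
  filter_upwards [ae_layerPotential_eq hc hΩ h heq hη 1] with y hy s _ using hy s

/-- The mollified layer fields of a density with vanishing trace are zero off the boundary. -/
theorem layer_eq_zero (heq : ∀ᵐ p ∂surfaceTimeMeasure Ω, singleLayer c Ω ψ p.1 p.2 = 0)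
    {L : ℝ} {η : ℝ → ℝ} (hη : IsMollifier L η) {x : E3} (hx : x ∉ frontier Ω) (t : ℝ) :
    layerPotential c (frontier Ω) (fun j y => timeMollify η (ψ y) j) 1 (x, t) = 0 ∧
    ∀ i, layerGradient c (frontier Ω) (fun j y => timeMollify η (ψ y) j) i (x, t) = 0 := by
  have hΓ := hΩ.hasLipschitzBoundary
  obtain ⟨m, hA⟩ := h.isSmoothDensity hη (t + 1)
  rcases (frontier Ω).eq_empty_or_nonempty with he | hne
  · simp [layerPotential, layerGradient, retardedPotential, he]
  have hB : ∀ D, IsAcousticField c D (α - L - 1) (t + 1) (fun _ => 0) (fun _ _ => 0) := fun D =>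
    ⟨contDiffOn_const, fun _ => contDiffOn_const, by simp, by simp, by simp⟩
  have hreg : ∀ D, IsRegularBackground D (frontier Ω) (t + 1) (fun _ => 0) (fun _ _ => 0) :=
    fun D => ⟨fun _ => ⟨0, by simp⟩, fun _ _ _ _ => continuousAt_const, ⟨0, by simp⟩⟩
  have htr : ∀ᵐ y ∂surfaceMeasure Ω, ∀ s < t + 1, layerPotential c (frontier Ω)
      (fun j y => timeMollify η (ψ y) j) 1 (y, s) = 0 := by
    filter_upwards [ae_layerPotential_eq hc hΩ h (f := fun _ _ => 0) heq hη 1] with y hy s _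
    rw [hy s]
    simp [timeMollify]
  by_cases hxΩ : x ∈ Ω
  · exact layer_eq_background hc hΓ hne hA (hB _) (hreg _) htr hxΩ (lt_add_one t)
  · have hxc : x ∈ (closure Ω)ᶜ := fun hxc => hx ⟨hxc, fun hi => hxΩ (interior_subset hi)⟩
    exact layer_eq_background hc hΓ.closure_compl hne hA (hB _) (hreg _) htr hxc (lt_add_one t)

end

/-! ### The weak wave equation and recovery of the density -/

/-- Polar coordinates. The area of the sphere is left unevaluated, since later only its being
nonzero matters. -/
theorem integral_eq_of_radial {F : E3 → ℝ} (hF : Integrable F) {K : ℝ}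
    (h : ∀ ω : E3, ‖ω‖ = 1 → ∫ ρ in Ioi (0 : ℝ), ρ ^ 2 * F (ρ • ω) = K) :
    ∫ x, F x = (volume : Measure E3).toSphere.real univ * K := by
  have hmp := (volume : Measure E3).measurePreserving_homeomorphUnitSphereProd
  have hemb := (homeomorphUnitSphereProd E3).measurableEmbedding
  set G : sphere (0 : E3) 1 × Ioi (0 : ℝ) → ℝ := fun p => F ((p.2 : ℝ) • (p.1 : E3)) with hG
  have hcomp : ∀ x : ({0}ᶜ : Set E3), G (homeomorphUnitSphereProd E3 x) = F x := fun x => by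
    have hx : ‖(x : E3)‖ ≠ 0 := norm_ne_zero_iff.2 x.2
    simp [hG, smul_smul, hx]
  have hd : Module.finrank ℝ E3 - 1 = 2 := by simp
  rw [hd] at hmp
  have hGi : Integrable G ((volume : Measure E3).toSphere.prod (.volumeIoiPow 2)) := by
    rw [← hmp.integrable_comp_emb hemb]
    have h2 : Integrable (F ∘ Subtype.val) ((volume : Measure E3).comap
        (Subtype.val : ({0}ᶜ : Set E3) → E3)) :=
      (integrableOn_iff_comap_subtypeVal (measurableSet_singleton _).compl).1 hF.integrableOn
    exact h2.congr (.of_forall fun x => (hcomp x).symm)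
  calc ∫ x, F x = ∫ x : ({0}ᶜ : Set E3), F x ∂((volume : Measure E3).comap (↑)) := by
        rw [integral_subtype_comap (measurableSet_singleton _).compl F, restrict_compl_singleton]
    _ = ∫ p, G p ∂((volume : Measure E3).toSphere.prod (.volumeIoiPow 2)) := by
        rw [← hmp.integral_comp hemb]
        exact integral_congr_ae (.of_forall fun x => (hcomp x).symm)
    _ = ∫ _, K ∂(volume : Measure E3).toSphere := by
        rw [integral_prod _ hGi]
        refine integral_congr_ae (.of_forall fun ω => ?_)
        dsimp only
        rw [← h ω (by simp)]
        simp only [Measure.volumeIoiPow, ENNReal.ofReal]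
        rw [integral_withDensity_eq_integral_smul (measurable_subtype_coe.pow_const _).real_toNNReal,
          integral_subtype_comap measurableSet_Ioi
            fun a : ℝ => Real.toNNReal (a ^ 2) • F (a • (ω : E3))]
        refine setIntegral_congr_fun measurableSet_Ioi fun x hx => ?_
        rw [NNReal.smul_def, Real.coe_toNNReal _ (pow_nonneg (le_of_lt hx) _), smul_eq_mul]
    _ = _ := by rw [integral_const, smul_eq_mul]

/-- The integrand of the weak form of the wave equation for the retarded kernel at `y`. -/
noncomputable def weakIntegrand (c : ℝ) (a : ℕ → ℝ → ℝ) (χ : E3 → ℝ) (t : ℝ) (y x : E3) : ℝ :=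
  ∑ i, (a 1 (t - ‖x - y‖ / c) * farKernel c i (x - y) +
    a 0 (t - ‖x - y‖ / c) * nearKernel i (x - y)) * fderiv ℝ χ x (basisVec i) +
  (c ^ 2)⁻¹ * (a 2 (t - ‖x - y‖ / c) * newtonKernel (x - y)) * χ x

theorem sum_farKernel_apply (c : ℝ) (z : E3) (L : E3 →L[ℝ] ℝ) :
    ∑ i, farKernel c i z * L (basisVec i) = -(4 * Real.pi * c)⁻¹ * (‖z‖ ^ 2)⁻¹ * L z := by
  rw [apply_eq_sum_basisVec L z, Finset.mul_sum]
  refine Finset.sum_congr rfl fun i _ => ?_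
  rw [farKernel, inner_basisVec]
  ring

theorem sum_nearKernel_apply (z : E3) (L : E3 →L[ℝ] ℝ) :
    ∑ i, nearKernel i z * L (basisVec i) = -(4 * Real.pi)⁻¹ * (‖z‖ ^ 3)⁻¹ * L z := by
  rw [apply_eq_sum_basisVec L z, Finset.mul_sum]
  refine Finset.sum_congr rfl fun i _ => ?_
  rw [nearKernel, inner_basisVec]
  ring

theorem weakIntegrand_eq (c : ℝ) (a : ℕ → ℝ → ℝ) (χ : E3 → ℝ) (t : ℝ) (y x : E3) :
    weakIntegrand c a χ t y x =
      -(a 1 (t - ‖x - y‖ / c) * ((4 * Real.pi * c)⁻¹ * (‖x - y‖ ^ 2)⁻¹) +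
        a 0 (t - ‖x - y‖ / c) * ((4 * Real.pi)⁻¹ * (‖x - y‖ ^ 3)⁻¹)) * fderiv ℝ χ x (x - y) +
      (c ^ 2)⁻¹ * (a 2 (t - ‖x - y‖ / c) * newtonKernel (x - y)) * χ x := by
  have h1 := sum_farKernel_apply c (x - y) (fderiv ℝ χ x)
  have h2 := sum_nearKernel_apply (x - y) (fderiv ℝ χ x)
  rw [weakIntegrand]
  simp only [add_mul, Finset.sum_add_distrib, mul_assoc (a _ _), ← Finset.mul_sum]
  rw [h1, h2]
  ring

/-- On each ray `x = y + ρ ω` the integrand times `ρ²` is an exact derivative in `ρ`. The compact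
support of `χ` leaves only the value at `ρ = 0`, the same for every direction: the point source at
`y`. -/
theorem integral_weakIntegrand {c : ℝ} (hc : 0 < c) {a : ℕ → ℝ → ℝ}
    (ha : ∀ j t, HasDerivAt (a j) (a (j + 1) t) t) {χ : E3 → ℝ} (hχ : ContDiff ℝ 1 χ)
    (hχs : HasCompactSupport χ) (t : ℝ) (y : E3) (hint : Integrable (weakIntegrand c a χ t y)) :
    ∫ x, weakIntegrand c a χ t y x =
      (volume : Measure E3).toSphere.real univ * ((4 * Real.pi)⁻¹ * (a 0 t * χ y)) := by
  rw [← integral_add_right_eq_self _ y]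
  refine integral_eq_of_radial (hint.comp_add_right y) fun ω hω => ?_
  have hac : ∀ j, Continuous (a j) := fun j =>
    continuous_iff_continuousAt.2 fun t => (ha j t).continuousAt
  set H : ℝ → ℝ := fun ρ => -(4 * Real.pi)⁻¹ *
    ((ρ / c * a 1 (t - ρ / c) + a 0 (t - ρ / c)) * χ (ρ • ω + y)) with hH
  set H' : ℝ → ℝ := fun ρ => -(4 * Real.pi)⁻¹ *
    (-(ρ / c ^ 2 * a 2 (t - ρ / c)) * χ (ρ • ω + y) +
      (ρ / c * a 1 (t - ρ / c) + a 0 (t - ρ / c)) * fderiv ℝ χ (ρ • ω + y) ω) with hH'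
  have hder : ∀ ρ, HasDerivAt H (H' ρ) ρ := by
    intro ρ
    have h0 : HasDerivAt (fun ρ : ℝ => t - ρ / c) (-(1 / c)) ρ :=
      ((hasDerivAt_id ρ).div_const c).const_sub t
    have h1 := (ha 0 (t - ρ / c)).comp ρ h0
    have h2 := (ha 1 (t - ρ / c)).comp ρ h0
    have h3 : HasDerivAt (fun ρ : ℝ => ρ • ω + y) ω ρ := by
      simpa using ((hasDerivAt_id ρ).smul_const ω).add_const y
    have h4 : HasDerivAt (fun ρ : ℝ => χ (ρ • ω + y)) (fderiv ℝ χ (ρ • ω + y) ω) ρ :=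
      ((hχ.differentiable one_ne_zero) _).hasFDerivAt.comp_hasDerivAt ρ h3
    refine (((((hasDerivAt_id ρ).div_const c).mul h2).add h1).mul h4 |>.const_mul
      (-(4 * Real.pi)⁻¹)).congr_deriv ?_
    simp only [hH', Function.comp, id, Pi.add_apply, Pi.mul_apply]
    field_simp
    ring
  have hH'c : Continuous H' := by
    have h1 : Continuous fun ρ : ℝ => fderiv ℝ χ (ρ • ω + y) ω :=
      ((hχ.continuous_fderiv one_ne_zero).comp (by fun_prop)).clm_apply continuous_const
    have h2 := hχ.continuous
    have h3 := hac 0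
    have h4 := hac 1
    have h5 := hac 2
    fun_prop
  have hHs : HasCompactSupport H := by
    obtain ⟨R, hR⟩ := hχs.isCompact.isBounded.subset_closedBall 0
    refine HasCompactSupport.intro (K := Icc (-(R + ‖y‖)) (R + ‖y‖)) isCompact_Icc fun ρ hρ => ?_
    have : χ (ρ • ω + y) = 0 := by
      refine image_eq_zero_of_notMem_tsupport fun hmem => hρ (abs_le.1 ?_)
      have h1 := mem_closedBall_zero_iff.1 (hR hmem)
      have h2 := norm_sub_le (ρ • ω + y) y
      rw [add_sub_cancel_right, norm_smul, hω, mul_one, Real.norm_eq_abs] at h2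
      linarith
    simp [hH, this]
  have hHd : deriv H = H' := funext fun ρ => (hder ρ).deriv
  have hHc : ContDiff ℝ 1 H := by
    rw [contDiff_one_iff_deriv]
    exact ⟨fun ρ => (hder ρ).differentiableAt, hHd ▸ hH'c⟩
  have key := hHs.integral_Ioi_deriv_eq hHc 0
  rw [hHd] at key
  have hval : -H 0 = (4 * Real.pi)⁻¹ * (a 0 t * χ y) := by simp [hH]
  rw [← hval, ← key]
  refine setIntegral_congr_fun measurableSet_Ioi fun ρ hρ => ?_
  have hρ' : (0 : ℝ) < ρ := hρ
  rw [weakIntegrand_eq, add_sub_cancel_right, norm_smul, hω, mul_one, Real.norm_of_nonneg hρ'.le,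
    map_smul, newtonKernel, norm_smul, hω, mul_one, Real.norm_of_nonneg hρ'.le, hH', smul_eq_mul]
  have := Real.pi_ne_zero
  field_simp
  ring

/-- This majorant reduces the joint integrability needed for Fubini to that of `gradPotential` on a
ball. -/
theorem enorm_weakIntegrand_le {c : ℝ} (hc : 0 < c) {Γ : Set E3} (hΓ : IsCompact Γ) {χ : E3 → ℝ}
    (hχ : ContDiff ℝ 1 χ) (hχs : HasCompactSupport χ) :
    ∃ R : ℝ, ∃ C : ℝ≥0∞, C ≠ ∞ ∧ ∀ (a : ℕ → ℝ → ℝ) (t M : ℝ) (x y : E3), y ∈ Γ →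
      (∀ j ≤ 2, |a j (t - ‖x - y‖ / c)| ≤ M) →
      ‖weakIntegrand c a χ t y x‖ₑ ≤
        (closedBall (0 : E3) R).indicator (fun _ => C * (‖M‖ₑ * ‖x - y‖ₑ⁻¹ ^ 2)) x := by
  obtain ⟨R, hR0, hR⟩ := hχs.isCompact.isBounded.subset_closedBall_lt 0 0
  obtain ⟨R₁, hR₁0, hR₁⟩ := hΓ.isBounded.subset_closedBall_lt 0 0
  obtain ⟨C₁, hC₁⟩ := hχs.exists_bound_of_continuous hχ.continuous
  obtain ⟨C₂, hC₂⟩ := (hχs.fderiv ℝ).exists_bound_of_continuous (hχ.continuous_fderiv one_ne_zero)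
  have hC₁0 : 0 ≤ C₁ := (norm_nonneg _).trans (hC₁ 0)
  have hC₂0 : 0 ≤ C₂ := (norm_nonneg _).trans (hC₂ 0)
  set B := R + R₁ with hB
  have hB0 : 0 < B := add_pos hR0 hR₁0
  set C : ℝ := ((4 * Real.pi * c)⁻¹ * B + (4 * Real.pi)⁻¹) * C₂ +
    (c ^ 2)⁻¹ * ((4 * Real.pi)⁻¹ * B) * C₁ with hC
  have hC0 : 0 ≤ C := by positivity
  refine ⟨R, ENNReal.ofReal C, ENNReal.ofReal_ne_top, fun a t M x y hy ha => ?_⟩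
  have hM : 0 ≤ M := (abs_nonneg _).trans (ha 0 (by norm_num))
  by_cases hx : x ∈ closedBall (0 : E3) R
  · rw [indicator_of_mem hx, weakIntegrand_eq]
    -- On the diagonal the integrand is `0`, by linearity of the derivative and the convention `0⁻¹
    -- = 0`.
    rcases eq_or_ne (x - y) 0 with hz | hz
    · simp [hz, newtonKernel]
    have hz' : 0 < ‖x - y‖ := norm_pos_iff.2 hz
    have hzB : ‖x - y‖ ≤ B := (norm_sub_le _ _).trans (add_le_add (mem_closedBall_zero_iff.1 hx)
      (mem_closedBall_zero_iff.1 (hR₁ hy)))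
    rw [enorm_inv_eq hz, ← ENNReal.ofReal_pow (by positivity), Real.enorm_of_nonneg hM,
      ← ENNReal.ofReal_mul hM, ← ENNReal.ofReal_mul hC0, ← ofReal_norm]
    refine ENNReal.ofReal_le_ofReal ?_
    set s := t - ‖x - y‖ / c
    set n := ‖x - y‖ with hn
    have h0 := ha 0 (by norm_num)
    have h1 := ha 1 (by norm_num)
    have h2 := ha 2 le_rfl
    have hD : |fderiv ℝ χ x (x - y)| ≤ C₂ * n :=
      ((fderiv ℝ χ x).le_opNorm _).trans (by gcongr; exact hC₂ x)
    have e1 : |a 1 s * ((4 * Real.pi * c)⁻¹ * (n ^ 2)⁻¹) +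
        a 0 s * ((4 * Real.pi)⁻¹ * (n ^ 3)⁻¹)| ≤ M * ((4 * Real.pi * c)⁻¹ * (n ^ 2)⁻¹) +
        M * ((4 * Real.pi)⁻¹ * (n ^ 3)⁻¹) := by
      refine (abs_add_le _ _).trans ?_
      rw [abs_mul (a 1 s), abs_mul (a 0 s),
        abs_of_pos (a := (4 * Real.pi * c)⁻¹ * (n ^ 2)⁻¹) (by positivity),
        abs_of_pos (a := (4 * Real.pi)⁻¹ * (n ^ 3)⁻¹) (by positivity)]
      gcongr
    have e2 : |(c ^ 2)⁻¹ * (a 2 s * newtonKernel (x - y)) * χ x| ≤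
        (c ^ 2)⁻¹ * (M * ((4 * Real.pi)⁻¹ * n⁻¹)) * C₁ := by
      rw [abs_mul, abs_mul, abs_mul, newtonKernel, pow_one,
        abs_of_pos (a := (c ^ 2)⁻¹) (by positivity),
        abs_of_pos (a := (4 * Real.pi)⁻¹ * ‖x - y‖⁻¹) (by positivity)]
      gcongr
      exact hC₁ x
    calc ‖_‖ ≤ (M * ((4 * Real.pi * c)⁻¹ * (n ^ 2)⁻¹) + M * ((4 * Real.pi)⁻¹ * (n ^ 3)⁻¹)) *
          (C₂ * n) + (c ^ 2)⁻¹ * (M * ((4 * Real.pi)⁻¹ * n⁻¹)) * C₁ := by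
          refine (norm_add_le _ _).trans (add_le_add ?_ e2)
          rw [norm_mul, norm_neg]
          exact mul_le_mul e1 hD (abs_nonneg _) (by positivity)
      _ = M * ((((4 * Real.pi * c)⁻¹ * n + (4 * Real.pi)⁻¹) * C₂ +
          (c ^ 2)⁻¹ * ((4 * Real.pi)⁻¹ * n) * C₁) * n⁻¹ ^ 2) := by
          have := Real.pi_ne_zero
          field_simp
      _ ≤ M * (C * n⁻¹ ^ 2) := by rw [hC]; gcongr
      _ = _ := by ring
  · rw [indicator_of_notMem hx]
    have hxs : x ∉ tsupport χ := fun h => hx (hR h)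
    have hd : fderiv ℝ χ x = 0 :=
      image_eq_zero_of_notMem_tsupport fun h => hxs (tsupport_fderiv_subset ℝ h)
    simp [weakIntegrand, image_eq_zero_of_notMem_tsupport hxs, hd]

section
variable {c : ℝ} (hc : 0 < c) {D Γ : Set E3} (hΓ : HasLipschitzBoundary D Γ) {t₀ N : ℝ} {m : E3 → ℝ}
  {A : ℕ → E3 → ℝ → ℝ} (hA : IsSmoothDensity Γ t₀ N m A) {χ : E3 → ℝ} (hχ : ContDiff ℝ 1 χ)
include hc hΓ hA hχ

theorem integrable_weakIntegrand (hχs : HasCompactSupport χ) {t : ℝ} (ht : t < N) :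
    Integrable (fun p : E3 × E3 => weakIntegrand c (fun j => A j p.2) χ t p.2 p.1)
      (volume.prod ((μHE[2] : Measure E3).restrict Γ)) := by
  have := hΓ.sFinite
  obtain ⟨R, C, hC, hle⟩ := enorm_weakIntegrand_le hc hΓ.isCompact hχ hχs
  have hAm : ∀ j, Measurable fun p : E3 × E3 => A j p.2 (t - ‖p.1 - p.2‖ / c) := fun j =>
    (hA.measurable j).comp (by fun_prop : Measurable fun p : E3 × E3 => (p.2, t - ‖p.1 - p.2‖ / c))
  have hfm : ∀ v, Measurable fun x => fderiv ℝ χ x v := fun v =>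
    ((hχ.continuous_fderiv one_ne_zero).clm_apply continuous_const).measurable
  have hχm := hχ.continuous.measurable
  have hm : Measurable fun p : E3 × E3 => weakIntegrand c (fun j => A j p.2) χ t p.2 p.1 := by
    unfold weakIntegrand farKernel nearKernel newtonKernel
    refine Measurable.add (Finset.measurable_sum _ fun i _ => ?_) ?_
    · exact (((hAm 1).mul (by fun_prop)).add ((hAm 0).mul (by fun_prop))).mul
        ((hfm _).comp measurable_fst)
    · exact (((hAm 2).mul (by fun_prop)).const_mul _).mul (hχm.comp measurable_fst)
  refine ⟨hm.aestronglyMeasurable, ?_⟩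
  rw [hasFiniteIntegral_iff_enorm, lintegral_prod _ hm.enorm.aemeasurable]
  have hmm := hA.measurable_bound.enorm
  have hb : ∀ x, ∫⁻ y in Γ, ‖weakIntegrand c (fun j => A j y) χ t y x‖ₑ ∂μHE[2] ≤
      (closedBall (0 : E3) R).indicator (fun x => C * gradPotential Γ (fun y => ‖m y‖ₑ) x) x := by
    intro x
    refine (setLIntegral_mono' hΓ.isCompact.measurableSet fun y hy => hle _ t (m y) x y hy
      fun j hj => hA.abs_le j hj y _ (retarded_lt hc ht x y)).trans ?_
    by_cases hx : x ∈ closedBall (0 : E3) R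
    · simp only [indicator_of_mem hx]
      rw [lintegral_const_mul' _ _ hC, gradPotential]
    · simp [indicator_of_notMem hx]
  refine (lintegral_mono hb).trans_lt ?_
  rw [lintegral_indicator measurableSet_closedBall, lintegral_const_mul' _ _ hC]
  refine ENNReal.mul_lt_top hC.lt_top ?_
  have h1 : ∀ a : ℝ≥0∞, a ≤ 1 + a ^ 2 := fun a => by
    rcases le_total a 1 with ha | ha
    · exact ha.trans (le_add_right le_rfl)
    · exact (le_self_pow₀ ha two_ne_zero).trans (le_add_left le_rfl)
  refine (lintegral_mono fun y => h1 _).trans_lt ?_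
  rw [lintegral_add_left measurable_const, lintegral_const, one_mul, Measure.restrict_apply_univ]
  exact ENNReal.add_lt_top.2 ⟨measure_closedBall_lt_top,
    hΓ.lintegral_gradPotential_sq_lt_top hmm hA.lintegral_sq_lt_top R⟩

omit hχ in
theorem integral_weakIntegrand_density {x : E3} {t : ℝ} (hq : (x, t) ∈ Γᶜ ×ˢ Iio N) :
    ∫ y in Γ, weakIntegrand c (fun j => A j y) χ t y x ∂μHE[2] =
      ∑ i, layerGradient c Γ A i (x, t) * fderiv ℝ χ x (basisVec i) +
        (c ^ 2)⁻¹ * layerPotential c Γ A 2 (x, t) * χ x := by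
  have hg : ∀ i, IntegrableOn (fun y => A 1 y (t - ‖x - y‖ / c) * farKernel c i (x - y) +
      A 0 y (t - ‖x - y‖ / c) * nearKernel i (x - y)) Γ μHE[2] := fun i =>
    (integrableOn_layer hc hΓ hA (by norm_num) (isSmoothKernel_far c i) hq).add
      (integrableOn_layer hc hΓ hA (by norm_num) (isSmoothKernel_near i) hq)
  have hn := integrableOn_layer hc hΓ hA le_rfl isSmoothKernel_newton hq
  simp only [weakIntegrand]
  rw [integral_add (integrable_finsetSum _ fun i _ => (hg i).mul_const _)
    ((hn.const_mul _).mul_const _), integral_finsetSum _ fun i _ => (hg i).mul_const _]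
  simp only [integral_mul_const, integral_const_mul]
  congr 1
  exact Finset.sum_congr rfl fun i _ => by rw [layerGradient_eq hc hΓ hA i hq]

end

/-- If the layer fields of a density vanish off the boundary then so does the density. -/
theorem ae_density_eq_zero {c : ℝ} (hc : 0 < c) {D Γ : Set E3} (hΓ : HasLipschitzBoundary D Γ)
    {t₀ N : ℝ} {m : E3 → ℝ} {A : ℕ → E3 → ℝ → ℝ} (hA : IsSmoothDensity Γ t₀ N m A)
    (h : ∀ x ∉ Γ, ∀ t < N, layerPotential c Γ A 1 (x, t) = 0 ∧
      ∀ i, layerGradient c Γ A i (x, t) = 0) {t : ℝ} (ht : t < N) :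
    ∀ᵐ y ∂(μHE[2] : Measure E3).restrict Γ, A 0 y t = 0 := by
  have := hΓ.sFinite
  have hAi : Integrable (fun y => A 0 y t) ((μHE[2] : Measure E3).restrict Γ) :=
    hA.integrable.mono' ((hA.measurable 0).comp
      (by fun_prop : Measurable fun y : E3 => (y, t))).aestronglyMeasurable
      (.of_forall fun y => hA.abs_le 0 (by norm_num) y t ht)
  refine ae_eq_zero_of_integral_contDiff_smul_eq_zero hAi.locallyIntegrable fun χ hχ hχs => ?_
  have hχ1 : ContDiff ℝ 1 χ := hχ.of_le (by simp)
  have hint := integrable_weakIntegrand hc hΓ hA hχ1 hχs ht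
  set κ : ℝ := (volume : Measure E3).toSphere.real univ with hκ
  have hκ0 : κ ≠ 0 := by
    rw [hκ, measureReal_def, ENNReal.toReal_ne_zero]
    exact ⟨Measure.measure_univ_ne_zero.2 (Measure.toSphere_ne_zero _), measure_ne_top _ _⟩
  have hl2 : ∀ x ∉ Γ, layerPotential c Γ A 2 (x, t) = 0 := by
    intro x hx
    have hq : (x, t) ∈ Γᶜ ×ˢ Iio N := mk_mem_prod hx ht
    rw [← fderiv_layerPotential_time hc hΓ hA (j := 1) le_rfl hq]
    have hev : layerPotential c Γ A 1 =ᶠ[𝓝 (x, t)] fun _ => 0 := by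
      filter_upwards [(hΓ.isCompact.isClosed.isOpen_compl.prod isOpen_Iio).mem_nhds hq] with p hp
      exact (h p.1 hp.1 p.2 hp.2).1
    rw [hev.fderiv_eq]
    simp
  -- The surface `Γ` has volume zero, so it is enough that the fields vanish off it.
  have hzero : ∫ x, ∫ y in Γ, weakIntegrand c (fun j => A j y) χ t y x ∂μHE[2] = 0 := by
    refine integral_eq_zero_of_ae ?_
    filter_upwards [measure_eq_zero_iff_ae_notMem.1 hΓ.volume_eq_zero] with x hx
    rw [integral_weakIntegrand_density hc hΓ hA (mk_mem_prod hx ht), hl2 x hx]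
    simp [(h x hx t ht).2]
  have hswap : ∫ x, (∫ y in Γ, weakIntegrand c (fun j => A j y) χ t y x ∂μHE[2]) =
      ∫ y in Γ, (∫ x, weakIntegrand c (fun j => A j y) χ t y x) ∂μHE[2] :=
    integral_integral_swap hint
  rw [hzero] at hswap
  -- In the other order of integration each source point contributes its strength times the value of
  -- the test function there.
  have hfin : ∫ y in Γ, (∫ x, weakIntegrand c (fun j => A j y) χ t y x) ∂μHE[2] =
      κ * (4 * Real.pi)⁻¹ * ∫ y in Γ, χ y • A 0 y t ∂μHE[2] := by
    rw [← integral_const_mul]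
    refine integral_congr_ae ?_
    filter_upwards [hint.prod_left_ae] with y hy
    rw [integral_weakIntegrand hc (fun j s => hA.hasDerivAt j y s) hχ1 hχs t y hy, smul_eq_mul]
    ring
  rw [hfin] at hswap
  have hne : κ * (4 * Real.pi)⁻¹ ≠ 0 :=
    mul_ne_zero hκ0 (inv_ne_zero (mul_ne_zero four_ne_zero Real.pi_ne_zero))
  exact (mul_eq_zero.1 hswap.symm).resolve_left hne

/-! ### Injectivity of the single-layer potential -/

theorem ContDiffBump.isMollifier (φ : ContDiffBump (0 : ℝ)) :
    IsMollifier φ.rOut (φ.normed volume) where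
  contDiff := φ.contDiff_normed
  eq_zero s hs := by
    by_contra hne
    have : s ∈ Function.support (φ.normed volume) := hne
    rw [φ.support_normed_eq, mem_ball_zero_iff, Real.norm_eq_abs] at this
    linarith

/-- Bumps of shrinking radius with fixed ratio `2` between outer and inner radius, so that
Lebesgue's differentiation theorem applies at almost every time. -/
theorem exists_mollifier_seq : ∃ (L : ℕ → ℝ) (η : ℕ → ℝ → ℝ), (∀ n, IsMollifier (L n) (η n)) ∧
    ∀ g : ℝ → ℝ, LocallyIntegrable g →
      ∀ᵐ t : ℝ, Tendsto (fun n => timeMollify (η n) g 0 t) atTop (𝓝 (g t)) := by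
  let φ : ℕ → ContDiffBump (0 : ℝ) := fun n =>
    ⟨1 / (n + 1) / 2, 1 / (n + 1), by positivity, half_lt_self (by positivity)⟩
  refine ⟨fun n => (φ n).rOut, fun n => (φ n).normed volume,
    fun n => ContDiffBump.isMollifier _, fun g hg => ?_⟩
  have := ContDiffBump.ae_convolution_tendsto_right_of_locallyIntegrable (φ := φ) (K := 2)
    tendsto_one_div_add_atTop_nhds_zero_nat
    (.of_forall fun n => le_of_eq (by simp only [φ]; ring)) hg
  filter_upwards [this] with t ht
  refine ht.congr fun n => ?_
  rw [timeMollify, convolution_def, ← integral_sub_left_eq_self _ _ t]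
  simp [mul_comm]

/-- The retarded single layer potential is injective on regular causal densities. -/
theorem IsRegularDensity.ae_eq_zero {c : ℝ} (hc : 0 < c) {Ω : Set E3} (hΩ : IsLipschitzObstacle Ω)
    {α : ℝ} {ψ : E3 → ℝ → ℝ} (h : IsRegularDensity (surfaceMeasure Ω) α ψ)
    (heq : ∀ᵐ p ∂surfaceTimeMeasure Ω, singleLayer c Ω ψ p.1 p.2 = 0) :
    ∀ᵐ p ∂surfaceTimeMeasure Ω, ψ p.1 p.2 = 0 := by
  have hΓ := hΩ.hasLipschitzBoundary
  have hfin : IsFiniteMeasure (surfaceMeasure Ω) := hΓ.sFinite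
  obtain ⟨L, η, hη, hlim⟩ := exists_mollifier_seq
  have hzero : ∀ n, ∀ᵐ y ∂surfaceMeasure Ω, ∀ᵐ t : ℝ, timeMollify (η n) (ψ y) 0 t = 0 := by
    intro n
    have hm : Measurable fun p : E3 × ℝ => timeMollify (η n) (ψ p.1) 0 p.2 := by
      obtain ⟨m, hA⟩ := h.isSmoothDensity (hη n) 0
      exact hA.measurable 0
    rw [Measure.ae_ae_comm (p := fun y t => timeMollify (η n) (ψ y) 0 t = 0)
      (hm (measurableSet_singleton 0))]
    refine .of_forall fun t => ?_
    obtain ⟨m, hA⟩ := h.isSmoothDensity (hη n) (t + 1)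
    exact ae_density_eq_zero hc hΓ hA
      (fun x hx s _ => layer_eq_zero hc hΩ h heq (hη n) hx s) (lt_add_one t)
  refine (Measure.ae_prod_iff_ae_ae (h.measurable (measurableSet_singleton 0))).2 ?_
  filter_upwards [ae_all_iff.2 hzero] with y hy
  filter_upwards [ae_all_iff.2 hy, hlim _ (h.locallyIntegrable y)] with t ht htl
  simp only [ht] at htl
  exact tendsto_nhds_unique htl tendsto_const_nhds

/-! ### Return to the original densities; length of the delay -/

theorem retardedIntegrand_ae_congr {c : ℝ} {ν : Measure E3} {ψ ψ' : E3 → ℝ → ℝ} {r : E3} {t : ℝ}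
    (h : ∀ᵐ y ∂ν, ψ y (t - ‖r - y‖ / c) = ψ' y (t - ‖r - y‖ / c)) :
    retardedIntegrand c ψ r t =ᵐ[ν] retardedIntegrand c ψ' r t :=
  h.mono fun y hy => by simp only [retardedIntegrand, hy]

/-- For `r` inside `Ω`, the ray from `y` through `r` must leave the bounded set `Ω` beyond `r`, at a
boundary point at least as far from `y` as `r` is. -/
theorem norm_sub_le_diam_frontier {Ω : Set E3} (hΩ : IsOpen Ω) (hbd : Bornology.IsBounded Ω)
    {r y : E3} (hr : r ∈ closure Ω) (hy : y ∈ frontier Ω) :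
    ‖r - y‖ ≤ diam (frontier Ω) := by
  have hfb : Bornology.IsBounded (frontier Ω) := hbd.closure.subset frontier_subset_closure
  have hle : ∀ z ∈ frontier Ω, ‖z - y‖ ≤ diam (frontier Ω) := fun z hz => by
    rw [← dist_eq_norm]
    exact dist_le_diam_of_mem hfb hz hy
  by_cases hrf : r ∈ frontier Ω
  · exact hle r hrf
  have hrΩ : r ∈ Ω := by
    by_contra hn
    exact hrf ⟨hr, fun hi => hn (interior_subset hi)⟩
  have hry : 0 < ‖r - y‖ := by
    refine norm_pos_iff.2 (sub_ne_zero.2 fun h => hrf (h ▸ hy))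
  obtain ⟨R, hR⟩ := hbd.subset_closedBall y
  have hf : Continuous fun s : ℝ => y + s • (r - y) := by fun_prop
  have hpre : IsPreconnected ((fun s : ℝ => y + s • (r - y)) '' Ici 1) :=
    isPreconnected_Ici.image _ hf.continuousOn
  obtain ⟨z, ⟨s, hs, rfl⟩, hz⟩ : (((fun s : ℝ => y + s • (r - y)) '' Ici 1) ∩ frontier Ω).Nonempty := by
    by_contra hemp
    have hcl : closure Ω ⊆ closedBall y R := closure_minimal hR isClosed_closedBall
    set s₀ := max 1 ((|R| + 1) / ‖r - y‖) with hs₀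
    have hs₀1 : 1 ≤ s₀ := le_max_left _ _
    have hfar : y + s₀ • (r - y) ∉ closure Ω := fun hmem => by
      have h1 := hcl hmem
      rw [mem_closedBall, dist_eq_norm, add_sub_cancel_left, norm_smul,
        Real.norm_of_nonneg (zero_le_one.trans hs₀1)] at h1
      have h2 : (|R| + 1) / ‖r - y‖ ≤ s₀ := le_max_right _ _
      rw [div_le_iff₀ hry] at h2
      linarith [le_abs_self R]
    obtain ⟨z, -, hzΩ, hzc⟩ := hpre Ω (closure Ω)ᶜ hΩ isClosed_closure.isOpen_compl
      (fun z hz => by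
        by_contra hn
        rw [mem_union, not_or, notMem_compl_iff] at hn
        exact hemp ⟨z, hz, hn.2, fun hi => hn.1 (interior_subset hi)⟩)
      ⟨r, ⟨1, self_mem_Ici, by simp⟩, hrΩ⟩
      ⟨_, ⟨s₀, hs₀1, rfl⟩, hfar⟩
    exact hzc (subset_closure hzΩ)
  have := hle _ hz
  rw [add_sub_cancel_left, norm_smul, Real.norm_of_nonneg (zero_le_one.trans hs)] at this
  have hs1 : (1 : ℝ) ≤ s := hs
  nlinarith

section
variable {c : ℝ} (hc : 0 < c) {Ω : Set E3} (hΩ : IsLipschitzObstacle Ω) {α : ℝ} {ψ : E3 → ℝ → ℝ}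
include hc hΩ

/-- The retarded single layer potential is injective on causal densities. -/
theorem ae_eq_zero_of_singleLayer_eq_zero
    (h2 : ∀ t₀ t₁ : ℝ, MemLp (fun p : E3 × ℝ => ψ p.1 p.2) 2
      ((surfaceMeasure Ω).prod (volume.restrict (Icc t₀ t₁))))
    (h0 : ∀ᵐ p ∂surfaceTimeMeasure Ω, p.2 < α → ψ p.1 p.2 = 0)
    (heq : ∀ᵐ p ∂surfaceTimeMeasure Ω, singleLayer c Ω ψ p.1 p.2 = 0) :
    ∀ᵐ p ∂surfaceTimeMeasure Ω, ψ p.1 p.2 = 0 := by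
  have hfin : IsFiniteMeasure (surfaceMeasure Ω) := hΩ.hasLipschitzBoundary.sFinite
  obtain ⟨ψ', hψ', he⟩ := exists_isRegularDensity h2 h0
  have heq' : ∀ᵐ p ∂surfaceTimeMeasure Ω, singleLayer c Ω ψ' p.1 p.2 = 0 := by
    filter_upwards [heq, (ae_retarded c he).2] with p hp hpe
    rw [← hp]
    exact (integral_congr_ae (retardedIntegrand_ae_congr hpe)).symm
  filter_upwards [hψ'.ae_eq_zero hc hΩ heq', he] with p hp hpe
  rw [hpe, hp]

/-- The layer potential of a solution of the integral equation converges to the incident field on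
the closure of the obstacle. -/
theorem IsCausalDensity.aeOnClosure {Ωinc : Set E3} {b : E3 → ℝ → ℝ}
    (hb : IsIncidentField c Ω Ωinc b) (hbα : ∀ r ∈ closure Ω, ∀ t ≤ α, b r t = 0)
    (hψ : IsCausalDensity c Ω b α ψ) :
    AEOnClosure Ω fun r t => SingleLayerConverges c Ω ψ r t ∧ singleLayer c Ω ψ r t = b r t := by
  have hΓ := hΩ.hasLipschitzBoundary
  have hfin : IsFiniteMeasure (surfaceMeasure Ω) := hΓ.sFinite
  obtain ⟨ψ', hψ', he⟩ := exists_isRegularDensity hψ.locally_sq_integrable hψ.causal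
  have hret := ae_retarded c he
  have heq' : ∀ᵐ p ∂surfaceTimeMeasure Ω, singleLayer c Ω ψ' p.1 p.2 = b p.1 p.2 := by
    filter_upwards [hψ.equation, hret.2] with p hp hpe
    rw [← hp]
    exact (integral_congr_ae (retardedIntegrand_ae_congr hpe)).symm
  refine ⟨fun r hr => ?_, ?_⟩
  · have hgood := isGoodPoint_of_notMem hΓ hψ' fun h => disjoint_left.1 hΓ.disjoint hr h
    filter_upwards [hgood.ae_converges hc hψ', ae_singleLayer_eq hc hΩ hψ' hb hbα heq' hr,
      hret.1 r] with t h1 h2 h3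
    have h4 := retardedIntegrand_ae_congr h3
    exact ⟨h1.congr h4.symm, (integral_congr_ae h4).trans h2⟩
  · have hconv : ∀ᵐ p ∂surfaceTimeMeasure Ω, SingleLayerConverges c Ω ψ' p.1 p.2 := by
      have hm : MeasurableSet {p : E3 × ℝ | SingleLayerConverges c Ω ψ' p.1 p.2} :=
        measurableSet_integrable hψ'.measurable_retardedIntegrand.stronglyMeasurable
      refine (Measure.ae_prod_iff_ae_ae hm).2 ?_
      filter_upwards [ae_isGoodPoint hΓ hψ'] with r hr using hr.ae_converges hc hψ'
    filter_upwards [hconv, hψ.equation, hret.2] with p h1 h2 h3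
    exact ⟨h1.congr (retardedIntegrand_ae_congr h3).symm, h2⟩

end

theorem SingleLayerConverges.mul_bounded {c : ℝ} {Ω : Set E3} {ψ : E3 → ℝ → ℝ} {r : E3} {t : ℝ}
    (h : SingleLayerConverges c Ω ψ r t) {k : ℝ → ℝ} (hk : Measurable k)
    (hk1 : ∀ s, |k s| ≤ 1) : SingleLayerConverges c Ω (fun y s => k s * ψ y s) r t := by
  have h1 : Integrable (fun y => k (t - ‖r - y‖ / c) * retardedIntegrand c ψ r t y)
      (surfaceMeasure Ω) :=
    Integrable.bdd_mul h (c := 1)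
      (hk.comp (by fun_prop : Measurable fun y : E3 => t - ‖r - y‖ / c)).aestronglyMeasurable
      (.of_forall fun y => hk1 _)
  refine h1.congr (.of_forall fun y => ?_)
  simp only [retardedIntegrand, mul_div_assoc]

theorem singleLayer_congr {c : ℝ} {Ω : Set E3} {ψ ψ' : E3 → ℝ → ℝ} {r : E3} {t : ℝ}
    (h : ∀ y ∈ frontier Ω, ψ y (t - ‖r - y‖ / c) = ψ' y (t - ‖r - y‖ / c)) :
    singleLayer c Ω ψ r t = singleLayer c Ω ψ' r t :=
  setIntegral_congr_fun isClosed_frontier.measurableSet fun y hy => by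
    simp only [retardedIntegrand, h y hy]

theorem AEOnClosure.mono {Ω : Set E3} {P Q : E3 → ℝ → Prop} (h : AEOnClosure Ω P)
    (hPQ : ∀ r ∈ closure Ω, ∀ t, P r t → Q r t) : AEOnClosure Ω Q := by
  refine ⟨fun r hr => (h.1 r hr).mono fun t => hPQ r (subset_closure hr) t, ?_⟩
  have hmem : ∀ᵐ p ∂surfaceTimeMeasure Ω, p.1 ∈ frontier Ω :=
    Measure.quasiMeasurePreserving_fst.ae (ae_restrict_mem isClosed_frontier.measurableSet)
  filter_upwards [h.2, hmem] with p hp hpm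
  exact hPQ p.1 (frontier_subset_closure hpm) p.2 hp

end RetardedScattering

end

/-! ### Support of `h_T` and the domain-of-dependence property -/

open RetardedScattering in
theorem lemma3p8 (c : ℝ) (hc : 0 < c) (Ω : Set E3) (hΩ : IsLipschitzObstacle Ω)
    (τ : ℝ) (hτ : 0 < τ) (wm wp : ℝ → ℝ) (hw : IsWindowPair τ wm wp) (T : ℝ)
    (Ωinc : Set E3) (b : E3 → ℝ → ℝ) (hb : IsIncidentField c Ω Ωinc b)
    (α : ℝ) (hbα : ∀ r ∈ closure Ω, ∀ t ≤ α, b r t = 0)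
    (ψ : E3 → ℝ → ℝ) (hψ : IsCausalDensity c Ω b α ψ)
    (hbT : ∀ r ∈ closure Ω, ∀ t ∈ dodInterval c Ω τ T ∪ Set.Ici T, b r t = 0) :
    -- the potentials below are given by convergent integrals
    AEOnClosure Ω (fun r t => SingleLayerConverges c Ω (psiMinus wm T ψ) r t ∧
      SingleLayerConverges c Ω (psiStar c Ω τ wm wp T ψ) r t) ∧
    -- `h_T = - S ψ_{*,T}` on the closure of `Ω` for all `t ≥ T - τ`
    (∀ r ∈ closure Ω, ∀ t, T - τ ≤ t →
      hT c Ω wm T b ψ r t = - singleLayer c Ω (psiStar c Ω τ wm wp T ψ) r t) ∧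
    -- `h_T = 0` for `t < T - τ`
    AEOnClosure Ω (fun r t => t < T - τ → hT c Ω wm T b ψ r t = 0) ∧
    -- the temporal support of `h_T` lies in `[T - τ, T + T_*]`
    AEOnClosure Ω (fun r t => t ∉ Set.Icc (T - τ) (T + crossingTime c Ω) →
      hT c Ω wm T b ψ r t = 0) ∧
    -- the solution for `t ≥ T` is determined by its restriction to `I_T`
    (∀ (Ωinc' : Set E3) (b' : E3 → ℝ → ℝ) (α' : ℝ) (ψ' : E3 → ℝ → ℝ),
      IsIncidentField c Ω Ωinc' b' →
      (∀ r ∈ closure Ω, ∀ t ≤ α', b' r t = 0) →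
      IsCausalDensity c Ω b' α' ψ' →
      (∀ r ∈ closure Ω, ∀ t ∈ dodInterval c Ω τ T ∪ Set.Ici T, b' r t = 0) →
      (∀ᵐ p ∂(surfaceTimeMeasure Ω), p.2 ∈ dodInterval c Ω τ T → ψ p.1 p.2 = ψ' p.1 p.2) →
      ∀ᵐ p ∂(surfaceTimeMeasure Ω), T ≤ p.2 → ψ p.1 p.2 = ψ' p.1 p.2) := by
  have hΓ := hΩ.hasLipschitzBoundary
  have hdist : ∀ r ∈ closure Ω, ∀ y ∈ frontier Ω, ‖r - y‖ / c ≤ crossingTime c Ω :=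
    fun r hr y hy => div_le_div_of_nonneg_right
      (norm_sub_le_diam_frontier hΩ.isOpen hΩ.isBounded hr hy) hc.le
  have hpos : ∀ r y : E3, 0 ≤ ‖r - y‖ / c := fun r y => by positivity
  have hT0 : 0 ≤ crossingTime c Ω := div_nonneg Metric.diam_nonneg hc.le
  have hmain := hψ.aeOnClosure hc hΩ hb hbα
  have hm1 : ∀ s, |wm s| ≤ 1 := fun s => by
    rw [abs_of_nonneg (hw.nonneg_minus s)]
    linarith [hw.add_eq_one s, hw.nonneg_plus s]
  have hp1 : ∀ s, |wp s| ≤ 1 := fun s => by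
    rw [abs_of_nonneg (hw.nonneg_plus s)]
    linarith [hw.add_eq_one s, hw.nonneg_minus s]
  have hmm := hw.measurable_minus
  have hmp := hw.measurable_plus
  -- This holds at every point, without an exceptional set: `b` vanishes there, and the two
  -- integrands agree on all of `Γ`, so non-convergent integrals receive the value `0` on both sides
  -- alike.
  have hlate : ∀ r ∈ closure Ω, ∀ t, T - τ ≤ t →
      hT c Ω wm T b ψ r t = - singleLayer c Ω (psiStar c Ω τ wm wp T ψ) r t := by
    intro r hr t ht
    rw [hT, hbT r hr t, zero_sub]
    · refine congrArg Neg.neg (singleLayer_congr fun y hy => ?_)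
      -- The delay is at most `T_*`, so retarded times are at least `T - τ - T_*` and the argument
      -- of `w₊` is nonnegative.
      rw [psiMinus, psiStar, hw.plus_eq_one _ (by linarith [hdist r hr y hy]), one_mul]
    · rcases lt_or_ge t T with h | h
      · exact Or.inl ⟨by linarith, h⟩
      · exact Or.inr h
  have hearly : AEOnClosure Ω (fun r t => t < T - τ → hT c Ω wm T b ψ r t = 0) := by
    refine hmain.mono fun r hr t h ht => ?_
    rw [hT, sub_eq_zero, ← h.2]
    refine singleLayer_congr fun y _ => ?_
    -- Retarded times precede `T - τ`, so the window does not alter the density and `Sψ = b`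
    -- applies.
    rw [psiMinus, hw.minus_eq_one _ (by linarith [hpos r y]), one_mul]
  refine ⟨hmain.mono fun r hr t h => ⟨?_, ?_⟩, hlate, hearly,
    hearly.mono fun r hr t h ht => ?_, ?_⟩
  · exact h.1.mul_bounded (k := fun s => wm (s - T)) (by fun_prop) fun s => hm1 _
  · refine h.1.mul_bounded (k := fun s => wp (s - T + crossingTime c Ω + τ) * wm (s - T))
      (by fun_prop) fun s => ?_
    rw [abs_mul]
    exact mul_le_one₀ (hp1 _) (abs_nonneg _) (hm1 _)
  · rcases lt_or_ge t (T - τ) with h1 | h1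
    · exact h h1
    · have h2 : T + crossingTime c Ω < t := not_le.1 fun h2 => ht ⟨h1, h2⟩
      rw [hlate r hr t h1, neg_eq_zero]
      rw [singleLayer_congr (ψ' := fun _ _ => 0) fun y hy => ?_]
      · simp [singleLayer, retardedIntegrand]
      -- After `T + T_*` every retarded time exceeds `T`, where `w₋` vanishes.
      · rw [psiStar, hw.minus_eq_zero _ (by linarith [hdist r hr y hy]), mul_zero, zero_mul]
  · intro Ωinc' b' α' ψ' hb' hbα' hψ' hbT' heq
    have hfin : IsFiniteMeasure (surfaceMeasure Ω) := hΓ.sFinite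
    have hmain' := hψ'.aeOnClosure hc hΩ hb' hbα'
    have hmT : MeasurableSet {p : E3 × ℝ | T ≤ p.2} := measurableSet_le measurable_const measurable_snd
    -- The difference is cut off sharply at `T`. Square integrability is all that injectivity
    -- requires, and this density is causal with starting time `T`.
    set δ : E3 → ℝ → ℝ := fun y s =>
      {p : E3 × ℝ | T ≤ p.2}.indicator (fun p => ψ p.1 p.2 - ψ' p.1 p.2) (y, s) with hδ
    have hδ1 : ∀ y s, T ≤ s → δ y s = ψ y s - ψ' y s := fun y s hs =>
      Set.indicator_of_mem (by exact hs) _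
    have hδ0 : ∀ y s, s < T → δ y s = 0 := fun y s hs =>
      Set.indicator_of_notMem (by exact not_le.2 hs) _
    have hzero := ae_eq_zero_of_singleLayer_eq_zero hc hΩ (α := T) (ψ := δ)
      (fun t₀ t₁ => ((hψ.locally_sq_integrable t₀ t₁).sub
        (hψ'.locally_sq_integrable t₀ t₁)).indicator hmT)
      (.of_forall fun p hp => hδ0 _ _ hp) ?_
    · filter_upwards [hzero] with p hp hpT
      rw [hδ1 _ _ hpT] at hp
      exact sub_eq_zero.1 hp
    · have hmem : ∀ᵐ p ∂surfaceTimeMeasure Ω, p.1 ∈ frontier Ω :=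
        Measure.quasiMeasurePreserving_fst.ae (ae_restrict_mem isClosed_frontier.measurableSet)
      filter_upwards [hmain.2, hmain'.2, (ae_retarded c heq).2, hmem] with p h h' hcone hpm
      have hpc := frontier_subset_closure hpm
      rcases lt_or_ge p.2 T with hpT | hpT
      · rw [singleLayer_congr (ψ' := fun _ _ => 0) fun y _ =>
          hδ0 _ _ ((sub_le_self _ (hpos _ _)).trans_lt hpT)]
        simp [singleLayer, retardedIntegrand]
      · have e : singleLayer c Ω δ p.1 p.2 = singleLayer c Ω ψ p.1 p.2 - singleLayer c Ω ψ' p.1 p.2 := by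
          rw [singleLayer, singleLayer, singleLayer, ← integral_sub h.1 h'.1]
          refine integral_congr_ae ?_
          filter_upwards [hcone, ae_restrict_mem isClosed_frontier.measurableSet] with y hy hyΓ
          rw [retardedIntegrand, retardedIntegrand, retardedIntegrand, ← sub_div]
          congr 1
          -- For `p.2 ≥ T` retarded times are at least `T - T_*`. Those before `T` therefore lie in
          -- `I_T`, where the densities agree, so the cutoff loses nothing.
          rcases lt_or_ge (p.2 - ‖p.1 - y‖ / c) T with hs | hs
          · rw [hδ0 _ _ hs, hy ⟨by linarith [hdist p.1 hpc y hyΓ], hs⟩, sub_self]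
          · exact hδ1 _ _ hs
        -- The potentials are `b` and `b'`, and both vanish for times at least `T`.
        rw [e, h.2, h'.2, hbT _ hpc _ (Or.inr hpT), hbT' _ hpc _ (Or.inr hpT), sub_self]
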